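/- Let $1\le k\le d-1$. Let $L_0\subset\mathbb R^{d+1}$ be a linear subspace of dimension $d-k+1$, let $v_1,\dots,v_k$ be linearly independent vectors which together with $L_0$ span $\mathbb R^{d+1}$, and put $v_0=0$, $L_i=L_0+v_i$. For $i=0,\dots,k$ let $F_i\subset L_i$ be a bounded closed strictly convex solid (with nonempty interior in $L_i$) whose boundary $E_i$ in $L_i$ is $C^\infty$ with nonvanishing Gaussian curvature. Call $(x_0,\dots,x_k)$ good if $x_i\in E_i$ for all $i$ and the outward unit normals to $E_i$ in $L_i$ at $x_i$ are all equal to one vector $m\in L_0$. Let $\eta(x_0,\dots,x_k)$ be the convex hull of $x_0,\dots,x_k$, let $S$ (the $k$-cone) be the union of all $\eta(x_0,\dots,x_k)$ over good tuples, $S_\delta=\{x:\operatorname{dist}(x,S)<\delta\}$, and $W=L_0+\operatorname{conv}(0,v_1,\dots,v_k)$. Then the following hold. (1) Let $L$ be an affine subspace parallel to $L_0$ which meets $S$. Then $S\cap L$ is the boundary in $L$ of a bounded closed strictly convex solid with nonempty interior in $L$, and it is $C^\infty$ with nonvanishing Gaussian curvature. Every $\eta(x_0,\dots,x_k)$ with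 $(x_0,\dots,x_k)$ good meets $L$ in exactly one point $x$. The map $x_0\mapsto x$ is smooth on $E_0$, and the outward unit normal to $S\cap L$ in $L$ at $x$ equals the outward unit normal to $E_0$ in $L_0$ at $x_0$. (2) For good tuples the points $x_0,\dots,x_k$ are affinely independent, and $\eta(x_0,\dots,x_k)\cap\eta(y_0,\dots,y_k)=\emptyset$ for distinct good tuples. Hence each $a\in S$ lies in $\eta(x_0,\dots,x_k)$ for exactly one good tuple; write $\eta(a)$ for this $k$-plane. (3) $S$ is a smooth hypersurface, up to its boundary: each $a\in S$ has an open neighbourhood $U$ and a $C^\infty$ function $\rho:U\to\mathbb R$ with $D\rho(a)|_{L_0}\neq0$ such that $S\cap U=\{z\in U\cap W:\rho(z)=0\}$. (4) There is a continuous unit normal field $n$ on $S$ for which the following statements (5) and (6) hold. For $a\in S$, a sector at $a$ with sides $(C_1\delta,C_2\delta^{1/2},C_3)$ is a rectangular box centered at $a$ with one side of length $C_1\delta$ in the direction $n(a)$, $k$ sides of length $C_3$ parallel to $\eta(a)$, and $d-k$ sides of length $C_2\delta^{1/2}$ in the directions tangent to $S$ and perpendicular to $\eta(a)$. At every $a\in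 S$ such boxes exist. Given sets ${\cal M}_\delta\subset S$ ($0<\delta\le\delta_0$) and sectors $\Pi_{a,\delta}$ at $a\in{\cal M}_\delta$, with sides $(C_1\delta,C_2\delta^{1/2},C_3)$, consider the following conditions for $0<\delta\le\delta_0$, with all constants independent of $\delta,\sigma,a,b,x$; here $t\Pi$ is the dilate of $\Pi$ by $t$ about its center. (a) $S_\delta\subset\bigcup_{a\in{\cal M}_\delta}\Pi_{a,\delta}$. (b) Finite overlap on a set $\Omega_\delta$: every $x\in\Omega_\delta$ lies in $\Pi_{a,\delta}$ for at most $K$ points $a\in{\cal M}_\delta$. (c) $c\,\Pi_{a,\delta}\subset S_\delta\cap\{x:|(x-a)\cdot n(a)|\le\delta\}$ for some $c>0$. (d) Angular separation: for every $A$ there is $N_A$ such that for every $a\in{\cal M}_\delta$ there are at most $N_A$ points $b\in{\cal M}_\delta$ with $|n(a)-n(b)|\le A\delta^{1/2}$. (e) Consistency: if $0<\delta\le\sigma\le\delta_0$, $a\in{\cal M}_\sigma$ and $b\in{\cal M}_\delta\cap\Pi_{a,\sigma}$, then $\Pi_{b,\delta}\subset C'\,\Pi_{a,\sigma}$. (5)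 $S$ satisfies Assumption (A): there are $\delta_0,C_1,C_2,C_3>0$, sets ${\cal M}_\delta\subset S$ and sectors $\Pi_{a,\delta}$ $(a\in{\cal M}_\delta)$ for which (a)-(e) hold with $\Omega_\delta=\mathbb R^{d+1}$. (6) The covering by sectors centered at the centers of mass. There is $C_0>0$ such that for every $C\ge C_0$ there are constants $c,C',c'>0$, $K$, $(N_A)_A$ with the following property. For $0<\delta\le1$ let ${\cal N}_\delta$ be any maximal $\delta^{1/2}$-separated subset of the unit sphere of $L_0$, let ${\cal M}_\delta$ be the set of centers of mass of those $\eta(x_0,\dots,x_k)$ for which $(x_0,\dots,x_k)$ is good with common normal in ${\cal N}_\delta$, and let $\Pi_{a,\delta}$ $(a\in{\cal M}_\delta)$ be any sectors with sides $(C\delta,C\delta^{1/2},C)$. Then (a)-(e) hold with $\delta_0=1$ and $\Omega_\delta=W\cup S_\delta$, and moreover $|n(a)-n(b)|\ge c'\delta^{1/2}$ for all distinct $a,b\in{\cal M}_\delta$. -/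

import Mathlib

open scoped ContDiff

noncomputable section

/-! ### Smooth strictly convex bodies in a finite-dimensional inner product space -/

section ConvexBodies

variable {V : Type*} [NormedAddCommGroup V] [InnerProductSpace ℝ V] [CompleteSpace V]

/-- `ρ` is a smooth local defining function of the solid `K` at its boundary point `x`:
near `x` the solid is `{ρ ≤ 0}`, and `ρ` vanishes at `x` with nonzero gradient. -/
def IsLocalDefiningFunction (K : Set V) (x : V) (ρ : V → ℝ) : Prop :=
  ρ x = 0 ∧ gradient ρ x ≠ 0 ∧
    ∃ U : Set V, IsOpen U ∧ x ∈ U ∧ ContDiffOn ℝ ∞ ρ U ∧ ∀ y ∈ U, (y ∈ K ↔ ρ y ≤ 0)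

/-- The tangent space at `x` of the level set of `ρ` through `x`. -/
def levelTangent (ρ : V → ℝ) (x : V) : Submodule ℝ V :=
  (Submodule.span ℝ {gradient ρ x})ᗮ

/-- The shape operator (with respect to the normal `∇ρ / ‖∇ρ‖`) of the level set of `ρ` through
`x`: the compression of the Hessian of `ρ` to the tangent space, divided by `‖∇ρ‖`. -/
def shapeOperator (ρ : V → ℝ) (x : V) : levelTangent ρ x →ₗ[ℝ] levelTangent ρ x :=
  ‖gradient ρ x‖⁻¹ •
    ((Submodule.span ℝ {gradient ρ x})ᗮ.orthogonalProjectionOnto.toLinearMap ∘ₗ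
      (fderiv ℝ (gradient ρ) x).toLinearMap ∘ₗ (levelTangent ρ x).subtype)

/-- The Gaussian curvature at `x` of the level set of `ρ` through `x`: the determinant of the
shape operator, i.e. the product of the principal curvatures. -/
def gaussianCurvature (ρ : V → ℝ) (x : V) : ℝ :=
  LinearMap.det (shapeOperator ρ x)

/-- `n` is the outward unit normal of the solid `K` at its boundary point `x`. -/
def IsOutwardUnitNormal (K : Set V) (x n : V) : Prop :=
  ∃ ρ : V → ℝ, IsLocalDefiningFunction K x ρ ∧ n = ‖gradient ρ x‖⁻¹ • gradient ρ x

/-- A bounded (closed) strictly convex solid whose boundary is a smooth hypersurface with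
nonvanishing Gaussian curvature. -/
structure IsSmoothStrictlyConvexBody (K : Set V) : Prop where
  isCompact : IsCompact K
  strictConvex : StrictConvex ℝ K
  interior_nonempty : (interior K).Nonempty
  smooth_boundary : ∀ x ∈ frontier K, ∃ ρ : V → ℝ, IsLocalDefiningFunction K x ρ
  curvature_ne_zero : ∀ x ∈ frontier K, ∀ ρ : V → ℝ,
    IsLocalDefiningFunction K x ρ → gaussianCurvature ρ x ≠ 0

end ConvexBodies

/-- A map is smooth on a subset `A` if near every point of `A` it agrees on `A` with a smooth map
defined on an open set of the ambient space. -/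
def SmoothOnSubset {V W : Type*} [NormedAddCommGroup V] [NormedSpace ℝ V]
    [NormedAddCommGroup W] [NormedSpace ℝ W] (f : V → W) (A : Set V) : Prop :=
  ∀ x ∈ A, ∃ U : Set V, IsOpen U ∧ x ∈ U ∧
    ∃ g : V → W, ContDiffOn ℝ ∞ g U ∧ ∀ y ∈ A ∩ U, f y = g y

/-- The ambient space `ℝ^(d+1)`. -/
abbrev Amb (d : ℕ) : Type := EuclideanSpace ℝ (Fin (d + 1))

/-- A continuous field of unit normals along `S`: at each point of `S` the vector is orthogonal
to all tangent directions of `S`. -/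
def IsUnitNormalField {d : ℕ} (S : Set (Amb d)) (n : Amb d → Amb d) : Prop :=
  ContinuousOn n S ∧
    ∀ a ∈ S, ‖n a‖ = 1 ∧ ∀ v ∈ tangentConeAt ℝ S a, inner ℝ v (n a) = 0

/-! ### `k`-cones -/

/-- The data from which a `k`-cone in `ℝ^(d+1)` is built: a `(d-k+1)`-dimensional linear subspace
`L₀`, vectors `v₁, …, v_k` spanning a complement of it, and in each of the parallel affine
subspaces `L₀, L₀ + v₁, …, L₀ + v_k` a bounded strictly convex solid `Fᵢ` whose boundary is smooth
with nonvanishing Gaussian curvature. -/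
structure KCone (d k : ℕ) where
  L₀ : Submodule ℝ (Amb d)
  finrank_L₀ : Module.finrank ℝ L₀ + k = d + 1
  v : Fin k → Amb d
  linearIndependent_v : LinearIndependent ℝ v
  span_eq_top : L₀ ⊔ Submodule.span ℝ (Set.range v) = ⊤
  F : Fin (k + 1) → Set (Amb d)
  /-- `F i` lies in `L i = L₀ + v i`, where `v 0 = 0`. -/
  F_subset : ∀ i, ∀ z ∈ F i, z - (Fin.cons 0 v : Fin (k + 1) → Amb d) i ∈ L₀
  body : ∀ i, IsSmoothStrictlyConvexBody
    {y : L₀ | (Fin.cons 0 v : Fin (k + 1) → Amb d) i + (y : Amb d) ∈ F i}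

namespace KCone

variable {d k : ℕ} (Q : KCone d k)

/-- The base points `0, v₁, …, v_k` of the affine subspaces `L₀, …, L_k`. -/
def base : Fin (k + 1) → Amb d := Fin.cons 0 Q.v

/-- The affine subspace `p + L₀`. -/
def parallel (p : Amb d) : Set (Amb d) := {z | z - p ∈ Q.L₀}

/-- The part of `A` in `p + L₀`, as a subset of `L₀` (translated by `-p`). -/
def section_ (p : Amb d) (A : Set (Amb d)) : Set Q.L₀ := {y | p + (y : Amb d) ∈ A}

/-- The `i`-th solid, as a subset of `L₀`. -/
def solid (i : Fin (k + 1)) : Set Q.L₀ := Q.section_ (Q.base i) (Q.F i)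

/-- The surface `E i`: the boundary of `F i` relative to `L i`. -/
def E (i : Fin (k + 1)) : Set (Amb d) :=
  {z | ∃ y ∈ frontier (Q.solid i), z = Q.base i + (y : Amb d)}

/-- `(x₀, …, x_k)` is a good tuple with common outward unit normal `n`: each `x i` is a point of
`E i` at which the outward unit normal to `E i` in `L i` is `n`. -/
def IsGoodWith (x : Fin (k + 1) → Amb d) (n : Q.L₀) : Prop :=
  ∀ i, ∃ y ∈ frontier (Q.solid i),
    x i = Q.base i + (y : Amb d) ∧ IsOutwardUnitNormal (Q.solid i) y n

/-- Good tuples. -/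
def IsGood (x : Fin (k + 1) → Amb d) : Prop := ∃ n : Q.L₀, Q.IsGoodWith x n

end KCone

/-- The `k`-plane `η(x₀, …, x_k)`. -/
def kPlane {d k : ℕ} (x : Fin (k + 1) → Amb d) : Set (Amb d) := convexHull ℝ (Set.range x)

/-- The center of mass of `η(x₀, …, x_k)`. -/
def centerOfMass {d k : ℕ} (x : Fin (k + 1) → Amb d) : Amb d := ((k : ℝ) + 1)⁻¹ • ∑ i, x i

/-- The rectangular box with center `a`, axes `e j` and side lengths `ℓ j`. -/
def rectBox {d : ℕ} (e : OrthonormalBasis (Fin (d + 1)) ℝ (Amb d)) (a : Amb d)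
    (ℓ : Fin (d + 1) → ℝ) : Set (Amb d) :=
  {x | ∀ j, |inner ℝ (e j) (x - a)| ≤ ℓ j / 2}

/-- The side lengths of a `δ`-sector: one side `C₁ δ`, then `d - k` sides `C₂ δ^(1/2)`, then `k`
sides `C₃`. -/
def sectorSides (d k : ℕ) (C₁ C₂ C₃ δ : ℝ) (j : Fin (d + 1)) : ℝ :=
  if (j : ℕ) = 0 then C₁ * δ else if (j : ℕ) + k ≤ d then C₂ * Real.sqrt δ else C₃

namespace KCone

variable {d k : ℕ} (Q : KCone d k)

/-- The `k`-cone `S`: the union of all `η(x₀, …, x_k)` over good tuples. -/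
def surface : Set (Amb d) := {z | ∃ x, Q.IsGood x ∧ z ∈ kPlane x}

/-- The union of those translates of `L₀` that meet the simplex with vertices
`0, v₁, …, v_k`. -/
def slab : Set (Amb d) := {z | ∃ w ∈ convexHull ℝ (Set.range Q.base), z - w ∈ Q.L₀}

/-- `e` is a possible system of axes of a sector centered at `a`: `e 0` is the unit normal `n a`,
and the last `k` axes are parallel to the `k`-plane through `a`.  By orthonormality the other
`d - k` axes are then tangent to `S` and perpendicular to that `k`-plane. -/
def IsSectorFrame (n : Amb d → Amb d) (a : Amb d)
    (e : OrthonormalBasis (Fin (d + 1)) ℝ (Amb d)) : Prop :=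
  e 0 = n a ∧ ∃ x, Q.IsGood x ∧ a ∈ kPlane x ∧
    ∀ j : Fin (d + 1), d < (j : ℕ) + k → e j ∈ vectorSpan ℝ (Set.range x)

/-- For `0 < δ ≤ δ₀`, the boxes with centers `a ∈ M δ`, axes `e δ a` and side lengths
`C₁ δ, C₂ δ^(1/2), …, C₂ δ^(1/2), C₃, …, C₃` form a covering of the `δ`-neighbourhood of `S` by
`δ`-sectors with the listed properties.  The overlap is counted at the points of `Ω δ`. -/
structure IsSectorCovering (n : Amb d → Amb d) (δ₀ : ℝ) (M : ℝ → Set (Amb d))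
    (e : ℝ → Amb d → OrthonormalBasis (Fin (d + 1)) ℝ (Amb d))
    (C₁ C₂ C₃ c C' : ℝ) (K : ℕ) (N : ℝ → ℕ) (Ω : ℝ → Set (Amb d)) : Prop where
  /-- The centers lie on `S`. -/
  centers : ∀ δ, 0 < δ → δ ≤ δ₀ → M δ ⊆ Q.surface
  /-- Directions of the axes. -/
  frame : ∀ δ, 0 < δ → δ ≤ δ₀ → ∀ a ∈ M δ, Q.IsSectorFrame n a (e δ a)
  /-- Covering of the `δ`-neighbourhood. -/
  cover : ∀ δ, 0 < δ → δ ≤ δ₀ → ∀ x ∈ Metric.thickening δ Q.surface,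
    ∃ a ∈ M δ, x ∈ rectBox (e δ a) a (sectorSides d k C₁ C₂ C₃ δ)
  /-- Finite overlap. -/
  overlap : ∀ δ, 0 < δ → δ ≤ δ₀ → ∀ x ∈ Ω δ,
    {a ∈ M δ | x ∈ rectBox (e δ a) a (sectorSides d k C₁ C₂ C₃ δ)}.encard ≤ K
  /-- The `c`-dilate of each sector lies in the `δ`-neighbourhood of `S` and in the `δ`-slab
  around the tangent plane. -/
  inner_box : ∀ δ, 0 < δ → δ ≤ δ₀ → ∀ a ∈ M δ,
    rectBox (e δ a) a (fun j => c * sectorSides d k C₁ C₂ C₃ δ j) ⊆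
      Metric.thickening δ Q.surface ∩ {x | |inner ℝ (x - a) (n a)| ≤ δ}
  /-- Angular separation. -/
  angular : ∀ A : ℝ, ∀ δ, 0 < δ → δ ≤ δ₀ → ∀ a ∈ M δ,
    {b ∈ M δ | ‖n a - n b‖ ≤ A * Real.sqrt δ}.encard ≤ N A
  /-- Consistency between scales. -/
  consistency : ∀ δ σ, 0 < δ → δ ≤ σ → σ ≤ δ₀ → ∀ a ∈ M σ, ∀ b ∈ M δ,
    b ∈ rectBox (e σ a) a (sectorSides d k C₁ C₂ C₃ σ) →
      rectBox (e δ b) b (sectorSides d k C₁ C₂ C₃ δ) ⊆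
        rectBox (e σ a) a (fun j => C' * sectorSides d k C₁ C₂ C₃ σ j)

/-- Assumption (A): for all sufficiently small `δ` the `δ`-neighbourhood of `S` has a covering by
`δ`-sectors, finitely overlapping in the whole space, with constants independent of `δ`. -/
def SatisfiesAssumptionA (n : Amb d → Amb d) : Prop :=
  ∃ (δ₀ C₁ C₂ C₃ c C' : ℝ) (K : ℕ) (N : ℝ → ℕ),
    0 < δ₀ ∧ 0 < C₁ ∧ 0 < C₂ ∧ 0 < C₃ ∧ 0 < c ∧ 0 < C' ∧
    ∃ (M : ℝ → Set (Amb d)) (e : ℝ → Amb d → OrthonormalBasis (Fin (d + 1)) ℝ (Amb d)),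
      Q.IsSectorCovering n δ₀ M e C₁ C₂ C₃ c C' K N (fun _ => Set.univ)

/-- `P` is a maximal `r`-separated subset of the unit sphere of `L₀`. -/
def IsMaximalSeparated (r : ℝ) (P : Set Q.L₀) : Prop :=
  P ⊆ Metric.sphere 0 1 ∧ (∀ m ∈ P, ∀ m' ∈ P, m ≠ m' → r ≤ dist m m') ∧
    ∀ m ∈ Metric.sphere (0 : Q.L₀) 1, ∃ m' ∈ P, dist m m' < r

/-- The centers of mass of the `k`-planes whose common normal belongs to `P`. -/
def centersOfMass (P : Set Q.L₀) : Set (Amb d) :=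
  {a | ∃ x, ∃ m ∈ P, Q.IsGoodWith x m ∧ a = centerOfMass x}

end KCone

end

noncomputable section

open Filter Topology

set_option linter.unusedSectionVars false

/-! ### The inverse function theorem -/

/-! Let `G i` send a unit vector `m` of `L₀` to the point of the `i`-th solid with outward normal
`m`. Nonvanishing curvature makes `G i` smooth, and everything else rests on the inequality `r / 2 *
‖m - m'‖ ^ 2 ≤ ⟪G m - G m', m⟫` for unit vectors, which expresses that balls of one radius `r` touch
the boundary from inside (`exists_tangent_ball`).

The inequality is linear in `G`, so every convex combination `∑ t i • G i` satisfies it. The slice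
of `S` with barycentric coordinates `t` is the image of the sphere under this combination.
Conversely, a smooth `0`-homogeneous `G` with the inequality is the inverse Gauss map of a smooth
strictly convex body with nonzero curvature (`IsGaussParam.isSmoothStrictlyConvexBody`): the radial
extension `radialMap` is strongly monotone, hence a local diffeomorphism, and the norm of its
inverse minus `1` is a defining function. This settles the sections. Disjointness of the `k`-planes
is injectivity of the combined map, and the radial extension carried out in all translates of `L₀`
at once (`tube`) makes `S` a hypersurface.

For the coverings, `err m z`, an element of `L₀`, measures how far `z` is from the affine span of
the `k`-plane with normal `m`. Up to constants, a sector at `a` on that plane is given by `|⟪err m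
z, m⟫| ≲ δ`, `‖err m z‖ ≲ √δ` and `‖z - a‖ ≲ C₃` (`mem_rectBox`, `of_mem_rectBox`). Changing `m`
changes `err` by a difference of values of the combined map, whose size is at most of order `‖m -
m'‖` and whose component along `m` is at most of order `‖m - m'‖ ^ 2`. Covering and consistency
follow. Finite overlap needs the reverse bound `‖m - m'‖ ≲ ‖G m - G m'‖` for the combination at the
given point. It holds for weights in the simplex and, by perturbation, for slightly negative weights
(`nondeg_of_neg_le`). Hence sectors of fixed length have their overlap counted only on `W ∪ S_δ`,
while sectors short along the `k`-planes give finite overlap everywhere, as Assumption (A) requires.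
-/

theorem exists_smooth_local_inverse {E F : Type*} [NormedAddCommGroup E] [NormedSpace ℝ E]
    [FiniteDimensional ℝ E] [NormedAddCommGroup F] [NormedSpace ℝ F] [FiniteDimensional ℝ F]
    (hdim : Module.finrank ℝ E = Module.finrank ℝ F)
    {f : E → F} {W : Set E} (hW : IsOpen W) (hf : ContDiffOn ℝ ∞ f W) {a : E} (ha : a ∈ W)
    (hinj : ∀ w, fderiv ℝ f a w = 0 → w = 0) :
    ∃ Φ : OpenPartialHomeomorph E F, a ∈ Φ.source ∧ Φ.source ⊆ W ∧ (∀ x, Φ x = f x) ∧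
      ContDiffOn ℝ ∞ Φ.symm Φ.target := by
  have : CompleteSpace E := FiniteDimensional.complete ℝ E
  have hfa : ∀ x ∈ W, ContDiffAt ℝ ∞ f x := fun x hx => hf.contDiffAt (hW.mem_nhds hx)
  have hker : LinearMap.ker (fderiv ℝ f a).toLinearMap = ⊥ := by
    rw [LinearMap.ker_eq_bot']
    exact hinj
  let f' : E ≃L[ℝ] F :=
    (LinearEquiv.ofInjectiveOfFinrankEq (fderiv ℝ f a).toLinearMap
      (LinearMap.ker_eq_bot.1 hker) hdim).toContinuousLinearEquiv
  have hf' : (f' : E →L[ℝ] F) = fderiv ℝ f a := by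
    ext w
    rfl
  have hstrict : HasStrictFDerivAt f (f' : E →L[ℝ] F) a := by
    rw [hf']
    exact (hfa a ha).hasStrictFDerivAt (by simp)
  have hcont : ContinuousAt (fderiv ℝ f) a :=
    ((hfa a ha).fderiv_right (m := 0) (by simp)).continuousAt
  -- Invertibility is an open condition. Shrinking the source to where it holds makes the inverse
  -- smooth on the whole target, not just at the image of `a`.
  have hnear : ∀ᶠ x in 𝓝 a, fderiv ℝ f x ∈ Set.range ((↑) : (E ≃L[ℝ] F) → (E →L[ℝ] F)) := by
    apply hcont.eventually
    rw [← hf']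
    exact ContinuousLinearEquiv.nhds f'
  obtain ⟨W', hW'sub, hW', haW'⟩ := mem_nhds_iff.1 (hnear.and (hW.mem_nhds ha))
  let Φ₀ := hstrict.toOpenPartialHomeomorph f
  refine ⟨Φ₀.restrOpen W' hW', ⟨hstrict.mem_toOpenPartialHomeomorph_source, haW'⟩, ?_, ?_, ?_⟩
  · intro x hx
    exact (hW'sub hx.2).2
  · intro x
    rfl
  · intro y hy
    set Φ := Φ₀.restrOpen W' hW' with hΦ
    have hx : Φ.symm y ∈ Φ.source := Φ.map_target hy
    have hxW : Φ.symm y ∈ W' := hx.2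
    obtain ⟨e, he⟩ := (hW'sub hxW).1
    have hd : HasFDerivAt Φ (e : E →L[ℝ] F) (Φ.symm y) := by
      rw [he]
      exact ((hfa _ (hW'sub hxW).2).differentiableAt (by simp)).hasFDerivAt
    exact (Φ.contDiffAt_symm hy hd (hfa _ (hW'sub hxW).2)).contDiffWithinAt

/-! ### Local defining functions -/

section Body

variable {V : Type*} [NormedAddCommGroup V] [InnerProductSpace ℝ V] [FiniteDimensional ℝ V]

theorem inner_gradient_eq (ρ : V → ℝ) (x w : V) :
    inner ℝ (gradient ρ x) w = fderiv ℝ ρ x w := by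
  simp [gradient]

theorem ContDiffOn.gradient_of_isOpen {ρ : V → ℝ} {U : Set V} (h : ContDiffOn ℝ ∞ ρ U)
    (hU : IsOpen U) : ContDiffOn ℝ ∞ (gradient ρ) U := by
  have := h.fderiv_of_isOpen (m := ∞) hU (by simp)
  exact (InnerProductSpace.toDual ℝ V).symm.toContinuousLinearEquiv.contDiff.comp_contDiffOn this

namespace IsLocalDefiningFunction

variable {K : Set V} {x : V} {ρ : V → ℝ}

theorem mem (h : IsLocalDefiningFunction K x ρ) : x ∈ K := by
  obtain ⟨h0, -, U, -, hx, -, hK⟩ := h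
  exact (hK x hx).2 h0.le

theorem differentiableAt (h : IsLocalDefiningFunction K x ρ) : DifferentiableAt ℝ ρ x := by
  obtain ⟨-, -, U, hU, hx, hs, -⟩ := h
  exact (hs.contDiffAt (hU.mem_nhds hx)).differentiableAt (by simp)

/-- The segment from `x` to `y` stays in `K`, so the right derivative of `ρ` along it at `x` is a
limit of nonpositive slopes. -/
theorem inner_gradient_sub_nonpos (h : IsLocalDefiningFunction K x ρ) (hK : Convex ℝ K)
    {y : V} (hy : y ∈ K) : inner ℝ (gradient ρ x) (y - x) ≤ 0 := by
  have hd := h.differentiableAt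
  have hxK := h.mem
  obtain ⟨h0, -, U, hU, hx, hs, hKU⟩ := h
  rw [inner_gradient_eq]
  have hline : HasDerivAt (fun s : ℝ => ρ (x + s • (y - x))) (fderiv ℝ ρ x (y - x)) 0 := by
    have h1 : HasDerivAt (fun s : ℝ => x + s • (y - x)) (y - x) 0 := by
      simpa using ((hasDerivAt_id (0 : ℝ)).smul_const (y - x)).const_add x
    have h2 : HasFDerivAt ρ (fderiv ℝ ρ x) (x + (0 : ℝ) • (y - x)) := by
      simpa using hd.hasFDerivAt
    exact h2.comp_hasDerivAt 0 h1
  have hlim := hline.hasDerivWithinAt (s := Set.Ioi 0)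
  rw [hasDerivWithinAt_iff_tendsto_slope' (by simp)] at hlim
  refine le_of_tendsto hlim ?_
  have hc : ContinuousAt (fun s : ℝ => x + s • (y - x)) 0 := by fun_prop
  have hU' : ∀ᶠ s in 𝓝 (0 : ℝ), x + s • (y - x) ∈ U := by
    apply hc.eventually_mem
    simpa using hU.mem_nhds hx
  filter_upwards [self_mem_nhdsWithin, nhdsWithin_le_nhds hU',
    nhdsWithin_le_nhds (Iio_mem_nhds (zero_lt_one' ℝ))] with s hs0 hsU hs1
  have hs0' : (0 : ℝ) < s := hs0
  have hs1' : s < 1 := hs1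
  have hmem : x + s • (y - x) ∈ K := by
    have := hK.add_smul_sub_mem hxK hy ⟨hs0'.le, hs1'.le⟩
    exact this
  have hle := (hKU _ hsU).1 hmem
  rw [slope_def_field]
  simp only [zero_smul, add_zero, h0, sub_zero]
  exact div_nonpos_of_nonpos_of_nonneg hle hs0'.le

theorem eventually_mem_of_inner_neg (h : IsLocalDefiningFunction K x ρ) {w : V}
    (hw : inner ℝ (gradient ρ x) w < 0) : ∀ᶠ s in 𝓝[>] (0 : ℝ), x + s • w ∈ K := by
  have hd := h.differentiableAt
  obtain ⟨h0, -, U, hU, hx, hs, hKU⟩ := h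
  rw [inner_gradient_eq] at hw
  have hline : HasDerivAt (fun s : ℝ => ρ (x + s • w)) (fderiv ℝ ρ x w) 0 := by
    have h1 : HasDerivAt (fun s : ℝ => x + s • w) w 0 := by
      simpa using ((hasDerivAt_id (0 : ℝ)).smul_const w).const_add x
    have h2 : HasFDerivAt ρ (fderiv ℝ ρ x) (x + (0 : ℝ) • w) := by
      simpa using hd.hasFDerivAt
    exact h2.comp_hasDerivAt 0 h1
  have hlim := hline.hasDerivWithinAt (s := Set.Ioi 0)
  rw [hasDerivWithinAt_iff_tendsto_slope' (by simp)] at hlim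
  have hc : ContinuousAt (fun s : ℝ => x + s • w) 0 := by fun_prop
  have hU' : ∀ᶠ s in 𝓝 (0 : ℝ), x + s • w ∈ U := by
    apply hc.eventually_mem
    simpa using hU.mem_nhds hx
  filter_upwards [self_mem_nhdsWithin, nhdsWithin_le_nhds hU',
    hlim.eventually (Iio_mem_nhds hw)] with s hs0 hsU hs1
  have hs0' : (0 : ℝ) < s := hs0
  rw [hKU _ hsU]
  have hs1' : slope (fun s : ℝ => ρ (x + s • w)) 0 s < 0 := hs1
  rw [slope_def_field] at hs1'
  simp only [zero_smul, add_zero, h0, sub_zero] at hs1'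
  by_contra hcon
  push Not at hcon
  exact absurd hs1' (not_lt.2 (div_nonneg hcon.le hs0'.le))

/-- A maximizer of a linear functional has its gradient along that functional. -/
theorem normal_eq_of_isMax (h : IsLocalDefiningFunction K x ρ) {n : V} (hn : ‖n‖ = 1)
    (hmax : ∀ y ∈ K, inner ℝ y n ≤ inner ℝ x n) : n = ‖gradient ρ x‖⁻¹ • gradient ρ x := by
  set g := gradient ρ x with hg
  have hg0 : g ≠ 0 := h.2.1
  -- A direction with `⟪g, w⟫ < 0` enters `K`, where `n` cannot increase. The open half-space of `g`
  -- thus lies in the closed half-space of `n`, which forces `n` to be a nonnegative multiple of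
  -- `g`.
  have key : ∀ w, inner ℝ g w < 0 → inner ℝ n w ≤ 0 := by
    intro w hw
    obtain ⟨s, hsK, hs0⟩ := ((h.eventually_mem_of_inner_neg hw).and self_mem_nhdsWithin).exists
    have hs0' : (0 : ℝ) < s := hs0
    have := hmax _ hsK
    rw [inner_add_left, inner_smul_left, real_inner_comm] at this
    simp at this
    exact nonpos_of_mul_nonpos_right (by rw [real_inner_comm]; linarith) hs0'
  have key' : ∀ w, inner ℝ g w ≤ 0 → inner ℝ n w ≤ 0 := by
    intro w hw
    have hpos : 0 < inner ℝ g g := real_inner_self_pos.2 hg0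
    have hlim : Tendsto (fun s : ℝ => inner ℝ n (w - s • g)) (𝓝[>] 0) (𝓝 (inner ℝ n w)) := by
      have : Continuous (fun s : ℝ => inner ℝ n (w - s • g)) := by fun_prop
      have := this.tendsto 0
      simp only [zero_smul, sub_zero] at this
      exact this.mono_left nhdsWithin_le_nhds
    refine le_of_tendsto hlim ?_
    filter_upwards [self_mem_nhdsWithin] with s hs
    apply key
    have hs0' : (0 : ℝ) < s := hs
    rw [inner_sub_right, inner_smul_right]
    nlinarith [mul_pos hs0' hpos]
  -- test with the component of `n` orthogonal to `g`
  have hgg : inner ℝ g g = ‖g‖ ^ 2 := real_inner_self_eq_norm_sq g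
  have hgn : 0 < ‖g‖ := norm_pos_iff.2 hg0
  set c := inner ℝ g n / ‖g‖ ^ 2 with hc
  have horth : inner ℝ g (n - c • g) = 0 := by
    rw [inner_sub_right, inner_smul_right, hgg, hc]
    field_simp
    ring
  have hzero : n - c • g = 0 := by
    have h1 := key' _ horth.le
    have h2 : inner ℝ (n - c • g) (n - c • g) = inner ℝ n (n - c • g) := by
      rw [inner_sub_left, inner_smul_left, horth]
      simp
    have h3 : inner ℝ (n - c • g) (n - c • g) ≤ 0 := h2 ▸ h1
    exact real_inner_self_nonpos.1 h3
  have hn' : n = c • g := sub_eq_zero.1 hzero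
  have hc0 : 0 ≤ c := by
    have h1 := key (-g) (by rw [inner_neg_right]; linarith [real_inner_self_pos.2 hg0])
    rw [inner_neg_right] at h1
    rw [hc, real_inner_comm]
    apply div_nonneg (by linarith) (by positivity)
  have hcn : c * ‖g‖ = 1 := by
    rw [hn', norm_smul, Real.norm_of_nonneg hc0] at hn
    exact hn
  rw [hn']
  congr 1
  field_simp
  linarith

end IsLocalDefiningFunction

/-- The boundary points of a smooth convex body with normal `n` are the maximizers of `n`. -/
theorem isOutwardUnitNormal_iff {K : Set V} (hK : IsSmoothStrictlyConvexBody K) {x n : V} :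
    (x ∈ frontier K ∧ IsOutwardUnitNormal K x n) ↔
      ‖n‖ = 1 ∧ x ∈ K ∧ ∀ y ∈ K, inner ℝ y n ≤ inner ℝ x n := by
  constructor
  · rintro ⟨-, ρ, hρ, hn⟩
    have hgn : 0 < ‖gradient ρ x‖ := norm_pos_iff.2 hρ.2.1
    refine ⟨?_, hρ.mem, fun y hy => ?_⟩
    · rw [hn, norm_smul, norm_inv, norm_norm, inv_mul_cancel₀ hgn.ne']
    · have := hρ.inner_gradient_sub_nonpos hK.strictConvex.convex hy
      rw [hn, inner_smul_right, inner_smul_right]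
      gcongr 1
      rw [inner_sub_right] at this
      rw [real_inner_comm, real_inner_comm (gradient ρ x) x]
      linarith
  · rintro ⟨hn, hx, hmax⟩
    have hfr : x ∈ frontier K := by
      rw [hK.isCompact.isClosed.frontier_eq]
      refine ⟨hx, fun hint => ?_⟩
      have hc : ContinuousAt (fun s : ℝ => x + s • n) 0 := by fun_prop
      have : ∀ᶠ s in 𝓝 (0 : ℝ), x + s • n ∈ interior K := by
        apply hc.eventually_mem
        simpa using isOpen_interior.mem_nhds hint
      have this' : ∀ᶠ s in 𝓝[>] (0 : ℝ), x + s • n ∈ interior K := nhdsWithin_le_nhds this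
      obtain ⟨s, hs, hs0⟩ := (this'.and self_mem_nhdsWithin).exists
      have hs0' : (0 : ℝ) < s := hs0
      have := hmax _ (interior_subset hs)
      rw [inner_add_left, inner_smul_left, real_inner_self_eq_norm_sq, hn] at this
      simp at this
      linarith
    obtain ⟨ρ, hρ⟩ := hK.smooth_boundary x hfr
    exact ⟨hfr, ρ, hρ, hρ.normal_eq_of_isMax hn hmax⟩

end Body

/-! ### The inverse Gauss map of a smooth strictly convex body -/

section GaussParam

variable {V : Type*} [NormedAddCommGroup V] [InnerProductSpace ℝ V]

theorem inner_sub_self_of_unit {m v : V} (hm : ‖m‖ = 1) (hv : ‖v‖ = 1) :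
    inner ℝ (v - m) v = ‖v - m‖ ^ 2 / 2 := by
  rw [norm_sub_sq_real, inner_sub_left, real_inner_self_eq_norm_sq, hm, hv,
    real_inner_comm v m]
  ring

theorem norm_inv_smul_self {u : V} (hu : u ≠ 0) : ‖‖u‖⁻¹ • u‖ = 1 := by
  rw [norm_smul, norm_inv, norm_norm, inv_mul_cancel₀ (norm_ne_zero_iff.2 hu)]

variable [FiniteDimensional ℝ V]

/-- A smooth `0`-homogeneous map which on the unit sphere is the inverse Gauss map of a convex body
containing tangent balls of radius `r`. -/
structure IsGaussParam (r : ℝ) (G : V → V) : Prop where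
  contDiffOn : ContDiffOn ℝ ∞ G {0}ᶜ
  homog : ∀ c : ℝ, 0 < c → ∀ u, G (c • u) = G u
  convex : ∀ m m', ‖m‖ = 1 → ‖m'‖ = 1 → r / 2 * ‖m - m'‖ ^ 2 ≤ inner ℝ (G m - G m') m

theorem shapeOperator_apply (ρ : V → ℝ) (x : V) (w : levelTangent ρ x) :
    shapeOperator ρ x w = (Submodule.span ℝ {gradient ρ x})ᗮ.orthogonalProjectionOnto
      (‖gradient ρ x‖⁻¹ • fderiv ℝ (gradient ρ) x (w : V)) := by
  rw [map_smul]
  rfl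

/-- One function serves all nearby boundary points: where `ρ < 0`, continuity would make the point
interior, so `ρ` vanishes on the boundary. -/
theorem IsLocalDefiningFunction.eventually_of_mem_frontier {K : Set V} (hK : IsClosed K) {x : V}
    {ρ : V → ℝ} (h : IsLocalDefiningFunction K x ρ) :
    ∀ᶠ y in 𝓝 x, y ∈ frontier K → IsLocalDefiningFunction K y ρ := by
  obtain ⟨h0, hg, U, hU, hx, hs, hKU⟩ := h
  have hgc : ContinuousAt (gradient ρ) x :=
    (hs.gradient_of_isOpen hU).continuousOn.continuousAt (hU.mem_nhds hx)
  filter_upwards [hU.mem_nhds hx, hgc.eventually_ne hg] with y hyU hgy hyf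
  refine ⟨?_, hgy, U, hU, hyU, hs, hKU⟩
  rw [hK.frontier_eq] at hyf
  by_contra hne
  have hlt : ρ y < 0 := lt_of_le_of_ne ((hKU y hyU).1 hyf.1) hne
  apply hyf.2
  rw [mem_interior_iff_mem_nhds]
  have hc : ContinuousAt ρ y := hs.continuousOn.continuousAt (hU.mem_nhds hyU)
  filter_upwards [hU.mem_nhds hyU, hc.eventually (Iio_mem_nhds hlt)] with z hzU hz
  exact (hKU z hzU).2 (le_of_lt hz)

namespace IsSmoothStrictlyConvexBody

variable {K : Set V}

theorem eq_of_isMax (hK : IsSmoothStrictlyConvexBody K) {u x y : V} (hu : u ≠ 0)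
    (hx : x ∈ K) (hxmax : ∀ z ∈ K, inner ℝ z u ≤ inner ℝ x u)
    (hy : y ∈ K) (hymax : ∀ z ∈ K, inner ℝ z u ≤ inner ℝ y u) : x = y := by
  by_contra hne
  have hxy : inner ℝ x u = inner ℝ y u := le_antisymm (hymax x hx) (hxmax y hy)
  have hint := hK.strictConvex hx hy hne (a := 1 / 2) (b := 1 / 2) (by norm_num) (by norm_num)
    (by norm_num)
  set z := (1 / 2 : ℝ) • x + (1 / 2 : ℝ) • y with hz
  have hzu : inner ℝ z u = inner ℝ x u := by
    rw [hz, inner_add_left, inner_smul_left, inner_smul_left, ← hxy]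
    simp
    ring
  have hc : ContinuousAt (fun s : ℝ => z + s • u) 0 := by fun_prop
  have h0 : ∀ᶠ s in 𝓝 (0 : ℝ), z + s • u ∈ interior K := by
    apply hc.eventually_mem
    simpa using isOpen_interior.mem_nhds hint
  have h1 : ∀ᶠ s in 𝓝[>] (0 : ℝ), z + s • u ∈ interior K := nhdsWithin_le_nhds h0
  obtain ⟨s, hs, hs0⟩ := (h1.and self_mem_nhdsWithin).exists
  have hs0' : (0 : ℝ) < s := hs0
  have := hxmax _ (interior_subset hs)
  rw [inner_add_left, hzu, inner_smul_left] at this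
  have hpos : 0 < inner ℝ u u := real_inner_self_pos.2 hu
  simp only [conj_trivial] at this
  nlinarith [mul_pos hs0' hpos]

theorem exists_isMax (hK : IsSmoothStrictlyConvexBody K) (u : V) :
    ∃ x ∈ K, ∀ z ∈ K, inner ℝ z u ≤ inner ℝ x u := by
  have hne : K.Nonempty := hK.interior_nonempty.mono interior_subset
  obtain ⟨x, hx, hmax⟩ := hK.isCompact.exists_isMaxOn hne
    (f := fun z => inner ℝ z u) (by fun_prop)
  exact ⟨x, hx, fun z hz => hmax hz⟩

variable {G : V → V}

/-- The maximizer solves the Lagrange system `μ • ∇ρ(x) = u / ‖u‖`, `ρ x = 0` in the unknowns `(x,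
μ)`. The linearized system is injective exactly because the shape operator is, so the inverse
function theorem gives a smooth solution. -/
theorem contDiffAt_of_isMax (hK : IsSmoothStrictlyConvexBody K) (hGK : ∀ u, G u ∈ K)
    (hG : ∀ u, ∀ z ∈ K, inner ℝ z u ≤ inner ℝ (G u) u) {u₀ : V} (hu₀ : u₀ ≠ 0) :
    ContDiffAt ℝ ∞ G u₀ := by
  set m₀ := ‖u₀‖⁻¹ • u₀ with hm₀
  have hm₀1 : ‖m₀‖ = 1 := norm_inv_smul_self hu₀
  have hmax₀ : ∀ z ∈ K, inner ℝ z m₀ ≤ inner ℝ (G u₀) m₀ := by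
    intro z hz
    rw [hm₀, inner_smul_right, inner_smul_right]
    gcongr 1
    exact hG u₀ z hz
  have hfr := (isOutwardUnitNormal_iff hK).2 ⟨hm₀1, hGK u₀, hmax₀⟩
  obtain ⟨ρ, hρ⟩ := hK.smooth_boundary _ hfr.1
  have hcurv := hK.curvature_ne_zero _ hfr.1 ρ hρ
  have hnormal := hρ.normal_eq_of_isMax hm₀1 hmax₀
  obtain ⟨h0, hg, U, hU, hxU, hs, hKU⟩ := hρ
  set x₀ := G u₀ with hx₀
  set g := gradient ρ x₀ with hgdef
  have hgn : 0 < ‖g‖ := norm_pos_iff.2 hg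
  have hgs : ContDiffOn ℝ ∞ (gradient ρ) U := hs.gradient_of_isOpen hU
  let F : V × ℝ → V × ℝ := fun q => (q.2 • gradient ρ q.1, ρ q.1)
  have hW : IsOpen (U ×ˢ (Set.univ : Set ℝ)) := hU.prod isOpen_univ
  have hF : ContDiffOn ℝ ∞ F (U ×ˢ (Set.univ : Set ℝ)) := by
    have h1 : ContDiffOn ℝ ∞ (fun q : V × ℝ => gradient ρ q.1) (U ×ˢ (Set.univ : Set ℝ)) :=
      hgs.comp contDiffOn_fst (fun q hq => hq.1)
    have h2 : ContDiffOn ℝ ∞ (fun q : V × ℝ => ρ q.1) (U ×ˢ (Set.univ : Set ℝ)) :=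
      hs.comp contDiffOn_fst (fun q hq => hq.1)
    exact (contDiffOn_snd.smul h1).prodMk h2
  have hgd : HasFDerivAt (gradient ρ) (fderiv ℝ (gradient ρ) x₀) x₀ :=
    ((hgs.contDiffAt (hU.mem_nhds hxU)).differentiableAt (by simp)).hasFDerivAt
  have hρd : HasFDerivAt ρ (fderiv ℝ ρ x₀) x₀ :=
    ((hs.contDiffAt (hU.mem_nhds hxU)).differentiableAt (by simp)).hasFDerivAt
  set H := fderiv ℝ (gradient ρ) x₀ with hH
  have hFd : HasFDerivAt F
      ((‖g‖⁻¹ • (H.comp (ContinuousLinearMap.fst ℝ V ℝ)) +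
        (ContinuousLinearMap.snd ℝ V ℝ).smulRight g).prod
        ((fderiv ℝ ρ x₀).comp (ContinuousLinearMap.fst ℝ V ℝ))) (x₀, ‖g‖⁻¹) := by
    have h1 : HasFDerivAt (fun q : V × ℝ => gradient ρ q.1)
        (H.comp (ContinuousLinearMap.fst ℝ V ℝ)) (x₀, ‖g‖⁻¹) :=
      HasFDerivAt.comp (x₀, ‖g‖⁻¹) (g := gradient ρ) hgd hasFDerivAt_fst
    have h2 : HasFDerivAt (fun q : V × ℝ => ρ q.1)
        ((fderiv ℝ ρ x₀).comp (ContinuousLinearMap.fst ℝ V ℝ)) (x₀, ‖g‖⁻¹) :=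
      HasFDerivAt.comp (x₀, ‖g‖⁻¹) (g := ρ) hρd hasFDerivAt_fst
    exact ((hasFDerivAt_snd (𝕜 := ℝ) (p := (x₀, ‖g‖⁻¹))).smul h1).prodMk h2
  have hshape : Function.Injective (shapeOperator ρ x₀) := by
    have := (LinearMap.equivOfDetNeZero (shapeOperator ρ x₀) hcurv).injective
    exact this
  obtain ⟨Φ, haΦ, hΦW, hΦ, hΦs⟩ := exists_smooth_local_inverse rfl hW hF
    (a := (x₀, ‖g‖⁻¹)) ⟨hxU, trivial⟩ (by
      rw [hFd.fderiv]
      rintro ⟨w, μ⟩ hw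
      simp only [ContinuousLinearMap.prod_apply, Prod.mk_eq_zero,
        add_apply, smul_apply,
        ContinuousLinearMap.comp_apply, ContinuousLinearMap.coe_fst',
        ContinuousLinearMap.smulRight_apply, ContinuousLinearMap.coe_snd'] at hw
      obtain ⟨hw1, hw2⟩ := hw
      rw [← inner_gradient_eq] at hw2
      have hwT : w ∈ levelTangent ρ x₀ := by
        rw [levelTangent, Submodule.mem_orthogonal_singleton_iff_inner_right]
        exact hw2
      -- The second equation makes `w` tangent. Projecting the first one to the tangent space
      -- removes the multiple of `g` and leaves the shape operator applied to `w`.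
      have hw0 : (⟨w, hwT⟩ : levelTangent ρ x₀) = 0 := by
        apply hshape
        rw [map_zero]
        have hHw : ‖g‖⁻¹ • H w = -(μ • g) := eq_neg_of_add_eq_zero_left hw1
        rw [shapeOperator_apply]
        change (Submodule.span ℝ {g})ᗮ.orthogonalProjectionOnto (‖g‖⁻¹ • H w) = 0
        rw [hHw, map_neg, neg_eq_zero]
        rw [Submodule.orthogonalProjectionOnto_eq_zero_iff]
        apply Submodule.le_orthogonal_orthogonal
        exact Submodule.smul_mem _ _ (Submodule.mem_span_singleton_self g)
      have hw0' : w = 0 := congrArg Subtype.val hw0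
      subst hw0'
      simp only [map_zero, smul_zero, zero_add, smul_eq_zero, hg, or_false] at hw1
      simp [hw1])
  have hFa : F (x₀, ‖g‖⁻¹) = (m₀, 0) := by
    simp only [F, h0, Prod.mk.injEq, and_true]
    exact hnormal.symm
  have hta : (m₀, (0 : ℝ)) ∈ Φ.target := by
    rw [← hFa, ← hΦ]
    exact Φ.map_source haΦ
  have hinva : Φ.symm (m₀, 0) = (x₀, ‖g‖⁻¹) := by
    rw [← hFa, ← hΦ]
    exact Φ.left_inv haΦ
  have hnrm : ContDiffAt ℝ ∞ (fun u : V => ((‖u‖⁻¹ • u, 0) : V × ℝ)) u₀ := by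
    have h1 : ContDiffAt ℝ ∞ (fun u : V => ‖u‖⁻¹) u₀ :=
      (contDiffAt_norm ℝ hu₀).inv (norm_ne_zero_iff.2 hu₀)
    exact (h1.smul contDiffAt_id).prodMk contDiffAt_const
  have hsymm : ContDiffAt ℝ ∞ Φ.symm ((fun u : V => ((‖u‖⁻¹ • u, 0) : V × ℝ)) u₀) :=
    hΦs.contDiffAt (Φ.open_target.mem_nhds hta)
  have hcomp : ContDiffAt ℝ ∞ (fun u : V => (Φ.symm (‖u‖⁻¹ • u, 0)).1) u₀ :=
    (hsymm.comp u₀ hnrm).fst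
  refine hcomp.congr_of_eventuallyEq ?_
  -- A critical point with negative multiplier would be a minimizer. By continuity the multiplier
  -- stays positive near `u₀`, and convexity then identifies the solution with the maximizer.
  have hpos : ∀ᶠ u in 𝓝 u₀, 0 < (Φ.symm (‖u‖⁻¹ • u, 0)).2 := by
    have hc : ContinuousAt (fun u : V => (Φ.symm (‖u‖⁻¹ • u, 0)).2) u₀ :=
      (hsymm.comp u₀ hnrm).snd.continuousAt
    apply hc.eventually_const_lt
    change 0 < (Φ.symm (m₀, 0)).2
    rw [hinva]
    positivity
  have htar : ∀ᶠ u in 𝓝 u₀, ((‖u‖⁻¹ • u, 0) : V × ℝ) ∈ Φ.target :=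
    hnrm.continuousAt.eventually_mem (Φ.open_target.mem_nhds hta)
  filter_upwards [hpos, htar, isOpen_ne.mem_nhds hu₀] with u hu1 hu2 hu3
  set q := Φ.symm (‖u‖⁻¹ • u, 0) with hq
  have hqs : q ∈ Φ.source := Φ.map_target hu2
  have hFq : F q = (‖u‖⁻¹ • u, 0) := by
    rw [← hΦ]
    exact Φ.right_inv hu2
  have hq1 : q.2 • gradient ρ q.1 = ‖u‖⁻¹ • u := congrArg Prod.fst hFq
  have hq2 : ρ q.1 = 0 := congrArg Prod.snd hFq
  have hu3' : u ≠ 0 := hu3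
  have hun : 0 < ‖u‖ := norm_pos_iff.2 hu3'
  have hgq : gradient ρ q.1 ≠ 0 := by
    intro hzero
    rw [hzero, smul_zero] at hq1
    exact smul_ne_zero (inv_ne_zero hun.ne') hu3' hq1.symm
  have hdef : IsLocalDefiningFunction K q.1 ρ :=
    ⟨hq2, hgq, U, hU, (hΦW hqs).1, hs, hKU⟩
  refine hK.eq_of_isMax hu3' (hGK u) (hG u) hdef.mem fun z hz => ?_
  have hle := hdef.inner_gradient_sub_nonpos hK.strictConvex.convex hz
  have hu' : u = (‖u‖ * q.2) • gradient ρ q.1 := by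
    rw [mul_smul, hq1, smul_smul, mul_inv_cancel₀ hun.ne', one_smul]
  rw [← sub_nonpos, ← inner_sub_left, real_inner_comm, hu', inner_smul_left]
  exact mul_nonpos_of_nonneg_of_nonpos (mul_pos hun hu1).le hle

/-- The points `G m + r • (v - m)` form the sphere of radius `r` tangent to the boundary at `G m`
from inside. If they all lie in `K`, comparing them with the maximizer `G v` in direction `v` gives
the inequality. They do for small `r`: the linear part of `ρ` contributes `-‖∇ρ‖ r ‖v - m‖² / 2`,
which beats the remainder `L r² ‖v - m‖²`. -/
theorem exists_tangent_ball (hK : IsSmoothStrictlyConvexBody K) (hGK : ∀ u, G u ∈ K)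
    (hG : ∀ u, ∀ z ∈ K, inner ℝ z u ≤ inner ℝ (G u) u) {m₀ : V} (hm₀ : ‖m₀‖ = 1) :
    ∃ r : ℝ, 0 < r ∧ ∀ᶠ m in 𝓝 m₀, ‖m‖ = 1 → ∀ v, ‖v‖ = 1 →
      r / 2 * ‖v - m‖ ^ 2 ≤ inner ℝ (G v - G m) v := by
  have hm₀0 : m₀ ≠ 0 := by
    rintro rfl
    simp at hm₀
  have hfrontier : ∀ m, ‖m‖ = 1 → G m ∈ frontier K := fun m hm =>
    ((isOutwardUnitNormal_iff hK).2 ⟨hm, hGK m, hG m⟩).1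
  obtain ⟨ρ, hρ⟩ := hK.smooth_boundary _ (hfrontier m₀ hm₀)
  have hev := hρ.eventually_of_mem_frontier hK.isCompact.isClosed
  obtain ⟨h0, hg, U, hU, hxU, hs, hKU⟩ := hρ
  have hGc : ContinuousAt G m₀ := (contDiffAt_of_isMax hK hGK hG hm₀0).continuousAt
  set x₀ := G m₀ with hx₀
  have hfd : ContDiffAt ℝ 1 (fderiv ℝ ρ) x₀ :=
    (hs.contDiffAt (hU.mem_nhds hxU)).fderiv_right (m := 1)
      (by norm_cast)
  obtain ⟨L, t, ht, hL⟩ := hfd.exists_lipschitzOnWith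
  obtain ⟨ε, hε, hball⟩ := Metric.mem_nhds_iff.1 (inter_mem ht (hU.mem_nhds hxU))
  set g₀ := ‖gradient ρ x₀‖ with hg₀
  have hg₀pos : 0 < g₀ := norm_pos_iff.2 hg
  have hgc : ContinuousAt (fun y => ‖gradient ρ y‖) x₀ :=
    ((hs.gradient_of_isOpen hU).continuousOn.continuousAt (hU.mem_nhds hxU)).norm
  set r := min (ε / 4) (g₀ / (4 * (L + 1))) with hr
  have hL1 : (0 : ℝ) < L + 1 := by positivity
  have hrpos : 0 < r := by
    apply lt_min <;> positivity
  -- As `‖v - m‖ ≤ 2`, the first bound keeps the point within `ε / 2` of `G m`. The second absorbs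
  -- the remainder, since `‖∇ρ‖ > g₀ / 2` nearby.
  have hr1 : r ≤ ε / 4 := min_le_left _ _
  have hr2 : (L : ℝ) * r ≤ g₀ / 4 := by
    have h1 : r ≤ g₀ / (4 * (L + 1)) := min_le_right _ _
    rw [le_div_iff₀ (by positivity)] at h1
    nlinarith
  refine ⟨r, hrpos, ?_⟩
  have hev1 : ∀ᶠ m in 𝓝 m₀, G m ∈ frontier K → IsLocalDefiningFunction K (G m) ρ :=
    hGc.eventually hev
  have hev2 : ∀ᶠ m in 𝓝 m₀, g₀ / 2 < ‖gradient ρ (G m)‖ :=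
    hGc.eventually (hgc.eventually_const_lt (by linarith))
  have hev3 : ∀ᶠ m in 𝓝 m₀, G m ∈ Metric.ball x₀ (ε / 2) :=
    hGc.eventually_mem (Metric.ball_mem_nhds _ (by positivity))
  filter_upwards [hev1, hev2, hev3] with m h1 h2 h3 hm v hv
  have hdef := h1 (hfrontier m hm)
  have hn := hdef.normal_eq_of_isMax hm (hG m)
  set x := G m with hx
  set g := ‖gradient ρ x‖ with hgdef
  have hgpos : 0 < g := by linarith
  have hgrad : gradient ρ x = g • m := by
    rw [hn, smul_smul, mul_inv_cancel₀ hgpos.ne', one_smul]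
  set y := x + r • (v - m) with hy
  have hyx : y - x = r • (v - m) := by rw [hy]; abel
  have hvm : ‖v - m‖ ≤ 2 := by
    calc ‖v - m‖ ≤ ‖v‖ + ‖m‖ := norm_sub_le _ _
      _ = 2 := by rw [hv, hm]; norm_num
  have hnyx : ‖y - x‖ = r * ‖v - m‖ := by
    rw [hyx, norm_smul, Real.norm_of_nonneg hrpos.le]
  have hyball : y ∈ Metric.ball x₀ ε := by
    have hdy : dist y x ≤ ε / 2 := by
      rw [dist_eq_norm, hnyx]
      nlinarith
    calc dist y x₀ ≤ dist y x + dist x x₀ := dist_triangle _ _ _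
      _ < ε / 2 + ε / 2 := add_lt_add_of_le_of_lt hdy h3
      _ = ε := by ring
  have hxball : x ∈ Metric.ball x₀ ε := Metric.ball_subset_ball (by linarith) h3
  have hseg : segment ℝ x y ⊆ Metric.ball x₀ ε :=
    (convex_ball x₀ ε).segment_subset hxball hyball
  have hmv := (convex_segment (𝕜 := ℝ) x y).norm_image_sub_le_of_norm_hasFDerivWithin_le'
    (f := ρ) (f' := fderiv ℝ ρ) (φ := fderiv ℝ ρ x) (C := L * ‖y - x‖)
    (fun z hz => ((hs.contDiffAt (hU.mem_nhds (hball (hseg hz)).2)).differentiableAt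
      (by simp)).hasFDerivAt.hasFDerivWithinAt)
    (fun z hz => by
      have h4 := hL.dist_le_mul z (hball (hseg hz)).1 x (hball hxball).1
      rw [dist_eq_norm, dist_eq_norm] at h4
      refine h4.trans ?_
      gcongr
      obtain ⟨s, hs0, rfl⟩ := (segment_eq_image' ℝ x y) ▸ hz
      simp only [add_sub_cancel_left, norm_smul, Real.norm_of_nonneg hs0.1]
      exact mul_le_of_le_one_left (norm_nonneg _) hs0.2)
    (left_mem_segment ℝ x y) (right_mem_segment ℝ x y)
  rw [hdef.1, sub_zero, ← inner_gradient_eq, hgrad, hyx, Real.norm_eq_abs] at hmv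
  have hin : inner ℝ m (v - m) = -(‖v - m‖ ^ 2 / 2) := by
    have h5 := inner_sub_self_of_unit hv hm
    rw [← neg_sub v m, inner_neg_left, norm_neg] at h5
    rw [real_inner_comm]
    linarith
  have hρy : ρ y ≤ 0 := by
    have h6 := (abs_le.1 hmv).2
    rw [inner_smul_left, inner_smul_right, hin, norm_smul, Real.norm_of_nonneg hrpos.le] at h6
    simp only [conj_trivial] at h6
    have h7 : 0 ≤ r * ‖v - m‖ ^ 2 := by positivity
    nlinarith [mul_nonneg h7 (by linarith : 0 ≤ g / 2 - L * r)]
  have hyK : y ∈ K := (hKU y (hball hyball).2).2 hρy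
  have hfin := hG v y hyK
  rw [hy, inner_add_left, inner_smul_left, inner_sub_self_of_unit hm hv] at hfin
  simp only [conj_trivial] at hfin
  rw [inner_sub_left]
  linarith

/-- The inverse Gauss map of a smooth strictly convex body. -/
theorem exists_isGaussParam (hK : IsSmoothStrictlyConvexBody K) :
    ∃ (r : ℝ) (G : V → V), 0 < r ∧ IsGaussParam r G ∧
      ∀ x n, (x ∈ frontier K ∧ IsOutwardUnitNormal K x n) ↔ ‖n‖ = 1 ∧ x = G n := by
  choose G hGK hG using hK.exists_isMax
  -- Compactness of the sphere turns the local radii into one.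
  have hball : ∃ r : ℝ, 0 < r ∧ ∀ m ∈ Metric.sphere (0 : V) 1, ∀ v, ‖v‖ = 1 →
      r / 2 * ‖v - m‖ ^ 2 ≤ inner ℝ (G v - G m) v := by
    refine (isCompact_sphere (0 : V) 1).induction_on
      (p := fun s => ∃ r : ℝ, 0 < r ∧ ∀ m ∈ s, ∀ v, ‖v‖ = 1 →
        r / 2 * ‖v - m‖ ^ 2 ≤ inner ℝ (G v - G m) v) ⟨1, one_pos, by simp⟩ ?_ ?_ ?_
    · rintro s t hst ⟨r, hr, h⟩
      exact ⟨r, hr, fun m hm => h m (hst hm)⟩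
    · rintro s t ⟨r, hr, h⟩ ⟨r', hr', h'⟩
      refine ⟨min r r', lt_min hr hr', fun m hm v hv => ?_⟩
      rcases hm with hm | hm
      · refine le_trans ?_ (h m hm v hv)
        gcongr
        exact min_le_left _ _
      · refine le_trans ?_ (h' m hm v hv)
        gcongr
        exact min_le_right _ _
    · intro m₀ hm₀
      obtain ⟨r, hr, h⟩ := exists_tangent_ball hK hGK hG (mem_sphere_zero_iff_norm.1 hm₀)
      refine ⟨{m | m ∈ Metric.sphere (0 : V) 1 ∧ ∀ v, ‖v‖ = 1 →
        r / 2 * ‖v - m‖ ^ 2 ≤ inner ℝ (G v - G m) v}, ?_, r, hr, fun m hm => hm.2⟩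
      filter_upwards [self_mem_nhdsWithin, nhdsWithin_le_nhds h] with m hm hm'
      exact ⟨hm, hm' (mem_sphere_zero_iff_norm.1 hm)⟩
  obtain ⟨r, hr, hrb⟩ := hball
  refine ⟨r, G, hr, ⟨?_, ?_, ?_⟩, ?_⟩
  · intro u hu
    exact (contDiffAt_of_isMax hK hGK hG hu).contDiffWithinAt
  · intro c hc u
    rcases eq_or_ne u 0 with rfl | hu
    · simp
    · refine hK.eq_of_isMax hu (hGK _) (fun z hz => ?_) (hGK _) (hG u)
      have := hG (c • u) z hz
      rw [inner_smul_right, inner_smul_right] at this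
      exact le_of_mul_le_mul_left this hc
  · intro m m' hm hm'
    exact hrb m' (mem_sphere_zero_iff_norm.2 hm') m hm
  · intro x n
    rw [isOutwardUnitNormal_iff hK]
    constructor
    · rintro ⟨hn, hx, hmax⟩
      refine ⟨hn, hK.eq_of_isMax ?_ hx hmax (hGK n) (hG n)⟩
      rintro rfl
      simp at hn
    · rintro ⟨hn, rfl⟩
      exact ⟨hn, hGK n, hG n⟩

end IsSmoothStrictlyConvexBody

end GaussParam

/-! ### From an inverse Gauss map back to the convex body -/

section GaussBody

variable {V : Type*} [NormedAddCommGroup V] [InnerProductSpace ℝ V]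

theorem inner_of_unit {m v : V} (hm : ‖m‖ = 1) (hv : ‖v‖ = 1) :
    inner ℝ m v = 1 - ‖m - v‖ ^ 2 / 2 := by
  rw [norm_sub_sq_real, hm, hv]
  ring

theorem norm_smul_sub_smul_sq {m v : V} (hm : ‖m‖ = 1) (hv : ‖v‖ = 1) (a b : ℝ) :
    ‖a • m - b • v‖ ^ 2 = (a - b) ^ 2 + a * b * ‖m - v‖ ^ 2 := by
  rw [norm_sub_sq_real, norm_sub_sq_real, norm_smul, norm_smul, inner_smul_left, inner_smul_right,
    hm, hv]
  simp only [Real.norm_eq_abs, mul_one, sq_abs, conj_trivial]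
  ring

theorem norm_smul_inv_smul (u : V) : ‖u‖ • ‖u‖⁻¹ • u = u := by
  rcases eq_or_ne u 0 with rfl | hu
  · simp
  · rw [smul_smul, mul_inv_cancel₀ (norm_ne_zero_iff.2 hu), one_smul]

/-- The difference quotients along `u + s • w` inherit the bound. A coercive derivative is
injective, as the inverse function theorem requires. -/
theorem inner_fderiv_ge_of_strongMono {f : V → V} {f' : V →L[ℝ] V} {u : V} {r : ℝ}
    (hf : HasFDerivAt f f' u)
    (hmono : ∀ᶠ u' in 𝓝 u, r * ‖u' - u‖ ^ 2 ≤ inner ℝ (f u' - f u) (u' - u)) (w : V) :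
    r * ‖w‖ ^ 2 ≤ inner ℝ (f' w) w := by
  have hline : HasDerivAt (fun s : ℝ => inner ℝ (f (u + s • w)) w) (inner ℝ (f' w) w) 0 := by
    have h1 : HasDerivAt (fun s : ℝ => u + s • w) w 0 := by
      simpa using ((hasDerivAt_id (0 : ℝ)).smul_const w).const_add u
    have h2 : HasFDerivAt f f' (u + (0 : ℝ) • w) := by simpa using hf
    have h3 := (h2.comp_hasDerivAt 0 h1).inner ℝ (hasDerivAt_const (0 : ℝ) w)
    simpa using h3
  have hlim := hline.hasDerivWithinAt (s := Set.Ioi 0)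
  rw [hasDerivWithinAt_iff_tendsto_slope' (by simp)] at hlim
  refine ge_of_tendsto hlim ?_
  have hc : ContinuousAt (fun s : ℝ => u + s • w) 0 := by fun_prop
  have hev : ∀ᶠ s in 𝓝 (0 : ℝ), r * ‖(u + s • w) - u‖ ^ 2 ≤
      inner ℝ (f (u + s • w) - f u) ((u + s • w) - u) := by
    have : Tendsto (fun s : ℝ => u + s • w) (𝓝 0) (𝓝 u) := by simpa [ContinuousAt] using hc
    exact this.eventually hmono
  filter_upwards [self_mem_nhdsWithin, nhdsWithin_le_nhds hev] with s hs0 hs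
  have hs0' : (0 : ℝ) < s := hs0
  rw [add_sub_cancel_left, norm_smul, inner_smul_right, inner_sub_left,
    Real.norm_of_nonneg hs0'.le] at hs
  rw [slope_def_field, zero_smul, add_zero, sub_zero, le_div_iff₀ hs0']
  nlinarith

/-- The intersection of the half-spaces determined by `G`. -/
def gaussBody (G : V → V) : Set V := {y | ∀ m, ‖m‖ = 1 → inner ℝ y m ≤ inner ℝ (G m) m}

/-- The radial extension of an inverse Gauss map to a neighbourhood of the sphere. -/
def radialMap (r : ℝ) (G : V → V) (u : V) : V := G u + (r - r * ‖u‖⁻¹) • u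

theorem radialMap_smul {r a : ℝ} {G : V → V} {m : V} (hG : G (a • m) = G m) (ha : 0 < a)
    (hm : ‖m‖ = 1) : radialMap r G (a • m) = G m + (r * (a - 1)) • m := by
  rw [radialMap, hG, norm_smul, hm, Real.norm_of_nonneg ha.le, smul_smul]
  congr 2
  field_simp

variable [FiniteDimensional ℝ V]

namespace IsGaussParam

variable {r : ℝ} {G : V → V}

theorem contDiffAt (h : IsGaussParam r G) {u : V} (hu : u ≠ 0) : ContDiffAt ℝ ∞ G u :=
  h.contDiffOn.contDiffAt (isOpen_compl_singleton.mem_nhds hu)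

theorem continuousOn_sphere (h : IsGaussParam r G) : ContinuousOn G (Metric.sphere 0 1) :=
  h.contDiffOn.continuousOn.mono fun m hm => by
    rintro rfl
    simp at hm

theorem apply_unit (h : IsGaussParam r G) {u : V} (hu : u ≠ 0) : G (‖u‖⁻¹ • u) = G u :=
  h.homog _ (inv_pos.2 (norm_pos_iff.2 hu)) u

theorem mem_gaussBody (h : IsGaussParam r G) (hr : 0 < r) {m : V} (hm : ‖m‖ = 1) :
    G m ∈ gaussBody G := by
  intro m' hm'
  have := h.convex m' m hm' hm
  rw [inner_sub_left] at this
  have h2 : 0 ≤ r / 2 * ‖m' - m‖ ^ 2 := by positivity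
  linarith

/-- Write `u = a • n` and `u' = b • m`. The convexity inequality, used in both orders, contributes
`(a + b) r / 2 * ‖n - m‖²`. The radial terms contribute `r * ‖u - u'‖²` minus exactly this amount,
so the factor `r / 2` is just what is needed. -/
theorem radialMap_strongMono (h : IsGaussParam r G) {u u' : V} (hu : u ≠ 0) (hu' : u' ≠ 0) :
    r * ‖u - u'‖ ^ 2 ≤ inner ℝ (radialMap r G u - radialMap r G u') (u - u') := by
  obtain ⟨a, n, ha, hn, rfl⟩ : ∃ (a : ℝ) (n : V), 0 < a ∧ ‖n‖ = 1 ∧ u = a • n :=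
    ⟨‖u‖, ‖u‖⁻¹ • u, norm_pos_iff.2 hu, norm_inv_smul_self hu, (norm_smul_inv_smul u).symm⟩
  obtain ⟨b, m, hb, hm, rfl⟩ : ∃ (b : ℝ) (m : V), 0 < b ∧ ‖m‖ = 1 ∧ u' = b • m :=
    ⟨‖u'‖, ‖u'‖⁻¹ • u', norm_pos_iff.2 hu', norm_inv_smul_self hu', (norm_smul_inv_smul u').symm⟩
  rw [radialMap_smul (h.homog a ha n) ha hn, radialMap_smul (h.homog b hb m) hb hm,
    norm_smul_sub_smul_sq hn hm]
  have h1 := h.convex n m hn hm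
  have h2 := h.convex m n hm hn
  rw [norm_sub_rev] at h2
  have h3 := inner_of_unit hn hm
  have e1 : inner ℝ n n = (1 : ℝ) := by rw [real_inner_self_eq_norm_sq, hn]; norm_num
  have e2 : inner ℝ m m = (1 : ℝ) := by rw [real_inner_self_eq_norm_sq, hm]; norm_num
  have e3 : inner ℝ m n = inner ℝ n m := real_inner_comm _ _
  simp only [inner_sub_left, inner_sub_right, inner_add_left, inner_smul_left, inner_smul_right,
    conj_trivial, e1, e2, e3] at h1 h2 ⊢
  rw [h3]
  nlinarith [mul_le_mul_of_nonneg_left h1 ha.le, mul_le_mul_of_nonneg_left h2 hb.le]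

theorem contDiffOn_radialMap (h : IsGaussParam r G) : ContDiffOn ℝ ∞ (radialMap r G) {0}ᶜ := by
  intro u hu
  have h1 : ContDiffAt ℝ ∞ (fun u : V => r - r * ‖u‖⁻¹) u :=
    contDiffAt_const.sub (contDiffAt_const.mul ((contDiffAt_norm ℝ hu).inv (norm_ne_zero_iff.2 hu)))
  exact ((h.contDiffAt hu).add (h1.smul contDiffAt_id)).contDiffWithinAt

theorem radialMap_unit {m : V} (hm : ‖m‖ = 1) : radialMap r G m = G m := by
  simp [radialMap, hm]

theorem radialMap_fderiv_injective (h : IsGaussParam r G) (hr : 0 < r) {u : V} (hu : u ≠ 0)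
    (w : V) (hw : fderiv ℝ (radialMap r G) u w = 0) : w = 0 := by
  have hd : HasFDerivAt (radialMap r G) (fderiv ℝ (radialMap r G) u) u :=
    ((h.contDiffOn_radialMap.contDiffAt (isOpen_compl_singleton.mem_nhds hu)).differentiableAt
      (by simp)).hasFDerivAt
  have h1 := inner_fderiv_ge_of_strongMono (r := r) hd (by
    filter_upwards [isOpen_ne.mem_nhds hu] with u' hu'
    exact h.radialMap_strongMono hu' hu) w
  rw [hw, inner_zero_left] at h1
  have : ‖w‖ ^ 2 ≤ 0 := nonpos_of_mul_nonpos_right h1 hr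
  exact norm_eq_zero.1 (pow_eq_zero_iff two_ne_zero |>.1 (le_antisymm this (sq_nonneg _)))

/-- For `‖u‖ ≤ 1` the point lies in the ball of radius `r` touching the body from inside at `G u`.
For `‖u‖ > 1` it violates the half-space with normal `u / ‖u‖`. -/
theorem radialMap_mem_gaussBody_iff (h : IsGaussParam r G) (hr : 0 < r) {u : V} (hu : u ≠ 0) :
    radialMap r G u ∈ gaussBody G ↔ ‖u‖ ≤ 1 := by
  obtain ⟨a, n, ha, hn, rfl⟩ : ∃ (a : ℝ) (n : V), 0 < a ∧ ‖n‖ = 1 ∧ u = a • n :=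
    ⟨‖u‖, ‖u‖⁻¹ • u, norm_pos_iff.2 hu, norm_inv_smul_self hu, (norm_smul_inv_smul u).symm⟩
  rw [radialMap_smul (h.homog a ha n) ha hn, norm_smul, hn, mul_one, Real.norm_of_nonneg ha.le]
  constructor
  · intro hmem
    have := hmem n hn
    rw [inner_add_left, inner_smul_left, real_inner_self_eq_norm_sq, hn] at this
    simp only [conj_trivial] at this
    by_contra hcon
    push Not at hcon
    nlinarith [mul_pos hr (sub_pos.2 hcon)]
  · intro ha1 m' hm'
    have h1 := h.convex m' n hm' hn
    rw [inner_sub_left] at h1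
    rw [inner_add_left, inner_smul_left, inner_of_unit hn hm', norm_sub_rev]
    simp only [conj_trivial]
    have h2 : ‖m' - n‖ ^ 2 ≥ 0 := sq_nonneg _
    nlinarith [mul_nonneg hr.le h2, mul_nonneg (mul_nonneg hr.le h2) ha.le,
      mul_nonneg hr.le (sub_nonneg.2 ha1)]

/-- The function `u ↦ ⟪G u, m⟫` is maximal at `u = m`. -/
theorem inner_fderiv_self (h : IsGaussParam r G) (hr : 0 < r) {m : V} (hm : ‖m‖ = 1) (w : V) :
    inner ℝ (fderiv ℝ G m w) m = 0 := by
  have hm0 : m ≠ 0 := by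
    rintro rfl
    simp at hm
  have hd : HasFDerivAt G (fderiv ℝ G m) m :=
    ((h.contDiffAt hm0).differentiableAt (by simp)).hasFDerivAt
  have hmax : IsLocalMax (fun u => inner ℝ (G u) m) m := by
    filter_upwards [isOpen_ne.mem_nhds hm0] with u hu
    have := h.mem_gaussBody hr (norm_inv_smul_self hu) m hm
    rwa [h.apply_unit hu] at this
  have := hmax.hasFDerivAt_eq_zero (hd.inner ℝ (hasFDerivAt_const m m))
  have := congrArg (fun f => f w) this
  simpa using this

/-- Envelope argument: `⟪G u, u⟫` is the support function, and its gradient is `G u` because the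
derivative of `G` is tangential. The difference `⟪G u - y, u⟫` is nonnegative near `m` and vanishes
at `m`, so its gradient `G m - y` is zero. -/
theorem eq_of_inner_eq (h : IsGaussParam r G) (hr : 0 < r) {m y : V} (hm : ‖m‖ = 1)
    (hy : y ∈ gaussBody G) (heq : inner ℝ y m = inner ℝ (G m) m) : y = G m := by
  have hm0 : m ≠ 0 := by
    rintro rfl
    simp at hm
  have hd : HasFDerivAt G (fderiv ℝ G m) m :=
    ((h.contDiffAt hm0).differentiableAt (by simp)).hasFDerivAt
  have hmin : IsLocalMin (fun u => inner ℝ (G u - y) u) m := by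
    filter_upwards [isOpen_ne.mem_nhds hm0] with u hu
    have h1 := hy _ (norm_inv_smul_self hu)
    rw [h.apply_unit hu, inner_smul_right, inner_smul_right] at h1
    have h2 := le_of_mul_le_mul_left h1 (inv_pos.2 (norm_pos_iff.2 hu))
    rw [inner_sub_left, inner_sub_left, heq, sub_self]
    linarith
  have hz := hmin.hasFDerivAt_eq_zero ((hd.sub_const y).inner ℝ (hasFDerivAt_id m))
  have hz' := congrArg (fun f => f (G m - y)) hz
  simp at hz'
  rw [← map_sub, h.inner_fderiv_self hr hm, add_zero] at hz'
  simp at hz'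
  exact (sub_eq_zero.1 hz').symm

theorem isClosed_gaussBody (G : V → V) : IsClosed (gaussBody G) := by
  have : gaussBody G = ⋂ m, ⋂ (_ : ‖m‖ = 1), {y | inner ℝ y m ≤ inner ℝ (G m) m} := by
    ext y
    simp [gaussBody]
  rw [this]
  exact isClosed_iInter fun m => isClosed_iInter fun _ =>
    isClosed_le (by fun_prop) continuous_const

theorem isCompact_gaussBody (h : IsGaussParam r G) : IsCompact (gaussBody G) := by
  obtain ⟨B, hB⟩ := (isCompact_sphere (0 : V) 1).exists_bound_of_continuousOn h.continuousOn_sphere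
  refine Metric.isCompact_of_isClosed_isBounded (isClosed_gaussBody G)
    ((Metric.isBounded_closedBall (x := (0 : V)) (r := max B 0)).subset fun y hy => ?_)
  rw [mem_closedBall_zero_iff]
  rcases eq_or_ne y 0 with rfl | hy0
  · simp
  · have h1 := norm_inv_smul_self hy0
    have h2 := hy _ h1
    have h3 : inner ℝ y (‖y‖⁻¹ • y) = ‖y‖ := by
      rw [inner_smul_right, real_inner_self_eq_norm_sq]
      field_simp
    rw [h3] at h2
    refine (h2.trans ((real_inner_le_norm _ _).trans ?_)).trans (le_max_left _ _)
    rw [h1, mul_one]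
    exact hB _ (mem_sphere_zero_iff_norm.2 h1)

theorem mem_interior_iff (h : IsGaussParam r G) {y : V} :
    y ∈ interior (gaussBody G) ↔ ∀ m, ‖m‖ = 1 → inner ℝ y m < inner ℝ (G m) m := by
  constructor
  · intro hy m hm
    have hc : ContinuousAt (fun s : ℝ => y + s • m) 0 := by fun_prop
    have h0 : ∀ᶠ s in 𝓝 (0 : ℝ), y + s • m ∈ interior (gaussBody G) := by
      apply hc.eventually_mem
      simpa using isOpen_interior.mem_nhds hy
    have h1 : ∀ᶠ s in 𝓝[>] (0 : ℝ), y + s • m ∈ interior (gaussBody G) := nhdsWithin_le_nhds h0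
    obtain ⟨s, hs, hs0⟩ := (h1.and self_mem_nhdsWithin).exists
    have hs0' : (0 : ℝ) < s := hs0
    have := interior_subset hs m hm
    rw [inner_add_left, inner_smul_left, real_inner_self_eq_norm_sq, hm] at this
    simp at this
    linarith
  · intro hy
    -- Compactness makes the gap in the strict inequalities uniform in `m`, so a ball of that radius
    -- fits.
    obtain ⟨ε, hε, hle⟩ := (isCompact_sphere (0 : V) 1).exists_forall_le'
      (f := fun m => inner ℝ (G m) m - inner ℝ y m) (a := 0)
      (ContinuousOn.sub (h.continuousOn_sphere.inner continuousOn_id)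
        (continuousOn_const.inner continuousOn_id))
      (fun m hm => sub_pos.2 (hy m (mem_sphere_zero_iff_norm.1 hm)))
    rw [mem_interior_iff_mem_nhds]
    refine Filter.mem_of_superset (Metric.ball_mem_nhds y hε) fun z hz m hm => ?_
    have h1 := hle m (mem_sphere_zero_iff_norm.2 hm)
    have h2 : inner ℝ (z - y) m ≤ ε := by
      refine (real_inner_le_norm _ _).trans ?_
      rw [hm, mul_one, ← dist_eq_norm]
      exact (Metric.mem_ball.1 hz).le
    rw [inner_sub_left] at h2
    linarith

theorem frontier_gaussBody (h : IsGaussParam r G) (hr : 0 < r) :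
    frontier (gaussBody G) = G '' Metric.sphere 0 1 := by
  ext y
  rw [(isClosed_gaussBody G).frontier_eq]
  constructor
  · rintro ⟨hy, hyi⟩
    rw [h.mem_interior_iff] at hyi
    push Not at hyi
    obtain ⟨m, hm, hle⟩ := hyi
    exact ⟨m, mem_sphere_zero_iff_norm.2 hm,
      (h.eq_of_inner_eq hr hm hy (le_antisymm (hy m hm) hle)).symm⟩
  · rintro ⟨m, hm, rfl⟩
    rw [mem_sphere_zero_iff_norm] at hm
    refine ⟨h.mem_gaussBody hr hm, fun hi => ?_⟩
    exact lt_irrefl _ (h.mem_interior_iff.1 hi m hm)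

/-- The defining function is `‖u‖ - 1` transported by the local inverse of `radialMap`. -/
theorem exists_isLocalDefiningFunction (h : IsGaussParam r G) (hr : 0 < r) {m : V}
    (hm : ‖m‖ = 1) : ∃ ρ, IsLocalDefiningFunction (gaussBody G) (G m) ρ := by
  have hm0 : m ≠ 0 := by
    rintro rfl
    simp at hm
  obtain ⟨Φ, hmΦ, hΦW, hΦ, hΦs⟩ := exists_smooth_local_inverse rfl isOpen_compl_singleton
    h.contDiffOn_radialMap (a := m) hm0 (fun w => h.radialMap_fderiv_injective hr hm0 w)
  have hta : G m ∈ Φ.target := by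
    have := Φ.map_source hmΦ
    rwa [hΦ, radialMap_unit hm] at this
  have hinv : Φ.symm (G m) = m := by
    have := Φ.left_inv hmΦ
    rwa [hΦ, radialMap_unit hm] at this
  have hne : ∀ y ∈ Φ.target, Φ.symm y ≠ 0 := fun y hy => hΦW (Φ.map_target hy)
  have hsm : ContDiffOn ℝ ∞ (fun y => ‖Φ.symm y‖ - 1) Φ.target :=
    (hΦs.norm ℝ hne).sub contDiffOn_const
  refine ⟨fun y => ‖Φ.symm y‖ - 1, by simp [hinv, hm], ?_, Φ.target, Φ.open_target, hta, hsm, ?_⟩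
  · intro hgrad
    have hd : HasFDerivAt (fun y => ‖Φ.symm y‖ - 1) (fderiv ℝ (fun y => ‖Φ.symm y‖ - 1) (G m))
        (G m) :=
      ((hsm.contDiffAt (Φ.open_target.mem_nhds hta)).differentiableAt (by simp)).hasFDerivAt
    have hline : HasDerivAt (fun s : ℝ => G m + (r * s) • m) (r • m) 0 := by
      have := (((hasDerivAt_id (0 : ℝ)).const_mul r).smul_const m).const_add (G m)
      simpa using this
    have hd' : HasFDerivAt (fun y => ‖Φ.symm y‖ - 1)
        (fderiv ℝ (fun y => ‖Φ.symm y‖ - 1) (G m)) (G m + (r * (0 : ℝ)) • m) := by simpa using hd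
    have hcomp := hd'.comp_hasDerivAt (0 : ℝ) hline
    rw [← inner_gradient_eq, hgrad, inner_zero_left] at hcomp
    -- Along the normal line `G m + (r * s) • m` the function equals `s`, so its gradient cannot
    -- vanish.
    have hev : (fun s : ℝ => s) =ᶠ[𝓝 0]
        (fun y => ‖Φ.symm y‖ - 1) ∘ (fun s : ℝ => G m + (r * s) • m) := by
      have hc : ContinuousAt (fun s : ℝ => (1 + s) • m) 0 := by fun_prop
      have hsrc : ∀ᶠ s in 𝓝 (0 : ℝ), (1 + s) • m ∈ Φ.source := by
        apply hc.eventually_mem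
        simpa using Φ.open_source.mem_nhds hmΦ
      filter_upwards [hsrc, Ioi_mem_nhds (show (-1 : ℝ) < 0 by norm_num)] with s hs hs1
      have hs1' : -1 < s := hs1
      have h1 := Φ.left_inv hs
      rw [hΦ, radialMap_smul (h.homog _ (by linarith) m) (by linarith) hm, add_sub_cancel_left] at h1
      simp only [Function.comp_apply, h1, norm_smul, hm, mul_one]
      rw [Real.norm_of_nonneg (by linarith)]
      ring
    have := (hcomp.congr_of_eventuallyEq hev).unique (hasDerivAt_id' (0 : ℝ))
    norm_num at this
  · intro y hy
    have h1 := h.radialMap_mem_gaussBody_iff hr (hne y hy)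
    have h2 := Φ.right_inv hy
    rw [hΦ] at h2
    rw [h2] at h1
    rw [h1, sub_nonpos]

/-- At a boundary point `G u` the gradient of `ρ` is a positive multiple of `u`. Differentiating
this at `m` shows that the Hessian composed with the derivative of `G` is `‖∇ρ‖ • id` modulo `m`.
After projection the derivative of `G` is a right inverse of the shape operator. -/
theorem gaussianCurvature_ne_zero (h : IsGaussParam r G) (hr : 0 < r) {m : V}
    (hm : ‖m‖ = 1) {ρ : V → ℝ} (hρ : IsLocalDefiningFunction (gaussBody G) (G m) ρ) :
    gaussianCurvature ρ (G m) ≠ 0 := by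
  have hm0 : m ≠ 0 := by
    rintro rfl
    simp at hm
  have hGd : HasFDerivAt G (fderiv ℝ G m) m :=
    ((h.contDiffAt hm0).differentiableAt (by simp)).hasFDerivAt
  have hGmem : ∀ u : V, u ≠ 0 → G u ∈ frontier (gaussBody G) := fun u hu => by
    rw [h.frontier_gaussBody hr, ← h.apply_unit hu]
    exact ⟨_, mem_sphere_zero_iff_norm.2 (norm_inv_smul_self hu), rfl⟩
  have hev := hGd.continuousAt.eventually
    (hρ.eventually_of_mem_frontier (isClosed_gaussBody G))
  have hNd : HasFDerivAt (fun u => gradient ρ (G u))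
      ((fderiv ℝ (gradient ρ) (G m)).comp (fderiv ℝ G m)) m := by
    obtain ⟨-, -, U, hU, hxU, hs, -⟩ := hρ
    have : HasFDerivAt (gradient ρ) (fderiv ℝ (gradient ρ) (G m)) (G m) :=
      (((hs.gradient_of_isOpen hU).contDiffAt (hU.mem_nhds hxU)).differentiableAt
        (by simp)).hasFDerivAt
    exact this.comp m hGd
  have hg : gradient ρ (G m) ≠ 0 := hρ.2.1
  have hnormal : ∀ᶠ u in 𝓝 m, gradient ρ (G u) = (‖gradient ρ (G u)‖ * ‖u‖⁻¹) • u := by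
    filter_upwards [hev, isOpen_ne.mem_nhds hm0] with u h1 hu
    have hu' : u ≠ 0 := hu
    have hdef := h1 (hGmem u hu)
    have h2 := hdef.normal_eq_of_isMax (norm_inv_smul_self hu') (fun y hy => by
      have := hy _ (norm_inv_smul_self hu')
      rwa [h.apply_unit hu'] at this)
    rw [mul_smul, h2, smul_smul, mul_inv_cancel₀ (norm_ne_zero_iff.2 hdef.2.1), one_smul]
  have hμd : DifferentiableAt ℝ (fun u => ‖gradient ρ (G u)‖ * ‖u‖⁻¹) m := by
    have h1 : DifferentiableAt ℝ (fun u => ‖gradient ρ (G u)‖) m :=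
      hNd.differentiableAt.norm ℝ hg
    have h2 : DifferentiableAt ℝ (fun u : V => ‖u‖⁻¹) m :=
      ((contDiffAt_norm (n := 1) ℝ hm0).differentiableAt (by simp)).inv (norm_ne_zero_iff.2 hm0)
    exact h1.mul h2
  have hNd2 := (hμd.hasFDerivAt.smul (hasFDerivAt_id m)).congr_of_eventuallyEq hnormal
  have hHA : ∀ w, fderiv ℝ (gradient ρ) (G m) (fderiv ℝ G m w) =
      ‖gradient ρ (G m)‖ • w +
        (fderiv ℝ (fun u => ‖gradient ρ (G u)‖ * ‖u‖⁻¹) m w) • m := by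
    intro w
    have := congrArg (fun f => f w) (hNd.unique hNd2)
    simpa [hm] using this
  have hgm : gradient ρ (G m) = ‖gradient ρ (G m)‖ • m := by
    have := hnormal.self_of_nhds
    rwa [hm, inv_one, mul_one] at this
  have hgn : 0 < ‖gradient ρ (G m)‖ := norm_pos_iff.2 hg
  have hmspan : m ∈ Submodule.span ℝ {gradient ρ (G m)} := by
    rw [Submodule.mem_span_singleton]
    refine ⟨‖gradient ρ (G m)‖⁻¹, ?_⟩
    nth_rw 2 [hgm]
    rw [smul_smul, inv_mul_cancel₀ hgn.ne', one_smul]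
  have hsurj : Function.Surjective (shapeOperator ρ (G m)) := by
    intro w
    have hmem : fderiv ℝ G m w ∈ levelTangent ρ (G m) := by
      change _ ∈ (Submodule.span ℝ {gradient ρ (G m)})ᗮ
      rw [Submodule.mem_orthogonal_singleton_iff_inner_left, hgm, inner_smul_right,
        h.inner_fderiv_self hr hm, mul_zero]
    refine ⟨⟨fderiv ℝ G m w, hmem⟩, ?_⟩
    rw [shapeOperator_apply, hHA, smul_add, smul_smul, inv_mul_cancel₀ hgn.ne', one_smul, map_add]
    have h1 : (Submodule.span ℝ {gradient ρ (G m)})ᗮ.orthogonalProjectionOnto (w : V) = w :=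
      Submodule.orthogonalProjectionOnto_mem_subspace_eq_self w
    have h2 : (Submodule.span ℝ {gradient ρ (G m)})ᗮ.orthogonalProjectionOnto
        (‖gradient ρ (G m)‖⁻¹ • fderiv ℝ (fun u => ‖gradient ρ (G u)‖ * ‖u‖⁻¹) m w • m) = 0 := by
      rw [Submodule.orthogonalProjectionOnto_eq_zero_iff]
      apply Submodule.le_orthogonal_orthogonal
      exact Submodule.smul_mem _ _ (Submodule.smul_mem _ _ hmspan)
    rw [h1, h2]
    exact add_zero w
  have hinj := LinearMap.injective_iff_surjective.2 hsurj
  exact (LinearEquiv.isUnit_det' (LinearEquiv.ofBijective _ ⟨hinj, hsurj⟩)).ne_zero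

theorem radialMap_injOn (h : IsGaussParam r G) (hr : 0 < r) {u u' : V} (hu : u ≠ 0)
    (hu' : u' ≠ 0) (heq : radialMap r G u = radialMap r G u') : u = u' := by
  have h1 := h.radialMap_strongMono hu hu'
  rw [heq, sub_self, inner_zero_left] at h1
  have h2 : ‖u - u'‖ ^ 2 ≤ 0 := nonpos_of_mul_nonpos_right h1 hr
  rw [← sub_eq_zero, ← norm_eq_zero]
  exact pow_eq_zero_iff two_ne_zero |>.1 (le_antisymm h2 (sq_nonneg _))

/-- The boundary deviates quadratically from its tangent planes. -/
theorem exists_norm_sub_le (h : IsGaussParam r G) (hr : 0 < r) {m w : V} (hm : ‖m‖ = 1)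
    (hw : inner ℝ w m = 0) : ∃ m', ‖m'‖ = 1 ∧ ‖G m + w - G m'‖ ≤ ‖w‖ ^ 2 / (2 * r) := by
  set z := G m + w with hz
  by_cases hzb : z ∈ gaussBody G
  · have : z = G m := h.eq_of_inner_eq hr hm hzb (by rw [hz, inner_add_left, hw, add_zero])
    exact ⟨m, hm, by rw [this, sub_self, norm_zero]; positivity⟩
  · have hconv : Convex ℝ (gaussBody G) := by
      intro x hx y hy a b ha hb hab m hm
      rw [inner_add_left, inner_smul_left, inner_smul_left]
      simp only [conj_trivial]
      have hb' : b = 1 - a := by linarith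
      subst hb'
      nlinarith [mul_le_mul_of_nonneg_left (hx m hm) ha, mul_le_mul_of_nonneg_left (hy m hm) hb]
    -- The nearest point `p` of the body is `G m'`, where `m'` is the direction from `p` to `z`. The
    -- distance is then at most `‖w‖ * ‖m' - m‖ - r / 2 * ‖m' - m‖²`, whose maximum over `‖m' - m‖`
    -- is `‖w‖² / (2 * r)`.
    obtain ⟨p, hp, hpz⟩ := exists_norm_eq_iInf_of_complete_convex ⟨_, h.mem_gaussBody hr hm⟩
      (isClosed_gaussBody G).isComplete hconv z
    rw [norm_eq_iInf_iff_real_inner_le_zero hconv hp] at hpz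
    have hne : z - p ≠ 0 := fun h0 => hzb (by rwa [sub_eq_zero.1 h0])
    have hpos : 0 < ‖z - p‖ := norm_pos_iff.2 hne
    set m' := ‖z - p‖⁻¹ • (z - p) with hm'
    have hm'1 : ‖m'‖ = 1 := norm_inv_smul_self hne
    have hpm : p = G m' := by
      refine h.eq_of_inner_eq hr hm'1 hp (le_antisymm (hp m' hm'1) ?_)
      have h1 := hpz _ (h.mem_gaussBody hr hm'1)
      rw [← sub_nonpos, ← inner_sub_left, hm', inner_smul_right, real_inner_comm]
      exact mul_nonpos_of_nonneg_of_nonpos (inv_nonneg.2 hpos.le) h1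
    refine ⟨m', hm'1, ?_⟩
    rw [← hpm]
    have h1 : ‖z - p‖ = inner ℝ (z - p) m' := by
      rw [hm', inner_smul_right, real_inner_self_eq_norm_sq]
      field_simp
    have h2 := h.convex m' m hm'1 hm
    have h3 : inner ℝ w m' ≤ ‖w‖ * ‖m' - m‖ := by
      have : inner ℝ w m' = inner ℝ w (m' - m) := by rw [inner_sub_right, hw, sub_zero]
      rw [this]
      exact real_inner_le_norm _ _
    rw [h1, hpm, hz, le_div_iff₀ (by positivity)]
    rw [inner_sub_left] at h2 ⊢
    rw [inner_add_left]
    nlinarith [sq_nonneg (‖w‖ - r * ‖m' - m‖), mul_le_mul_of_nonneg_left h2 hr.le]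

variable [Nontrivial V]

theorem isSmoothStrictlyConvexBody (h : IsGaussParam r G) (hr : 0 < r) :
    IsSmoothStrictlyConvexBody (gaussBody G) where
  isCompact := h.isCompact_gaussBody
  strictConvex := by
    intro x hx y hy hxy a b ha hb hab
    rw [h.mem_interior_iff]
    intro m hm
    rw [inner_add_left, inner_smul_left, inner_smul_left]
    simp only [conj_trivial]
    have h1 := hx m hm
    have h2 := hy m hm
    by_contra hcon
    push Not at hcon
    have hb' : b = 1 - a := by linarith
    subst hb'
    have h3 : inner ℝ x m = inner ℝ (G m) m := by
      refine le_antisymm h1 ?_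
      by_contra h4
      push Not at h4
      nlinarith [mul_pos ha (sub_pos.2 h4), mul_nonneg hb.le (sub_nonneg.2 h2)]
    have h5 : inner ℝ y m = inner ℝ (G m) m := by
      refine le_antisymm h2 ?_
      by_contra h4
      push Not at h4
      nlinarith [mul_pos hb (sub_pos.2 h4)]
    exact hxy ((h.eq_of_inner_eq hr hm hx h3).trans (h.eq_of_inner_eq hr hm hy h5).symm)
  interior_nonempty := by
    obtain ⟨m, hm⟩ := exists_norm_eq V (zero_le_one' ℝ)
    -- The centre of the inner tangent ball clears every supporting half-space by at least `r`.
    refine ⟨G m - r • m, h.mem_interior_iff.2 fun m' hm' => ?_⟩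
    have h1 := h.convex m' m hm' hm
    rw [inner_sub_left] at h1
    rw [inner_sub_left, inner_smul_left, inner_of_unit hm hm', norm_sub_rev]
    simp only [conj_trivial]
    nlinarith
  smooth_boundary := by
    intro x hx
    rw [h.frontier_gaussBody hr] at hx
    obtain ⟨m, hm, rfl⟩ := hx
    exact h.exists_isLocalDefiningFunction hr (mem_sphere_zero_iff_norm.1 hm)
  curvature_ne_zero := by
    intro x hx ρ hρ
    rw [h.frontier_gaussBody hr] at hx
    obtain ⟨m, hm, rfl⟩ := hx
    exact h.gaussianCurvature_ne_zero hr (mem_sphere_zero_iff_norm.1 hm) hρ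

theorem isOutwardUnitNormal (h : IsGaussParam r G) (hr : 0 < r) {m : V} (hm : ‖m‖ = 1) :
    G m ∈ frontier (gaussBody G) ∧ IsOutwardUnitNormal (gaussBody G) (G m) m :=
  (isOutwardUnitNormal_iff (h.isSmoothStrictlyConvexBody hr)).2
    ⟨hm, h.mem_gaussBody hr hm, fun _ hy => hy m hm⟩

end IsGaussParam

end GaussBody

/-! ### Stability under convex combinations, and injectivity with a constant -/

section GaussParamMore

variable {V : Type*} [NormedAddCommGroup V] [InnerProductSpace ℝ V]

namespace IsGaussParam

variable {r : ℝ} {G : V → V}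

theorem mono (h : IsGaussParam r G) {r' : ℝ} (hr : r' ≤ r) : IsGaussParam r' G where
  contDiffOn := h.contDiffOn
  homog := h.homog
  convex m m' hm hm' := le_trans (by gcongr) (h.convex m m' hm hm')

theorem sub_const (h : IsGaussParam r G) (c : V) : IsGaussParam r (fun u => G u - c) where
  contDiffOn := h.contDiffOn.sub contDiffOn_const
  homog a ha u := by simp only [h.homog a ha u]
  convex m m' hm hm' := by
    rw [sub_sub_sub_cancel_right]
    exact h.convex m m' hm hm'

/-- Each condition is stable under convex combinations; for the inequality this is linearity in `G`.
Geometrically, a Minkowski combination of bodies with inner tangent balls of radius `r` has such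
balls too. -/
theorem sum {ι : Type*} [Fintype ι] {G : ι → V → V} (h : ∀ i, IsGaussParam r (G i))
    {t : ι → ℝ} (ht : t ∈ stdSimplex ℝ ι) : IsGaussParam r (fun u => ∑ i, t i • G i u) where
  contDiffOn := ContDiffOn.sum fun i _ => (h i).contDiffOn.const_smul (t i)
  homog a ha u := by simp only [(h _).homog a ha u]
  convex m m' hm hm' := by
    rw [← Finset.sum_sub_distrib, sum_inner]
    calc r / 2 * ‖m - m'‖ ^ 2 = ∑ i, t i * (r / 2 * ‖m - m'‖ ^ 2) := by
          rw [← Finset.sum_mul, ht.2, one_mul]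
      _ ≤ ∑ i, inner ℝ (t i • G i m - t i • G i m') m := by
          refine Finset.sum_le_sum fun i _ => ?_
          rw [← smul_sub, inner_smul_left]
          exact mul_le_mul_of_nonneg_left ((h i).convex m m' hm hm') (ht.1 i)

/-- Add the inequality to its copy with `m` and `m'` exchanged, then apply Cauchy-Schwarz. Only the
inequality is assumed, so that weights outside the simplex are also allowed. -/
theorem norm_sub_ge (h : ∀ m m' : V, ‖m‖ = 1 → ‖m'‖ = 1 →
      r / 2 * ‖m - m'‖ ^ 2 ≤ inner ℝ (G m - G m') m) {m m' : V} (hm : ‖m‖ = 1)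
    (hm' : ‖m'‖ = 1) : r * ‖m - m'‖ ≤ ‖G m - G m'‖ := by
  rcases eq_or_ne m m' with rfl | hne
  · simp
  have hpos : 0 < ‖m - m'‖ := norm_pos_iff.2 (sub_ne_zero.2 hne)
  have h1 := h m m' hm hm'
  have h2 := h m' m hm' hm
  rw [norm_sub_rev, ← neg_sub (G m) (G m'), inner_neg_left] at h2
  have h3 := real_inner_le_norm (G m - G m') (m - m')
  rw [inner_sub_right] at h3
  refine le_of_mul_le_mul_right ?_ hpos
  nlinarith

theorem locallyLipschitzOn (h : IsGaussParam r G) :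
    LocallyLipschitzOn (Metric.sphere 0 1) G := by
  intro m hm
  have hm0 : m ≠ 0 := by
    rintro rfl
    simp at hm
  obtain ⟨K, t, ht, hK⟩ := (((h.contDiffOn.contDiffAt
    (isOpen_compl_singleton.mem_nhds hm0)).of_le (by simp) :
      ContDiffAt ℝ 1 G m)).exists_lipschitzOnWith
  exact ⟨K, t, mem_nhdsWithin_of_mem_nhds ht, hK⟩

end IsGaussParam

end GaussParamMore

/-! ### Coordinates adapted to a `k`-cone -/

namespace KCone

variable {d k : ℕ}

/-- Coordinates adapted to a `k`-cone (the projection `Y` to `L₀` along the `v i`, and the linear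
parts `σ` of the barycentric coordinates), together with the inverse Gauss maps `G` of its solids
and uniform constants for them. -/
structure Chart (Q : KCone d k) where
  Y : Amb d →L[ℝ] Q.L₀
  σ : Fin (k + 1) → Amb d →L[ℝ] ℝ
  G : Fin (k + 1) → Q.L₀ → Q.L₀
  r : ℝ
  B : ℝ
  decomp : ∀ z, (Y z : Amb d) + ∑ i, σ i z • Q.base i = z
  Y_coe : ∀ y : Q.L₀, Y y = y
  Y_base : ∀ i, Y (Q.base i) = 0
  σ_coe : ∀ i (y : Q.L₀), σ i y = 0
  -- The barycentric coordinates are affine, and at the origin, which is `Q.base 0`, the one of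
  -- index `0` equals `1`. Subtracting this constant leaves the linear `σ`.
  σ_base : ∀ i j, σ i (Q.base j) = (if i = j then 1 else 0) - (if i = 0 then 1 else 0)
  sum_σ : ∀ z, ∑ i, σ i z = 0
  r_pos : 0 < r
  gauss : ∀ i, IsGaussParam r (G i)
  one_le_B : 1 ≤ B
  card_le_B : (k : ℝ) + 1 ≤ B
  norm_Y_le : ∀ z, ‖Y z‖ ≤ B * ‖z‖
  abs_σ_le : ∀ i z, |σ i z| ≤ B * ‖z‖
  lip : ∀ i m m', ‖m‖ = 1 → ‖m'‖ = 1 → ‖G i m - G i m'‖ ≤ B * ‖m - m'‖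
  bound : ∀ i m, ‖m‖ = 1 → ‖G i m‖ ≤ B
  norm_base_le : ∀ i, ‖Q.base i‖ ≤ B
  good : ∀ x n, Q.IsGoodWith x n ↔ ‖n‖ = 1 ∧ x = fun i => Q.base i + (G i n : Amb d)

variable (Q : KCone d k)

theorem exists_coordinates : ∃ (Y : Amb d →L[ℝ] Q.L₀) (σ : Fin (k + 1) → Amb d →L[ℝ] ℝ),
    (∀ z, (Y z : Amb d) + ∑ i, σ i z • Q.base i = z) ∧ (∀ y : Q.L₀, Y y = y) ∧
    (∀ i, Y (Q.base i) = 0) ∧ (∀ i (y : Q.L₀), σ i y = 0) ∧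
    (∀ i j, σ i (Q.base j) = (if i = j then 1 else 0) - (if i = 0 then 1 else 0)) ∧
    ∀ z, ∑ i, σ i z = 0 := by
  let f : Q.L₀ × (Fin k → ℝ) →ₗ[ℝ] Amb d :=
    Q.L₀.subtype.coprod (Fintype.linearCombination ℝ Q.v)
  have hsurj : Function.Surjective f := by
    rw [← LinearMap.range_eq_top, LinearMap.range_coprod, Submodule.range_subtype,
      Fintype.range_linearCombination]
    exact Q.span_eq_top
  have hdim : Module.finrank ℝ (Q.L₀ × (Fin k → ℝ)) = Module.finrank ℝ (Amb d) := by
    rw [Module.finrank_prod, Module.finrank_fin_fun, Q.finrank_L₀]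
    simp
  have hinj : Function.Injective f :=
    (LinearMap.injective_iff_surjective_of_finrank_eq_finrank hdim).2 hsurj
  let Λ := LinearEquiv.ofBijective f ⟨hinj, hsurj⟩
  have hΛ : ∀ y t, Λ (y, t) = (y : Amb d) + ∑ j, t j • Q.v j := fun y t => rfl
  have hsymm_coe : ∀ y : Q.L₀, Λ.symm (y : Amb d) = (y, 0) := fun y => by
    rw [LinearEquiv.symm_apply_eq, hΛ]
    simp
  have hsymm_v : ∀ j, Λ.symm (Q.v j) = (0, Pi.single j 1) := fun j => by
    rw [LinearEquiv.symm_apply_eq, hΛ]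
    simp [Pi.single_apply]
  let Y : Amb d →L[ℝ] Q.L₀ := (LinearMap.fst ℝ _ _ ∘ₗ Λ.symm.toLinearMap).toContinuousLinearMap
  let τ : Fin k → Amb d →L[ℝ] ℝ := fun j =>
    (LinearMap.proj j ∘ₗ LinearMap.snd ℝ _ _ ∘ₗ Λ.symm.toLinearMap).toContinuousLinearMap
  have hY : ∀ z, Y z = (Λ.symm z).1 := fun z => rfl
  have hτ : ∀ j z, τ j z = (Λ.symm z).2 j := fun j z => rfl
  have hb0 : Q.base 0 = 0 := rfl
  have hbs : ∀ j, Q.base (Fin.succ j) = Q.v j := fun j => rfl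
  -- The barycentric coordinates sum to `1`, so their linear parts sum to `0`; this determines the
  -- entry of index `0`.
  refine ⟨Y, Fin.cons (-∑ j, τ j) τ, ?_, ?_, ?_, ?_, ?_, ?_⟩
  · intro z
    rw [Fin.sum_univ_succ]
    simp only [hb0, smul_zero, zero_add, Fin.cons_succ, hbs]
    have := Λ.apply_symm_apply z
    rw [← Prod.mk.eta (p := Λ.symm z), hΛ] at this
    exact this
  · intro y
    rw [hY, hsymm_coe]
  · intro i
    refine Fin.cases ?_ (fun j => ?_) i
    · rw [hb0, map_zero]
    · rw [hbs, hY, hsymm_v]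
  · intro i y
    refine Fin.cases ?_ (fun j => ?_) i
    · simp [hτ, hsymm_coe]
    · simp [hτ, hsymm_coe]
  · intro i j
    refine Fin.cases ?_ (fun j => ?_) j
    · rw [hb0, map_zero]
      simp
    · rw [hbs]
      refine Fin.cases ?_ (fun i => ?_) i
      · simp [hτ, hsymm_v, (Fin.succ_ne_zero j).symm]
      · simp [hτ, hsymm_v, Pi.single_apply]
  · intro z
    rw [Fin.sum_univ_succ]
    simp

theorem exists_chart : Nonempty Q.Chart := by
  obtain ⟨Y, σ, h1, h2, h3, h4, h5, h6⟩ := Q.exists_coordinates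
  have hbody : ∀ i, IsSmoothStrictlyConvexBody (Q.solid i) := Q.body
  choose r G hr hG hgood using fun i => (hbody i).exists_isGaussParam
  have hlip : ∀ i, ∃ K : NNReal, LipschitzOnWith K (G i) (Metric.sphere 0 1) := fun i =>
    (hG i).locallyLipschitzOn.exists_lipschitzOnWith_of_compact (isCompact_sphere _ _)
  choose K hK using hlip
  have hbd : ∀ i, ∃ C, ∀ m ∈ Metric.sphere (0 : Q.L₀) 1, ‖G i m‖ ≤ C := fun i =>
    (isCompact_sphere (0 : Q.L₀) 1).exists_bound_of_continuousOn (hG i).continuousOn_sphere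
  choose C hC using hbd
  obtain ⟨r₀, hr₀, hr₀le⟩ : ∃ r₀ : ℝ, 0 < r₀ ∧ ∀ i, r₀ ≤ r i := by
    obtain ⟨i, -, hi⟩ := Finset.exists_min_image Finset.univ r Finset.univ_nonempty
    exact ⟨r i, hr i, fun j => hi j (Finset.mem_univ j)⟩
  have hle : ∀ f : Fin (k + 1) → ℝ, ∀ i, f i ≤ ∑ j, |f j| := fun f i =>
    (le_abs_self _).trans (Finset.single_le_sum (f := fun j => |f j|)
      (fun j _ => abs_nonneg _) (Finset.mem_univ i))
  have hnn : ∀ f : Fin (k + 1) → ℝ, 0 ≤ ∑ j, |f j| := fun f =>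
    Finset.sum_nonneg fun j _ => abs_nonneg _
  set B : ℝ := 1 + k + ‖Y‖ + ∑ i, |‖σ i‖| + ∑ i, |(K i : ℝ)| + ∑ i, |C i| +
    ∑ i, |‖Q.base i‖| with hB
  have n1 := norm_nonneg Y
  have n2 := hnn (fun i => ‖σ i‖)
  have n3 := hnn (fun i => (K i : ℝ))
  have n4 := hnn C
  have n5 := hnn (fun i => ‖Q.base i‖)
  have n6 : (0 : ℝ) ≤ k := Nat.cast_nonneg k
  refine ⟨⟨Y, σ, G, r₀, B, h1, h2, h3, h4, h5, h6, hr₀, fun i => (hG i).mono (hr₀le i),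
    by linarith, by linarith, fun z => ?_, fun i z => ?_, fun i m m' hm hm' => ?_,
    fun i m hm => ?_, fun i => ?_, fun x n => ?_⟩⟩
  · refine (Y.le_opNorm z).trans ?_
    gcongr
    linarith
  · rw [← Real.norm_eq_abs]
    refine ((σ i).le_opNorm z).trans ?_
    gcongr
    linarith [hle (fun i => ‖σ i‖) i]
  · have := (hK i).dist_le_mul m (mem_sphere_zero_iff_norm.2 hm) m'
      (mem_sphere_zero_iff_norm.2 hm')
    rw [dist_eq_norm, dist_eq_norm] at this
    refine this.trans ?_
    gcongr
    linarith [hle (fun i => (K i : ℝ)) i]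
  · refine (hC i m (mem_sphere_zero_iff_norm.2 hm)).trans ?_
    linarith [hle C i]
  · linarith [hle (fun i => ‖Q.base i‖) i]
  · constructor
    · intro hx
      have : ∀ i, ‖n‖ = 1 ∧ x i = Q.base i + (G i n : Amb d) := fun i => by
        obtain ⟨y, hy, hxy, hn⟩ := hx i
        obtain ⟨hn1, rfl⟩ := (hgood i y n).1 ⟨hy, hn⟩
        exact ⟨hn1, hxy⟩
      exact ⟨(this 0).1, funext fun i => (this i).2⟩
    · rintro ⟨hn, rfl⟩ i
      have := (hgood i (G i n) n).2 ⟨hn, rfl⟩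
      exact ⟨G i n, this.1, rfl, this.2⟩

end KCone

/-! ### Parametrization of `S` by normals and barycentric coordinates -/

namespace KCone

variable {d k : ℕ} {Q : KCone d k}

namespace Chart

variable (c : Q.Chart)

/-- The good tuple with normal `m`. -/
def X (m : Q.L₀) (i : Fin (k + 1)) : Amb d := Q.base i + (c.G i m : Amb d)

/-- The point with barycentric coordinates `t` on the `k`-plane with normal `m`. -/
def pt (m : Q.L₀) (t : Fin (k + 1) → ℝ) : Amb d := ∑ i, t i • c.X m i

/-- The inverse Gauss map of the section with barycentric coordinates `t`. -/
def sectionG (t : Fin (k + 1) → ℝ) (m : Q.L₀) : Q.L₀ := ∑ i, t i • c.G i m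

/-- The barycentric coordinates of the translate of `L₀` through `z`. -/
def bary (z : Amb d) (i : Fin (k + 1)) : ℝ := c.σ i z + if i = 0 then 1 else 0

/-- The deviation of `z` from the affine span of the `k`-plane with normal `m`. -/
def err (m : Q.L₀) (z : Amb d) : Q.L₀ := c.Y z - c.sectionG (c.bary z) m

theorem isGoodWith_iff {x : Fin (k + 1) → Amb d} {n : Q.L₀} :
    Q.IsGoodWith x n ↔ ‖n‖ = 1 ∧ x = c.X n := c.good x n

theorem isGood_iff {x : Fin (k + 1) → Amb d} : Q.IsGood x ↔ ∃ m, ‖m‖ = 1 ∧ x = c.X m :=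
  exists_congr fun _ => c.isGoodWith_iff

theorem sum_bary (z : Amb d) : ∑ i, c.bary z i = 1 := by
  simp [bary, Finset.sum_add_distrib, c.sum_σ]

theorem Y_add_sum_bary (z : Amb d) : (c.Y z : Amb d) + ∑ i, c.bary z i • Q.base i = z := by
  simp only [bary, add_smul, Finset.sum_add_distrib]
  simp [show Q.base 0 = 0 from rfl, c.decomp]

theorem σ_sum_base {t : Fin (k + 1) → ℝ} (i : Fin (k + 1)) :
    c.σ i (∑ j, t j • Q.base j) = t i - if i = 0 then ∑ j, t j else 0 := by
  rw [map_sum]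
  simp only [map_smul, c.σ_base, smul_eq_mul, mul_sub, Finset.sum_sub_distrib]
  simp [Finset.sum_ite_eq]

theorem pt_eq (m : Q.L₀) (t : Fin (k + 1) → ℝ) :
    c.pt m t = (c.sectionG t m : Amb d) + ∑ i, t i • Q.base i := by
  simp only [pt, X, sectionG, smul_add, Finset.sum_add_distrib, Submodule.coe_sum,
    Submodule.coe_smul]
  rw [add_comm]

theorem Y_pt (m : Q.L₀) (t : Fin (k + 1) → ℝ) : c.Y (c.pt m t) = c.sectionG t m := by
  rw [pt_eq, map_add, c.Y_coe, map_sum]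
  simp [c.Y_base]

theorem σ_pt (m : Q.L₀) (t : Fin (k + 1) → ℝ) (i : Fin (k + 1)) :
    c.σ i (c.pt m t) = t i - if i = 0 then ∑ j, t j else 0 := by
  rw [pt_eq, map_add, c.σ_coe, zero_add, c.σ_sum_base]

theorem bary_pt (m : Q.L₀) {t : Fin (k + 1) → ℝ} (ht : ∑ i, t i = 1) : c.bary (c.pt m t) = t := by
  ext i
  rw [bary, σ_pt, ht]
  ring

theorem err_pt (m m' : Q.L₀) {t : Fin (k + 1) → ℝ} (ht : ∑ i, t i = 1) :
    c.err m' (c.pt m t) = c.sectionG t m - c.sectionG t m' := by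
  rw [err, Y_pt, bary_pt _ _ ht]

theorem bary_eq_iff {z p : Amb d} : c.bary z = c.bary p ↔ z - p ∈ Q.L₀ := by
  constructor
  · intro h
    rw [← c.Y_add_sum_bary z, ← c.Y_add_sum_bary p, h, add_sub_add_right_eq_sub]
    exact Submodule.sub_mem _ (SetLike.coe_mem _) (SetLike.coe_mem _)
  · intro h
    ext i
    have := c.σ_coe i ⟨z - p, h⟩
    simp only [map_sub, sub_eq_zero] at this
    simp [bary, this]

theorem mem_kPlane_iff {m : Q.L₀} {z : Amb d} :
    z ∈ kPlane (c.X m) ↔ ∃ t ∈ stdSimplex ℝ (Fin (k + 1)), z = c.pt m t := by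
  rw [kPlane, convexHull_range_eq_exists_affineCombination]
  constructor
  · rintro ⟨s, w, hw0, hw1, rfl⟩
    refine ⟨fun i => if i ∈ s then w i else 0, ⟨fun i => ?_, ?_⟩, ?_⟩
    · by_cases hi : i ∈ s
      · simp [hi, hw0 i hi]
      · simp [hi]
    · rw [Finset.sum_ite_mem, Finset.univ_inter, hw1]
    · rw [s.affineCombination_eq_linear_combination _ _ hw1]
      simp [pt, ite_smul, Finset.sum_ite_mem]
  · rintro ⟨t, ht, rfl⟩
    refine ⟨Finset.univ, t, fun i _ => ht.1 i, ht.2, ?_⟩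
    rw [Finset.univ.affineCombination_eq_linear_combination _ _ ht.2]
    rfl

theorem mem_surface_iff {z : Amb d} :
    z ∈ Q.surface ↔ ∃ m, ‖m‖ = 1 ∧ ∃ t ∈ stdSimplex ℝ (Fin (k + 1)), z = c.pt m t := by
  constructor
  · rintro ⟨x, hx, hz⟩
    obtain ⟨m, hm, rfl⟩ := c.isGood_iff.1 hx
    exact ⟨m, hm, c.mem_kPlane_iff.1 hz⟩
  · rintro ⟨m, hm, h⟩
    exact ⟨c.X m, c.isGood_iff.2 ⟨m, hm, rfl⟩, c.mem_kPlane_iff.2 h⟩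

theorem pt_mem_surface {m : Q.L₀} (hm : ‖m‖ = 1) {t : Fin (k + 1) → ℝ}
    (ht : t ∈ stdSimplex ℝ (Fin (k + 1))) : c.pt m t ∈ Q.surface :=
  c.mem_surface_iff.2 ⟨m, hm, t, ht, rfl⟩

theorem bary_mem_of_mem_surface {z : Amb d} (hz : z ∈ Q.surface) :
    c.bary z ∈ stdSimplex ℝ (Fin (k + 1)) := by
  obtain ⟨m, -, t, ht, rfl⟩ := c.mem_surface_iff.1 hz
  rwa [c.bary_pt _ ht.2]

theorem mem_slab_iff {z : Amb d} : z ∈ Q.slab ↔ c.bary z ∈ stdSimplex ℝ (Fin (k + 1)) := by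
  have hb : ∀ t : Fin (k + 1) → ℝ, ∑ i, t i = 1 → c.bary (∑ i, t i • Q.base i) = t := by
    intro t ht
    ext i
    rw [bary, σ_sum_base, ht]
    ring
  constructor
  · rintro ⟨w, hw, hzw⟩
    rw [c.bary_eq_iff.2 hzw]
    rw [convexHull_range_eq_exists_affineCombination] at hw
    obtain ⟨s, t, ht0, ht1, rfl⟩ := hw
    have hsum : ∑ i, (if i ∈ s then t i else 0) = 1 := by
      rw [Finset.sum_ite_mem, Finset.univ_inter, ht1]
    rw [s.affineCombination_eq_linear_combination _ _ ht1]
    have : ∑ i ∈ s, t i • Q.base i = ∑ i, (if i ∈ s then t i else 0) • Q.base i := by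
      simp [ite_smul, Finset.sum_ite_mem]
    rw [this, hb _ hsum]
    refine ⟨fun i => ?_, hsum⟩
    by_cases hi : i ∈ s
    · simp [hi, ht0 i hi]
    · simp [hi]
  · intro h
    refine ⟨∑ i, c.bary z i • Q.base i, ?_, ?_⟩
    · rw [convexHull_range_eq_exists_affineCombination]
      refine ⟨Finset.univ, c.bary z, fun i _ => h.1 i, h.2, ?_⟩
      rw [Finset.univ.affineCombination_eq_linear_combination _ _ h.2]
    · rw [sub_eq_of_eq_add (c.Y_add_sum_bary z).symm]
      exact SetLike.coe_mem _

theorem sectionG_isGaussParam {t : Fin (k + 1) → ℝ} (ht : t ∈ stdSimplex ℝ (Fin (k + 1))) :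
    IsGaussParam c.r (c.sectionG t) := IsGaussParam.sum c.gauss ht

theorem sectionG_injOn {t : Fin (k + 1) → ℝ} (ht : t ∈ stdSimplex ℝ (Fin (k + 1))) {m m' : Q.L₀}
    (hm : ‖m‖ = 1) (hm' : ‖m'‖ = 1) (h : c.sectionG t m = c.sectionG t m') : m = m' := by
  have := IsGaussParam.norm_sub_ge (c.sectionG_isGaussParam ht).convex hm hm'
  rw [h, sub_self, norm_zero] at this
  have h2 : ‖m - m'‖ ≤ 0 := nonpos_of_mul_nonpos_right this c.r_pos
  exact sub_eq_zero.1 (norm_le_zero_iff.1 h2)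

/-- Barycentric coordinates recover the weights. Once these agree, injectivity of the section's
inverse Gauss map recovers the normal. -/
theorem pt_inj {t t' : Fin (k + 1) → ℝ} (ht : t ∈ stdSimplex ℝ (Fin (k + 1)))
    (ht' : ∑ i, t' i = 1) {m m' : Q.L₀} (hm : ‖m‖ = 1) (hm' : ‖m'‖ = 1)
    (h : c.pt m t = c.pt m' t') : m = m' ∧ t = t' := by
  have h1 : t = t' := by rw [← c.bary_pt m ht.2, h, c.bary_pt m' ht']
  subst h1
  refine ⟨c.sectionG_injOn ht hm hm' ?_, rfl⟩
  rw [← Y_pt, h, Y_pt]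

/-! ### The simplices `η` -/

theorem affineIndependent_X (m : Q.L₀) : AffineIndependent ℝ (c.X m) := by
  rw [affineIndependent_iff]
  intro s w hw0 hw i hi
  have h1 : ∑ j, (if j ∈ s then w j else 0) = 0 := by
    rw [Finset.sum_ite_mem, Finset.univ_inter, hw0]
  have h2 : c.pt m (fun j => if j ∈ s then w j else 0) = 0 := by
    simp only [pt, ite_smul, zero_smul, Finset.sum_ite_mem, Finset.univ_inter]
    exact hw
  have h3 := c.σ_pt m (fun j => if j ∈ s then w j else 0) i
  rw [h2, map_zero, h1] at h3
  simpa [hi] using h3.symm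

theorem disjoint_kPlane {m m' : Q.L₀} (hm : ‖m‖ = 1) (hm' : ‖m'‖ = 1) (hne : m ≠ m') :
    Disjoint (kPlane (c.X m)) (kPlane (c.X m')) := by
  rw [Set.disjoint_left]
  intro z hz hz'
  obtain ⟨t, ht, rfl⟩ := c.mem_kPlane_iff.1 hz
  obtain ⟨t', ht', h⟩ := c.mem_kPlane_iff.1 hz'
  exact hne (c.pt_inj ht ht'.2 hm hm' h).1

/-! ### Sections parallel to `L₀` -/

/-- A translate of `L₀` fixes the barycentric coordinates, so only the normal varies and the slice
is the image of the sphere under one combined inverse Gauss map, shifted by `Y p`. -/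
theorem section_surface_eq [Nontrivial Q.L₀] {p : Amb d}
    (hp : c.bary p ∈ stdSimplex ℝ (Fin (k + 1))) :
    Q.section_ p Q.surface =
      frontier (gaussBody fun u => c.sectionG (c.bary p) u - c.Y p) := by
  rw [((c.sectionG_isGaussParam hp).sub_const (c.Y p)).frontier_gaussBody c.r_pos]
  ext y
  have hb : c.bary (p + (y : Amb d)) = c.bary p := c.bary_eq_iff.2 (by simp)
  change p + (y : Amb d) ∈ Q.surface ↔ _
  rw [c.mem_surface_iff]
  constructor
  · rintro ⟨m, hm, t, ht, h⟩
    refine ⟨m, mem_sphere_zero_iff_norm.2 hm, ?_⟩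
    have h1 : t = c.bary p := by rw [← hb, h, c.bary_pt m ht.2]
    have h2 := congrArg c.Y h
    rw [c.Y_pt, map_add, c.Y_coe, h1] at h2
    exact (eq_sub_of_add_eq' h2).symm
  · rintro ⟨m, hm, h⟩
    refine ⟨m, mem_sphere_zero_iff_norm.1 hm, c.bary p, hp, ?_⟩
    rw [← c.Y_add_sum_bary (p + (y : Amb d)), hb, map_add, c.Y_coe, c.pt_eq, ← h,
      add_sub_cancel]

theorem existsUnique_mem_parallel {m p} (hp : c.bary p ∈ stdSimplex ℝ (Fin (k + 1))) :
    ∃! z, z ∈ kPlane (c.X m) ∧ z ∈ Q.parallel p := by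
  refine ⟨c.pt m (c.bary p), ⟨c.mem_kPlane_iff.2 ⟨_, hp, rfl⟩, ?_⟩, ?_⟩
  · exact c.bary_eq_iff.1 (c.bary_pt m hp.2)
  · rintro z ⟨hz, hzp⟩
    obtain ⟨t, ht, rfl⟩ := c.mem_kPlane_iff.1 hz
    rw [← c.bary_eq_iff.2 hzp, c.bary_pt m ht.2]

theorem contDiffAt_pt (t : Fin (k + 1) → ℝ) {u : Q.L₀} (hu : u ≠ 0) :
    ContDiffAt ℝ ∞ (fun u => c.pt u t) u := by
  unfold pt X
  refine ContDiffAt.sum fun i _ => ContDiffAt.const_smul _ (contDiffAt_const.add ?_)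
  exact Q.L₀.subtypeL.contDiff.contDiffAt.comp u ((c.gauss i).contDiffAt hu)

/-- The map sends `z` to its normal and then to the point of the `k`-plane with weights `t`. On `E
0` the normal agrees locally with the inverse of `radialMap` applied to `Y z`, which is smooth on an
open set. -/
theorem exists_section_map (t : Fin (k + 1) → ℝ) :
    ∃ φ : Amb d → Amb d, SmoothOnSubset φ (Q.E 0) ∧
      ∀ m, ‖m‖ = 1 → φ (c.X m 0) = c.pt m t := by
  classical
  have hinj : ∀ m m', ‖m‖ = 1 → ‖m'‖ = 1 → c.G 0 m = c.G 0 m' → m = m' := by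
    intro m m' hm hm' h
    have := IsGaussParam.norm_sub_ge (c.gauss 0).convex hm hm'
    rw [h, sub_self, norm_zero] at this
    have h2 : ‖m - m'‖ ≤ 0 := nonpos_of_mul_nonpos_right this c.r_pos
    exact sub_eq_zero.1 (norm_le_zero_iff.1 h2)
  let N : Amb d → Q.L₀ := fun z => if h : ∃ m, ‖m‖ = 1 ∧ c.G 0 m = c.Y z then h.choose else 0
  have hYX : ∀ m, c.Y (c.X m 0) = c.G 0 m := fun m => by
    rw [X, map_add, c.Y_base, c.Y_coe, zero_add]
  have hN : ∀ m, ‖m‖ = 1 → N (c.X m 0) = m := by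
    intro m hm
    have hex : ∃ m', ‖m'‖ = 1 ∧ c.G 0 m' = c.Y (c.X m 0) := ⟨m, hm, (hYX m).symm⟩
    simp only [N, dif_pos hex]
    exact hinj _ _ hex.choose_spec.1 hm (hex.choose_spec.2.trans (hYX m))
  -- The chart describes only complete good tuples. A point of `E 0` is therefore compared with the
  -- first entry of the good tuple having the same normal.
  have hE : ∀ z ∈ Q.E 0, ∃ m, ‖m‖ = 1 ∧ z = c.X m 0 := by
    rintro z ⟨y, hy, rfl⟩
    have hb : IsSmoothStrictlyConvexBody (Q.solid 0) := Q.body 0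
    obtain ⟨ρ, hρ⟩ := hb.smooth_boundary y hy
    obtain ⟨r, G, -, -, hG⟩ := hb.exists_isGaussParam
    obtain ⟨hn, -⟩ := (hG y _).1 ⟨hy, ρ, hρ, rfl⟩
    set n := ‖gradient ρ y‖⁻¹ • gradient ρ y
    obtain ⟨y', hy', hXy', hn'⟩ := (c.isGoodWith_iff.2 ⟨hn, rfl⟩ : Q.IsGoodWith (c.X n) n) 0
    have h1 := (hG y n).1 ⟨hy, ρ, hρ, rfl⟩
    have h2 := (hG y' n).1 ⟨hy', hn'⟩
    exact ⟨n, hn, by rw [hXy', h1.2, h2.2]⟩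
  refine ⟨fun z => c.pt (N z) t, ?_, fun m hm => by simp only [hN m hm]⟩
  intro z hz
  obtain ⟨m₀, hm₀, rfl⟩ := hE z hz
  have hm₀0 : m₀ ≠ 0 := by
    rintro rfl
    simp at hm₀
  obtain ⟨Φ, hmΦ, hΦW, hΦ, hΦs⟩ := exists_smooth_local_inverse rfl isOpen_compl_singleton
    (c.gauss 0).contDiffOn_radialMap (a := m₀) hm₀0
    (fun w => (c.gauss 0).radialMap_fderiv_injective c.r_pos hm₀0 w)
  have hta : c.G 0 m₀ ∈ Φ.target := by
    have := Φ.map_source hmΦ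
    rwa [hΦ, IsGaussParam.radialMap_unit hm₀] at this
  refine ⟨c.Y ⁻¹' Φ.target, Φ.open_target.preimage c.Y.continuous, by
    rw [Set.mem_preimage, hYX]; exact hta, fun z => c.pt (Φ.symm (c.Y z)) t, ?_, ?_⟩
  · intro z hz
    have h1 : ContDiffAt ℝ ∞ (fun z => Φ.symm (c.Y z)) z :=
      ContDiffAt.comp (g := Φ.symm) z (hΦs.contDiffAt (Φ.open_target.mem_nhds hz))
        c.Y.contDiff.contDiffAt
    exact (ContDiffAt.comp z (c.contDiffAt_pt t (hΦW (Φ.map_target hz))) h1).contDiffWithinAt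
  · rintro z ⟨hzE, hzU⟩
    obtain ⟨m, hm, rfl⟩ := hE z hzE
    have hzU' : c.Y (c.X m 0) ∈ Φ.target := hzU
    have h2 := Φ.right_inv hzU'
    set u := Φ.symm (c.Y (c.X m 0)) with hu
    have hu0 : u ≠ 0 := hΦW (Φ.map_target hzU')
    have hm0 : m ≠ 0 := by
      rintro rfl
      simp at hm
    rw [hΦ, hYX, ← IsGaussParam.radialMap_unit (r := c.r) (G := c.G 0) hm] at h2
    have h5 : u = m := (c.gauss 0).radialMap_injOn c.r_pos hu0 hm0 h2
    change c.pt (N (c.X m 0)) t = c.pt u t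
    rw [hN m hm, h5]

theorem exists_section (c : Q.Chart) [Nontrivial Q.L₀] (p : Amb d) (hp : (Q.surface ∩ Q.parallel p).Nonempty) :
    ∃ K : Set Q.L₀, IsSmoothStrictlyConvexBody K ∧
      Q.section_ p Q.surface = frontier K ∧
      (∀ x, Q.IsGood x → ∃! z, z ∈ kPlane x ∧ z ∈ Q.parallel p) ∧
      ∃ φ : Amb d → Amb d, SmoothOnSubset φ (Q.E 0) ∧
        ∀ x m, Q.IsGoodWith x m →
          φ (x 0) ∈ kPlane x ∧
          ∃ y ∈ frontier K, φ (x 0) = p + (y : Amb d) ∧ IsOutwardUnitNormal K y m := by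
  obtain ⟨z, hzS, hzp⟩ := hp
  have hp' : c.bary p ∈ stdSimplex ℝ (Fin (k + 1)) := by
    rw [← c.bary_eq_iff.2 hzp]
    exact c.bary_mem_of_mem_surface hzS
  have hgp := (c.sectionG_isGaussParam hp').sub_const (c.Y p)
  refine ⟨_, hgp.isSmoothStrictlyConvexBody c.r_pos, c.section_surface_eq hp', ?_, ?_⟩
  · intro x hx
    obtain ⟨m, hm, rfl⟩ := c.isGood_iff.1 hx
    exact c.existsUnique_mem_parallel hp'
  · obtain ⟨φ, hφ, hφX⟩ := c.exists_section_map (c.bary p)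
    refine ⟨φ, hφ, fun x m hx => ?_⟩
    obtain ⟨hm, rfl⟩ := c.isGoodWith_iff.1 hx
    rw [hφX m hm]
    refine ⟨c.mem_kPlane_iff.2 ⟨_, hp', rfl⟩, _, (hgp.isOutwardUnitNormal c.r_pos hm).1, ?_,
      (hgp.isOutwardUnitNormal c.r_pos hm).2⟩
    rw [c.pt_eq, Submodule.coe_sub]
    rw [← add_sub_assoc, add_comm p, add_sub_assoc]
    congr 1
    exact eq_sub_of_add_eq' (c.Y_add_sum_bary p)

/-! ### The surface as a smooth hypersurface -/

/-- The radial extension, in every translate of `L₀`, of the parametrization of the surface. -/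
def tube (z : Amb d) : Amb d :=
  z - (c.Y z : Amb d) + ((radialMap c.r (c.sectionG (c.bary z)) (c.Y z) : Q.L₀) : Amb d)

theorem bary_tube (z : Amb d) : c.bary (c.tube z) = c.bary z := by
  rw [bary_eq_iff]
  have : c.tube z - z = ((radialMap c.r (c.sectionG (c.bary z)) (c.Y z) - c.Y z : Q.L₀) : Amb d) := by
    rw [tube, Submodule.coe_sub]
    abel
  rw [this]
  exact SetLike.coe_mem _

theorem Y_tube (z : Amb d) :
    c.Y (c.tube z) = radialMap c.r (c.sectionG (c.bary z)) (c.Y z) := by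
  rw [tube, map_add, map_sub, c.Y_coe, c.Y_coe, sub_self, zero_add]

theorem contDiff_bary (i : Fin (k + 1)) : ContDiff ℝ ∞ (fun z => c.bary z i) :=
  (c.σ i).contDiff.add contDiff_const

theorem contDiffOn_tube : ContDiffOn ℝ ∞ c.tube (c.Y ⁻¹' {0}ᶜ) := by
  intro z hz
  have hz0 : c.Y z ≠ 0 := hz
  have hY : ContDiffAt ℝ ∞ c.Y z := c.Y.contDiff.contDiffAt
  have h1 : ContDiffAt ℝ ∞ (fun z => c.sectionG (c.bary z) (c.Y z)) z := by
    unfold sectionG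
    exact ContDiffAt.sum fun i _ => (c.contDiff_bary i).contDiffAt.smul
      (((c.gauss i).contDiffAt hz0).comp z hY)
  have h2 : ContDiffAt ℝ ∞ (fun z => (c.r - c.r * ‖c.Y z‖⁻¹) • c.Y z) z :=
    (contDiffAt_const.sub (contDiffAt_const.mul
      ((hY.norm ℝ hz0).inv (norm_ne_zero_iff.2 hz0)))).smul hY
  have h3 : ContDiffAt ℝ ∞ (fun z => (c.Y z : Amb d)) z :=
    Q.L₀.subtypeL.contDiff.contDiffAt.comp z hY
  have h4 : ContDiffAt ℝ ∞
      (fun z => ((radialMap c.r (c.sectionG (c.bary z)) (c.Y z) : Q.L₀) : Amb d)) z :=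
    Q.L₀.subtypeL.contDiff.contDiffAt.comp z (h1.add h2)
  exact ((contDiffAt_id.sub h3).add h4).contDiffWithinAt

theorem isOpen_tube_domain : IsOpen (c.Y ⁻¹' {0}ᶜ) :=
  isOpen_compl_singleton.preimage c.Y.continuous

/-- The map preserves barycentric coordinates, so a kernel vector lies in `L₀`. On that translate of
`L₀` the map is `radialMap`, whose derivative is injective. -/
theorem tube_fderiv_injective {z : Amb d} (hz : c.Y z ≠ 0)
    (hb : c.bary z ∈ stdSimplex ℝ (Fin (k + 1))) (w : Amb d)
    (hw : fderiv ℝ c.tube z w = 0) : w = 0 := by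
  have hd : HasFDerivAt c.tube (fderiv ℝ c.tube z) z :=
    ((c.contDiffOn_tube.contDiffAt (c.isOpen_tube_domain.mem_nhds hz)).differentiableAt
      (by simp)).hasFDerivAt
  have hσ : ∀ i, c.σ i w = 0 := by
    intro i
    have h1 : HasFDerivAt (fun z => c.σ i (c.tube z)) ((c.σ i).comp (fderiv ℝ c.tube z)) z :=
      (c.σ i).hasFDerivAt.comp z hd
    have h2 : (fun z => c.σ i (c.tube z)) = c.σ i := by
      ext z
      have := congrFun (c.bary_tube z) i
      simpa [bary] using this
    rw [h2] at h1
    have h3 := congrArg (fun f => f w) ((c.σ i).hasFDerivAt.unique h1)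
    simpa [hw] using h3
  have hwY : (c.Y w : Amb d) = w := by
    have := c.decomp w
    simpa [hσ] using this
  set f : Q.L₀ → Q.L₀ := radialMap c.r (c.sectionG (c.bary z)) with hf
  have hg := c.sectionG_isGaussParam hb
  have hfeq : ∀ u : Q.L₀, c.Y (c.tube (z - (c.Y z : Amb d) + (u : Amb d))) = f u := by
    intro u
    have h1 : c.Y (z - (c.Y z : Amb d) + (u : Amb d)) = u := by
      rw [map_add, map_sub, c.Y_coe, c.Y_coe, sub_self, zero_add]
    have h2 : c.bary (z - (c.Y z : Amb d) + (u : Amb d)) = c.bary z := by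
      rw [bary_eq_iff]
      have : z - (c.Y z : Amb d) + (u : Amb d) - z = ((u - c.Y z : Q.L₀) : Amb d) := by
        rw [Submodule.coe_sub]
        abel
      rw [this]
      exact SetLike.coe_mem _
    rw [Y_tube, h1, h2]
  have hfd : HasFDerivAt f ((c.Y.comp (fderiv ℝ c.tube z)).comp Q.L₀.subtypeL) (c.Y z) := by
    have h1 : HasFDerivAt (fun u : Q.L₀ => z - (c.Y z : Amb d) + (u : Amb d)) Q.L₀.subtypeL
        (c.Y z) := Q.L₀.subtypeL.hasFDerivAt.const_add _
    have h2 : HasFDerivAt (fun z => c.Y (c.tube z)) (c.Y.comp (fderiv ℝ c.tube z))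
        (z - (c.Y z : Amb d) + (c.Y z : Amb d)) := by
      rw [sub_add_cancel]
      exact c.Y.hasFDerivAt.comp z hd
    have h3 := h2.comp (c.Y z) h1
    have h4 : f = (fun z => c.Y (c.tube z)) ∘ fun u : Q.L₀ => z - (c.Y z : Amb d) + (u : Amb d) :=
      funext fun u => (hfeq u).symm
    rw [h4]
    exact h3
  have hY0 : c.Y w = 0 := by
    refine hg.radialMap_fderiv_injective c.r_pos hz _ ?_
    rw [← hf, hfd.fderiv]
    simp [hwY, hw]
  rw [← hwY, hY0]
  rfl

/-- With `Φ` a local inverse of `tube`, the function is `‖Y (Φ.symm z)‖ - 1`. It is defined for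
weights outside the simplex as well, so it extends past the boundary of `S`, and the slab condition
selects the right part of its zero set. -/
theorem exists_defining_function (c : Q.Chart) {a : Amb d} (ha : a ∈ Q.surface) :
    ∃ (U : Set (Amb d)) (ρ : Amb d → ℝ), IsOpen U ∧ a ∈ U ∧
      ContDiffOn ℝ ∞ ρ U ∧ (∃ w ∈ Q.L₀, fderiv ℝ ρ a w ≠ 0) ∧
      Q.surface ∩ U = {z ∈ U | z ∈ Q.slab ∧ ρ z = 0} := by
  obtain ⟨m, hm, t, ht, rfl⟩ := c.mem_surface_iff.1 ha
  have hm0 : m ≠ 0 := by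
    rintro rfl
    simp at hm
  have hline : ∀ s : ℝ, 0 < 1 + s →
      c.Y (∑ i, t i • Q.base i + (((1 + s) • m : Q.L₀) : Amb d)) = (1 + s) • m ∧
      c.bary (∑ i, t i • Q.base i + (((1 + s) • m : Q.L₀) : Amb d)) = t ∧
      c.tube (∑ i, t i • Q.base i + (((1 + s) • m : Q.L₀) : Amb d)) =
        c.pt m t + (c.r * s) • (m : Amb d) := by
    intro s hs
    have h1 : c.Y (∑ i, t i • Q.base i + (((1 + s) • m : Q.L₀) : Amb d)) = (1 + s) • m := by
      rw [map_add, c.Y_coe, map_sum]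
      simp [c.Y_base]
    have h2 : c.bary (∑ i, t i • Q.base i + (((1 + s) • m : Q.L₀) : Amb d)) = t := by
      ext i
      rw [bary, map_add, c.σ_coe, c.σ_sum_base, ht.2]
      ring
    refine ⟨h1, h2, ?_⟩
    rw [tube, h1, h2, radialMap_smul ((c.sectionG_isGaussParam ht).homog _ hs m) hs hm, c.pt_eq,
      add_sub_cancel_left, add_sub_cancel_right, Submodule.coe_add, Submodule.coe_smul]
    abel
  set z₀ := ∑ i, t i • Q.base i + (m : Amb d) with hz₀
  have hz₀' := hline 0 (by norm_num)
  simp only [add_zero, one_smul, mul_zero, zero_smul, ← hz₀] at hz₀'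
  obtain ⟨hYz, hbz, htz⟩ := hz₀'
  obtain ⟨Φ, hzΦ, hΦW, hΦ, hΦs⟩ := exists_smooth_local_inverse rfl c.isOpen_tube_domain
    c.contDiffOn_tube (a := z₀) (by simp [hYz, hm0])
    (fun w => c.tube_fderiv_injective (by rwa [hYz]) (by rwa [hbz]) w)
  have hne : ∀ z ∈ Φ.target, c.Y (Φ.symm z) ≠ 0 := fun z hz => hΦW (Φ.map_target hz)
  have hta : c.pt m t ∈ Φ.target := by
    have := Φ.map_source hzΦ
    rwa [hΦ, htz] at this
  have hsm : ContDiffOn ℝ ∞ (fun z => ‖c.Y (Φ.symm z)‖ - 1) Φ.target :=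
    ((c.Y.contDiff.comp_contDiffOn hΦs).norm ℝ hne).sub contDiffOn_const
  refine ⟨Φ.target, fun z => ‖c.Y (Φ.symm z)‖ - 1, Φ.open_target, hta, hsm,
    ⟨m, SetLike.coe_mem m, fun hzero => ?_⟩, ?_⟩
  · have hd : HasFDerivAt (fun z => ‖c.Y (Φ.symm z)‖ - 1)
        (fderiv ℝ (fun z => ‖c.Y (Φ.symm z)‖ - 1) (c.pt m t)) (c.pt m t) :=
      ((hsm.contDiffAt (Φ.open_target.mem_nhds hta)).differentiableAt (by simp)).hasFDerivAt
    have hl : HasDerivAt (fun s : ℝ => c.pt m t + (c.r * s) • (m : Amb d)) (c.r • (m : Amb d)) 0 := by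
      have := (((hasDerivAt_id (0 : ℝ)).const_mul c.r).smul_const (m : Amb d)).const_add (c.pt m t)
      simpa using this
    have hd' : HasFDerivAt (fun z => ‖c.Y (Φ.symm z)‖ - 1)
        (fderiv ℝ (fun z => ‖c.Y (Φ.symm z)‖ - 1) (c.pt m t))
        (c.pt m t + (c.r * (0 : ℝ)) • (m : Amb d)) := by simpa using hd
    have hcomp := hd'.comp_hasDerivAt (0 : ℝ) hl
    rw [map_smul, hzero, smul_zero] at hcomp
    -- Along `pt m t + (r * s) • m` the function equals `s`, so its derivative in the direction `m`
    -- of `L₀` is nonzero.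
    have hev : (fun s : ℝ => s) =ᶠ[𝓝 0] (fun z => ‖c.Y (Φ.symm z)‖ - 1) ∘
        (fun s : ℝ => c.pt m t + (c.r * s) • (m : Amb d)) := by
      have hc : ContinuousAt
          (fun s : ℝ => ∑ i, t i • Q.base i + (((1 + s) • m : Q.L₀) : Amb d)) 0 := by fun_prop
      have hsrc : ∀ᶠ s in 𝓝 (0 : ℝ),
          ∑ i, t i • Q.base i + (((1 + s) • m : Q.L₀) : Amb d) ∈ Φ.source := by
        apply hc.eventually_mem
        simpa [← hz₀] using Φ.open_source.mem_nhds hzΦ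
      filter_upwards [hsrc, Ioi_mem_nhds (show (-1 : ℝ) < 0 by norm_num)] with s hs hs1
      have hs1' : -1 < s := hs1
      obtain ⟨g1, -, g3⟩ := hline s (by linarith)
      have h1 := Φ.left_inv hs
      rw [hΦ, g3] at h1
      simp only [Function.comp_apply, h1, g1, norm_smul, hm, mul_one]
      rw [Real.norm_of_nonneg (by linarith)]
      ring
    have := (hcomp.congr_of_eventuallyEq hev).unique (hasDerivAt_id' (0 : ℝ))
    norm_num at this
  · ext z
    constructor
    · rintro ⟨hzS, hzU⟩
      refine ⟨hzU, c.mem_slab_iff.2 (c.bary_mem_of_mem_surface hzS), ?_⟩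
      obtain ⟨m', hm', t', ht', rfl⟩ := c.mem_surface_iff.1 hzS
      have hm'0 : m' ≠ 0 := by
        rintro rfl
        simp at hm'
      have h1 := Φ.right_inv hzU
      rw [hΦ] at h1
      have h2 := congrArg c.bary h1
      rw [bary_tube, c.bary_pt m' ht'.2] at h2
      have h3 := congrArg c.Y h1
      rw [Y_tube, h2, Y_pt, ← IsGaussParam.radialMap_unit (r := c.r) (G := c.sectionG t') hm'] at h3
      change ‖c.Y (Φ.symm (c.pt m' t'))‖ - 1 = 0
      rw [(c.sectionG_isGaussParam ht').radialMap_injOn c.r_pos (hne _ hzU) hm'0 h3, hm', sub_self]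
    · rintro ⟨hzU, hzs, hz1⟩
      refine ⟨?_, hzU⟩
      have hz1' : ‖c.Y (Φ.symm z)‖ = 1 := sub_eq_zero.1 hz1
      have h1 := Φ.right_inv hzU
      rw [hΦ] at h1
      have h2 := congrArg c.bary h1
      rw [bary_tube] at h2
      have h3 := congrArg c.Y h1
      rw [Y_tube, h2, IsGaussParam.radialMap_unit hz1'] at h3
      have hz : z = c.pt (c.Y (Φ.symm z)) (c.bary z) := by
        rw [pt_eq, h3, c.Y_add_sum_bary]
      rw [hz]
      exact c.pt_mem_surface hz1' (c.mem_slab_iff.1 hzs)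

end Chart

end KCone

theorem norm_le_of_forall_inner_le {V : Type*} [NormedAddCommGroup V] [InnerProductSpace ℝ V]
    {v : V} {D : ℝ} (hD : 0 ≤ D) (h : ∀ z, |inner ℝ v z| ≤ D * ‖z‖) : ‖v‖ ≤ D := by
  rcases eq_or_ne v 0 with rfl | hv
  · rwa [norm_zero]
  · have h1 := h v
    rw [real_inner_self_eq_norm_sq, abs_of_nonneg (sq_nonneg _), sq] at h1
    exact le_of_mul_le_mul_right h1 (norm_pos_iff.2 hv)

/-! ### Uniform estimates for the deviation `err` -/

namespace KCone

variable {d k : ℕ} {Q : KCone d k}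

namespace Chart

variable (c : Q.Chart)

theorem B_pos : 0 < c.B := lt_of_lt_of_le one_pos c.one_le_B

theorem sum_le_B_mul {f : Fin (k + 1) → ℝ} {b : ℝ} (hb : 0 ≤ b) (h : ∀ i, f i ≤ b) :
    ∑ i, f i ≤ c.B * b := by
  calc ∑ i, f i ≤ ∑ _i : Fin (k + 1), b := Finset.sum_le_sum fun i _ => h i
    _ = ((k : ℝ) + 1) * b := by simp
    _ ≤ c.B * b := by
      gcongr
      exact c.card_le_B

/-- The projection to `L₀` along the span of the `k`-plane with normal `m`. -/
def R (m : Q.L₀) : Amb d →L[ℝ] Q.L₀ := c.Y - ∑ i, (c.σ i).smulRight (c.G i m)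

theorem R_apply (m : Q.L₀) (z : Amb d) : c.R m z = c.Y z - ∑ i, c.σ i z • c.G i m := by
  simp [R]

/-- A uniform bound for the operators attached to the chart. -/
def D : ℝ := (d + 1) * (c.B + 2 * c.B ^ 3)

theorem B_le_D : c.B + 2 * c.B ^ 3 ≤ c.D := by
  have hB := c.B_pos
  rw [D]
  refine le_mul_of_one_le_left (by positivity) ?_
  have : (0 : ℝ) ≤ d := Nat.cast_nonneg d
  linarith

theorem one_le_D : 1 ≤ c.D := by
  have h1 := c.one_le_B
  have h2 := c.B_le_D
  have h3 : 0 ≤ c.B ^ 3 := by positivity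
  linarith

theorem D_pos : 0 < c.D := lt_of_lt_of_le one_pos c.one_le_D

theorem R_coe (m y : Q.L₀) : c.R m y = y := by
  simp [R_apply, c.Y_coe, c.σ_coe]

/-- The deviation is affine in `z` with linear part `R m`. -/
theorem err_sub_err (m : Q.L₀) (z z' : Amb d) : c.err m z - c.err m z' = c.R m (z - z') := by
  have h : ∀ i, c.bary z i - c.bary z' i = c.σ i (z - z') := fun i => by simp [bary]
  rw [err, err, sub_sub_sub_comm, sectionG, sectionG, ← Finset.sum_sub_distrib, R_apply, map_sub]
  simp only [← sub_smul, h]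

theorem err_pt_self (m : Q.L₀) {t : Fin (k + 1) → ℝ} (ht : ∑ i, t i = 1) :
    c.err m (c.pt m t) = 0 := by rw [c.err_pt _ _ ht, sub_self]

theorem err_eq_R (m : Q.L₀) {t : Fin (k + 1) → ℝ} (ht : ∑ i, t i = 1) (z : Amb d) :
    c.err m z = c.R m (z - c.pt m t) := by rw [← err_sub_err, c.err_pt_self m ht, sub_zero]

theorem norm_sum_σ_le {z : Amb d} {f : Fin (k + 1) → Q.L₀} {b : ℝ} (hb : 0 ≤ b)
    (hf : ∀ i, ‖f i‖ ≤ b) : ‖∑ i, c.σ i z • f i‖ ≤ c.B ^ 2 * b * ‖z‖ := by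
  have hB := c.B_pos
  calc ‖∑ i, c.σ i z • f i‖ ≤ ∑ i, ‖c.σ i z • f i‖ := norm_sum_le _ _
    _ ≤ c.B * (c.B * ‖z‖ * b) := by
        refine c.sum_le_B_mul (by positivity) fun i => ?_
        rw [norm_smul, Real.norm_eq_abs]
        exact mul_le_mul (c.abs_σ_le i z) (hf i) (norm_nonneg _) (by positivity)
    _ = c.B ^ 2 * b * ‖z‖ := by ring

theorem norm_R_le' {m : Q.L₀} (hm : ‖m‖ = 1) (z : Amb d) :
    ‖c.R m z‖ ≤ (c.B + c.B ^ 3) * ‖z‖ := by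
  have hB := c.B_pos
  rw [R_apply]
  calc ‖c.Y z - ∑ i, c.σ i z • c.G i m‖ ≤ ‖c.Y z‖ + ‖∑ i, c.σ i z • c.G i m‖ := norm_sub_le _ _
    _ ≤ c.B * ‖z‖ + c.B ^ 2 * c.B * ‖z‖ :=
        add_le_add (c.norm_Y_le z) (c.norm_sum_σ_le hB.le fun i => c.bound i m hm)
    _ = (c.B + c.B ^ 3) * ‖z‖ := by ring

theorem norm_R_le {m : Q.L₀} (hm : ‖m‖ = 1) (z : Amb d) : ‖c.R m z‖ ≤ c.D * ‖z‖ := by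
  refine (c.norm_R_le' hm z).trans ?_
  have hB := c.B_pos
  have := c.B_le_D
  gcongr
  have : 0 ≤ c.B ^ 3 := by positivity
  linarith

theorem norm_R_sub_le {m m' : Q.L₀} (hm : ‖m‖ = 1) (hm' : ‖m'‖ = 1) (z : Amb d) :
    ‖c.R m z - c.R m' z‖ ≤ c.B ^ 3 * ‖m - m'‖ * ‖z‖ := by
  have hB := c.B_pos
  have : c.R m z - c.R m' z = -∑ i, c.σ i z • (c.G i m - c.G i m') := by
    simp only [R_apply, smul_sub, Finset.sum_sub_distrib]
    abel
  rw [this, norm_neg]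
  refine (c.norm_sum_σ_le (b := c.B * ‖m - m'‖) (by positivity)
    fun i => c.lip i m m' hm hm').trans (le_of_eq (by ring))

/-! ### The unit normal field -/

/-- A normal vector along the `k`-plane with normal `m`. -/
def ν (m : Q.L₀) : Amb d := (InnerProductSpace.toDual ℝ (Amb d)).symm ((innerSL ℝ m).comp (c.R m))

theorem inner_ν (m : Q.L₀) (z : Amb d) : inner ℝ (c.ν m) z = inner ℝ m (c.R m z) := by
  rw [ν, InnerProductSpace.toDual_symm_apply]
  rfl

theorem inner_ν_coe (m y : Q.L₀) : inner ℝ (c.ν m) (y : Amb d) = inner ℝ m y := by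
  rw [inner_ν, R_coe]

theorem norm_ν_le {m : Q.L₀} (hm : ‖m‖ = 1) : ‖c.ν m‖ ≤ c.D := by
  refine norm_le_of_forall_inner_le c.D_pos.le fun z => ?_
  rw [inner_ν]
  refine (abs_real_inner_le_norm _ _).trans ?_
  rw [hm, one_mul]
  exact c.norm_R_le hm z

theorem one_le_norm_ν {m : Q.L₀} (hm : ‖m‖ = 1) : 1 ≤ ‖c.ν m‖ := by
  have h1 := c.inner_ν_coe m m
  rw [real_inner_self_eq_norm_sq, hm] at h1
  have h2 := real_inner_le_norm (c.ν m) (m : Amb d)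
  have h3 : ‖(m : Amb d)‖ = 1 := hm
  rw [h1, h3] at h2
  linarith

theorem norm_ν_sub_le {m m' : Q.L₀} (hm : ‖m‖ = 1) (hm' : ‖m'‖ = 1) :
    ‖c.ν m - c.ν m'‖ ≤ c.D * ‖m - m'‖ := by
  have hB := c.B_pos
  have hD := c.D_pos
  refine norm_le_of_forall_inner_le (by positivity) fun z => ?_
  rw [inner_sub_left, inner_ν, inner_ν]
  have : inner ℝ m (c.R m z) - inner ℝ m' (c.R m' z) =
      inner ℝ (m - m') (c.R m z) + inner ℝ m' (c.R m z - c.R m' z) := by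
    rw [inner_sub_left, inner_sub_right]
    ring
  rw [this]
  calc |inner ℝ (m - m') (c.R m z) + inner ℝ m' (c.R m z - c.R m' z)|
      ≤ |inner ℝ (m - m') (c.R m z)| + |inner ℝ m' (c.R m z - c.R m' z)| := abs_add_le _ _
    _ ≤ ‖m - m'‖ * ‖c.R m z‖ + ‖m'‖ * ‖c.R m z - c.R m' z‖ :=
        add_le_add (abs_real_inner_le_norm _ _) (abs_real_inner_le_norm _ _)
    _ ≤ ‖m - m'‖ * ((c.B + c.B ^ 3) * ‖z‖) + 1 * (c.B ^ 3 * ‖m - m'‖ * ‖z‖) := by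
        rw [hm']
        gcongr
        · exact c.norm_R_le' hm z
        · exact c.norm_R_sub_le hm hm' z
    _ = (c.B + 2 * c.B ^ 3) * ‖m - m'‖ * ‖z‖ := by ring
    _ ≤ c.D * ‖m - m'‖ * ‖z‖ := by
        gcongr
        exact c.B_le_D

/-- The unit normal along the `k`-plane with normal `m`. -/
def nrm (m : Q.L₀) : Amb d := ‖c.ν m‖⁻¹ • c.ν m

theorem ν_ne_zero {m : Q.L₀} (hm : ‖m‖ = 1) : c.ν m ≠ 0 := by
  have := c.one_le_norm_ν hm
  rw [← norm_pos_iff]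
  linarith

theorem norm_nrm {m : Q.L₀} (hm : ‖m‖ = 1) : ‖c.nrm m‖ = 1 := norm_inv_smul_self (c.ν_ne_zero hm)

theorem inner_nrm (m : Q.L₀) (z : Amb d) :
    inner ℝ (c.nrm m) z = ‖c.ν m‖⁻¹ * inner ℝ m (c.R m z) := by
  rw [nrm, inner_smul_left, inner_ν]
  rfl

theorem abs_inner_nrm_le {m : Q.L₀} (hm : ‖m‖ = 1) (z : Amb d) :
    |inner ℝ (c.nrm m) z| ≤ |inner ℝ m (c.R m z)| := by
  rw [inner_nrm, abs_mul, abs_inv, abs_norm]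
  exact mul_le_of_le_one_left (abs_nonneg _) (inv_le_one_of_one_le₀ (c.one_le_norm_ν hm))

theorem abs_inner_R_le {m : Q.L₀} (hm : ‖m‖ = 1) (z : Amb d) :
    |inner ℝ m (c.R m z)| ≤ c.D * |inner ℝ (c.nrm m) z| := by
  have h1 := c.one_le_norm_ν hm
  rw [inner_nrm, abs_mul, abs_inv, abs_norm, ← mul_assoc]
  refine le_mul_of_one_le_left (abs_nonneg _) ?_
  rw [← div_eq_mul_inv, le_div_iff₀ (by linarith), one_mul]
  exact c.norm_ν_le hm

/-- By `norm_smul_sub_smul_sq`, normalizing vectors of norm at least `1` does not increase their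
distance. -/
theorem norm_nrm_sub_le {m m' : Q.L₀} (hm : ‖m‖ = 1) (hm' : ‖m'‖ = 1) :
    ‖c.nrm m - c.nrm m'‖ ≤ c.D * ‖m - m'‖ := by
  refine le_trans ?_ (c.norm_ν_sub_le hm hm')
  have h1 := c.one_le_norm_ν hm
  have h2 := c.one_le_norm_ν hm'
  have h3 := norm_smul_sub_smul_sq (c.norm_nrm hm) (c.norm_nrm hm') ‖c.ν m‖ ‖c.ν m'‖
  rw [nrm, nrm, norm_smul_inv_smul, norm_smul_inv_smul] at h3
  refine le_of_sq_le_sq ?_ (norm_nonneg _)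
  change ‖c.nrm m - c.nrm m'‖ ^ 2 ≤ _
  rw [h3]
  have h4 : 1 ≤ ‖c.ν m‖ * ‖c.ν m'‖ := one_le_mul_of_one_le_of_one_le h1 h2
  change _ ≤ _ + _ * ‖c.nrm m - c.nrm m'‖ ^ 2
  nlinarith [sq_nonneg (‖c.ν m‖ - ‖c.ν m'‖), sq_nonneg ‖c.nrm m - c.nrm m'‖]

/-- As functionals on `L₀` the unit normals are `‖ν m‖⁻¹ • m`. The difference `y` of these vectors
is bounded by that of the normals, and its coefficients are at least `D⁻¹`. -/
theorem norm_sub_le_nrm {m m' : Q.L₀} (hm : ‖m‖ = 1) (hm' : ‖m'‖ = 1) :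
    ‖m - m'‖ ≤ c.D * ‖c.nrm m - c.nrm m'‖ := by
  have h1 := c.one_le_norm_ν hm
  have h2 := c.one_le_norm_ν hm'
  set y : Q.L₀ := ‖c.ν m‖⁻¹ • m - ‖c.ν m'‖⁻¹ • m' with hy
  have h3 : ‖y‖ ≤ ‖c.nrm m - c.nrm m'‖ := by
    have h4 : inner ℝ (c.nrm m - c.nrm m') (y : Amb d) = ‖y‖ ^ 2 := by
      rw [inner_sub_left, inner_nrm, inner_nrm, R_coe, R_coe, ← real_inner_self_eq_norm_sq]
      rw [← real_inner_smul_left, ← real_inner_smul_left, ← inner_sub_left]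
    have h5 := real_inner_le_norm (c.nrm m - c.nrm m') (y : Amb d)
    have h6 : ‖(y : Amb d)‖ = ‖y‖ := rfl
    rw [h4, h6] at h5
    rcases eq_or_lt_of_le (norm_nonneg y) with h0 | h0
    · rw [← h0]
      exact norm_nonneg _
    · rw [sq] at h5
      exact le_of_mul_le_mul_right h5 h0
  have h7 := norm_smul_sub_smul_sq hm hm' ‖c.ν m‖⁻¹ ‖c.ν m'‖⁻¹
  rw [← hy] at h7
  have h8 : c.D⁻¹ ≤ ‖c.ν m‖⁻¹ := inv_anti₀ (by linarith) (c.norm_ν_le hm)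
  have h9 : c.D⁻¹ ≤ ‖c.ν m'‖⁻¹ := inv_anti₀ (by linarith) (c.norm_ν_le hm')
  have hD := c.D_pos
  have h10 : (c.D⁻¹ * ‖m - m'‖) ^ 2 ≤ ‖y‖ ^ 2 := by
    rw [h7, mul_pow, sq c.D⁻¹]
    have : c.D⁻¹ * c.D⁻¹ ≤ ‖c.ν m‖⁻¹ * ‖c.ν m'‖⁻¹ := by gcongr
    nlinarith [sq_nonneg (‖c.ν m‖⁻¹ - ‖c.ν m'‖⁻¹), sq_nonneg ‖m - m'‖]
  have h11 := (le_of_sq_le_sq h10 (norm_nonneg _)).trans h3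
  rwa [inv_mul_le_iff₀ hD] at h11

theorem norm_sectionG_sub_le {t : Fin (k + 1) → ℝ} (ht : t ∈ stdSimplex ℝ (Fin (k + 1)))
    {m m' : Q.L₀} (hm : ‖m‖ = 1) (hm' : ‖m'‖ = 1) :
    ‖c.sectionG t m - c.sectionG t m'‖ ≤ c.B * ‖m - m'‖ := by
  rw [sectionG, sectionG, ← Finset.sum_sub_distrib]
  calc ‖∑ i, (t i • c.G i m - t i • c.G i m')‖ ≤ ∑ i, t i * (c.B * ‖m - m'‖) := by
        refine (norm_sum_le _ _).trans (Finset.sum_le_sum fun i _ => ?_)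
        rw [← smul_sub, norm_smul, Real.norm_of_nonneg (ht.1 i)]
        exact mul_le_mul_of_nonneg_left (c.lip i m m' hm hm') (ht.1 i)
    _ = c.B * ‖m - m'‖ := by rw [← Finset.sum_mul, ht.2, one_mul]

/-- For the upper bound, the inequality with `m` and `m'` exchanged shows that pairing `G i m - G i
m'` with `m'` gives something nonpositive. So `m` may be replaced by `m - m'`, and the Lipschitz
bound applies. -/
theorem inner_G_sub_mem {m m' : Q.L₀} (hm : ‖m‖ = 1) (hm' : ‖m'‖ = 1) (i : Fin (k + 1)) :
    c.r / 2 * ‖m - m'‖ ^ 2 ≤ inner ℝ (c.G i m - c.G i m') m ∧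
      inner ℝ (c.G i m - c.G i m') m ≤ c.B * ‖m - m'‖ ^ 2 := by
  refine ⟨(c.gauss i).convex m m' hm hm', ?_⟩
  have h1 := (c.gauss i).convex m' m hm' hm
  have h2 : 0 ≤ c.r / 2 * ‖m' - m‖ ^ 2 := by
    have := c.r_pos
    positivity
  have h3 := real_inner_le_norm (c.G i m - c.G i m') (m - m')
  have h4 := mul_le_mul_of_nonneg_right (c.lip i m m' hm hm') (norm_nonneg (m - m'))
  rw [inner_sub_right] at h3
  rw [← neg_sub (c.G i m), inner_neg_left] at h1
  nlinarith

theorem inner_sectionG_sub_mem {t : Fin (k + 1) → ℝ} (ht : t ∈ stdSimplex ℝ (Fin (k + 1)))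
    {m m' : Q.L₀} (hm : ‖m‖ = 1) (hm' : ‖m'‖ = 1) :
    c.r / 2 * ‖m - m'‖ ^ 2 ≤ inner ℝ (c.sectionG t m - c.sectionG t m') m ∧
      inner ℝ (c.sectionG t m - c.sectionG t m') m ≤ c.B * ‖m - m'‖ ^ 2 := by
  refine ⟨(c.sectionG_isGaussParam ht).convex m m' hm hm', ?_⟩
  rw [sectionG, sectionG, ← Finset.sum_sub_distrib, sum_inner]
  calc ∑ i, inner ℝ (t i • c.G i m - t i • c.G i m') m ≤ ∑ i, t i * (c.B * ‖m - m'‖ ^ 2) := by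
        refine Finset.sum_le_sum fun i _ => ?_
        rw [← smul_sub, inner_smul_left]
        exact mul_le_mul_of_nonneg_left (c.inner_G_sub_mem hm hm' i).2 (ht.1 i)
    _ = c.B * ‖m - m'‖ ^ 2 := by rw [← Finset.sum_mul, ht.2, one_mul]

open Classical in
/-- The direction in `L₀` of the `k`-plane through a point of the surface. -/
def dir (a : Amb d) : Q.L₀ :=
  if h : ∃ m, ‖m‖ = 1 ∧ ∃ t ∈ stdSimplex ℝ (Fin (k + 1)), a = c.pt m t then h.choose else 0

theorem dir_pt {m : Q.L₀} (hm : ‖m‖ = 1) {t : Fin (k + 1) → ℝ}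
    (ht : t ∈ stdSimplex ℝ (Fin (k + 1))) : c.dir (c.pt m t) = m := by
  have h : ∃ m', ‖m'‖ = 1 ∧ ∃ t' ∈ stdSimplex ℝ (Fin (k + 1)), c.pt m t = c.pt m' t' :=
    ⟨m, hm, t, ht, rfl⟩
  rw [dir, dif_pos h]
  obtain ⟨h1, t', ht', h2⟩ := h.choose_spec
  exact (c.pt_inj ht ht'.2 hm h1 h2).1.symm

/-- The unit normal field of the surface. -/
def normal (a : Amb d) : Amb d := c.nrm (c.dir a)

theorem normal_pt {m : Q.L₀} (hm : ‖m‖ = 1) {t : Fin (k + 1) → ℝ}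
    (ht : t ∈ stdSimplex ℝ (Fin (k + 1))) : c.normal (c.pt m t) = c.nrm m := by
  rw [normal, c.dir_pt hm ht]

/-- The normal depends in a Lipschitz way on the point of `S`: `err m` vanishes at `pt m t`, and at
`pt m' t'` it is at least `r * ‖m' - m‖`. -/
theorem norm_dir_sub_le {m m' : Q.L₀} (hm : ‖m‖ = 1) (hm' : ‖m'‖ = 1) {t t' : Fin (k + 1) → ℝ}
    (ht : t ∈ stdSimplex ℝ (Fin (k + 1))) (ht' : t' ∈ stdSimplex ℝ (Fin (k + 1))) :
    c.r * ‖m' - m‖ ≤ c.D * ‖c.pt m' t' - c.pt m t‖ := by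
  refine (IsGaussParam.norm_sub_ge (c.sectionG_isGaussParam ht').convex hm' hm).trans ?_
  rw [← c.err_pt m' m ht'.2, c.err_eq_R m ht.2]
  exact c.norm_R_le hm _

theorem isUnitNormalField : IsUnitNormalField Q.surface c.normal := by
  have hr := c.r_pos
  have hD := c.D_pos
  have hB := c.B_pos
  constructor
  · intro a ha
    obtain ⟨m, hm, t, ht, rfl⟩ := c.mem_surface_iff.1 ha
    rw [Metric.continuousWithinAt_iff]
    intro ε hε
    refine ⟨ε * c.r / (c.D * c.D), by positivity, fun z hz hzd => ?_⟩
    obtain ⟨m', hm', t', ht', rfl⟩ := c.mem_surface_iff.1 hz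
    rw [c.normal_pt hm' ht', c.normal_pt hm ht, dist_eq_norm]
    rw [dist_eq_norm, lt_div_iff₀ (by positivity)] at hzd
    have h1 := c.norm_nrm_sub_le hm' hm
    have h2 := c.norm_dir_sub_le hm hm' ht ht'
    refine lt_of_mul_lt_mul_right ?_ hr.le
    calc ‖c.nrm m' - c.nrm m‖ * c.r ≤ c.D * ‖m' - m‖ * c.r := by gcongr
      _ = c.D * (c.r * ‖m' - m‖) := by ring
      _ ≤ c.D * (c.D * ‖c.pt m' t' - c.pt m t‖) := by gcongr
      _ < ε * c.r := by linarith
  · intro a ha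
    obtain ⟨m, hm, t, ht, rfl⟩ := c.mem_surface_iff.1 ha
    rw [c.normal_pt hm ht]
    refine ⟨c.norm_nrm hm, fun v hv => ?_⟩
    have hd1 : HasFDerivWithinAt (fun z => inner ℝ (c.ν m) (z - c.pt m t)) (innerSL ℝ (c.ν m))
        Q.surface (c.pt m t) :=
      ((innerSL ℝ (c.ν m)).hasFDerivAt.comp (c.pt m t)
        ((hasFDerivAt_id (c.pt m t)).sub_const (c.pt m t))).hasFDerivWithinAt
    have hd2 : HasFDerivWithinAt (fun z => inner ℝ (c.ν m) (z - c.pt m t))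
        -- On `S` the component along `ν m` is quadratic in the change of normal, hence in the
        -- distance. So its derivative within `S` is zero, and derivatives within `S` are unique on
        -- the tangent cone.
        (0 : Amb d →L[ℝ] ℝ) Q.surface (c.pt m t) := by
      refine Asymptotics.IsBigO.hasFDerivWithinAt (n := 2) ?_ ha (by norm_num)
      refine Asymptotics.IsBigO.of_bound (c.B * (c.D / c.r) ^ 2) ?_
      filter_upwards [self_mem_nhdsWithin] with z hz
      obtain ⟨m', hm', t', ht', rfl⟩ := c.mem_surface_iff.1 hz
      have h2 := c.norm_dir_sub_le hm hm' ht ht'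
      have h3 := c.inner_sectionG_sub_mem ht' hm hm'
      have h4 : ‖m' - m‖ ≤ c.D / c.r * ‖c.pt m' t' - c.pt m t‖ := by
        rw [div_mul_eq_mul_div, le_div_iff₀ hr]
        linarith
      rw [inner_ν, ← c.err_eq_R m ht.2, c.err_pt m' m ht'.2, real_inner_comm, norm_pow, norm_norm,
        Real.norm_eq_abs, ← neg_sub, inner_neg_left, abs_neg, abs_of_nonneg]
      · calc inner ℝ (c.sectionG t' m - c.sectionG t' m') m ≤ c.B * ‖m - m'‖ ^ 2 := h3.2
          _ = c.B * ‖m' - m‖ ^ 2 := by rw [norm_sub_rev]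
          _ ≤ c.B * (c.D / c.r * ‖c.pt m' t' - c.pt m t‖) ^ 2 := by gcongr
          _ = _ := by ring
      · exact le_trans (by positivity) h3.1
    have := hd1.unique_on hd2 hv
    rw [innerSL_apply_apply] at this
    rw [real_inner_comm, nrm, inner_smul_left, this]
    simp

/-! ### Sector frames -/

theorem R_X (m : Q.L₀) (i : Fin (k + 1)) : c.R m (c.X m i) = c.G 0 m := by
  rw [R_apply, X, map_add, c.Y_base, c.Y_coe, zero_add]
  simp only [map_add, c.σ_base, c.σ_coe, add_zero, sub_smul, Finset.sum_sub_distrib]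
  simp [ite_smul]

/-- `R m` takes the same value at all vertices, so it kills their differences. Conversely, if `R m w
= 0`, the decomposition of `w` becomes a combination of vertex differences with coefficients `σ i
w`. -/
theorem mem_vectorSpan_iff {m : Q.L₀} {w : Amb d} :
    w ∈ vectorSpan ℝ (Set.range (c.X m)) ↔ c.R m w = 0 := by
  constructor
  · intro hw
    have hle : vectorSpan ℝ (Set.range (c.X m)) ≤ LinearMap.ker (c.R m).toLinearMap := by
      rw [vectorSpan_def, Submodule.span_le]
      rintro _ ⟨_, ⟨i, rfl⟩, _, ⟨j, rfl⟩, rfl⟩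
      simp [R_X]
    exact hle hw
  · intro hw
    rw [R_apply, sub_eq_zero] at hw
    have h1 : w = ∑ i, c.σ i w • (c.X m i -ᵥ c.X m 0) := by
      simp only [vsub_eq_sub, smul_sub, Finset.sum_sub_distrib, ← Finset.sum_smul, c.sum_σ,
        zero_smul, X, smul_add, Finset.sum_add_distrib]
      have h2 := congrArg (fun y : Q.L₀ => (y : Amb d)) hw
      simp only [Submodule.coe_sum, Submodule.coe_smul] at h2
      rw [← h2, add_zero, sub_zero, add_comm]
      exact (c.decomp w).symm
    rw [h1]
    exact Submodule.sum_mem _ fun i _ => Submodule.smul_mem _ _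
      (vsub_mem_vectorSpan ℝ (Set.mem_range_self i) (Set.mem_range_self 0))

/-- A system of axes of sectors centered on the `k`-plane with normal `m`. -/
def IsFrameAt (m : Q.L₀) (e : OrthonormalBasis (Fin (d + 1)) ℝ (Amb d)) : Prop :=
  e 0 = c.nrm m ∧ ∀ j : Fin (d + 1), d < (j : ℕ) + k → e j ∈ vectorSpan ℝ (Set.range (c.X m))

theorem isSectorFrame_iff {m : Q.L₀} (hm : ‖m‖ = 1) {t : Fin (k + 1) → ℝ}
    (ht : t ∈ stdSimplex ℝ (Fin (k + 1))) {e : OrthonormalBasis (Fin (d + 1)) ℝ (Amb d)} :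
    Q.IsSectorFrame c.normal (c.pt m t) e ↔ c.IsFrameAt m e := by
  rw [IsSectorFrame, IsFrameAt, c.normal_pt hm ht]
  refine and_congr_right fun _ => ⟨?_, fun h => ?_⟩
  · rintro ⟨x, hx, hax, h⟩
    obtain ⟨m', hm', rfl⟩ := c.isGood_iff.1 hx
    obtain ⟨t', ht', hp⟩ := c.mem_kPlane_iff.1 hax
    obtain ⟨rfl, -⟩ := c.pt_inj ht ht'.2 hm hm' hp
    exact h
  · exact ⟨c.X m, c.isGood_iff.2 ⟨m, hm, rfl⟩, c.mem_kPlane_iff.2 ⟨t, ht, rfl⟩, h⟩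

theorem finrank_vectorSpan (m : Q.L₀) :
    Module.finrank ℝ (vectorSpan ℝ (Set.range (c.X m))) = k :=
  (c.affineIndependent_X m).finrank_vectorSpan (by simp)

theorem inner_nrm_eq_zero {m : Q.L₀} {w : Amb d} (hw : w ∈ vectorSpan ℝ (Set.range (c.X m))) :
    inner ℝ (c.nrm m) w = 0 := by
  rw [inner_nrm, c.mem_vectorSpan_iff.1 hw, inner_zero_right, mul_zero]

theorem exists_isFrameAt (hkd : k ≤ d) {m : Q.L₀} (hm : ‖m‖ = 1) : ∃ e, c.IsFrameAt m e := by
  set W := vectorSpan ℝ (Set.range (c.X m)) with hW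
  let b : OrthonormalBasis (Fin k) ℝ W :=
    (stdOrthonormalBasis ℝ W).reindex (finCongr (c.finrank_vectorSpan m))
  -- The indices with `d < j + k` are the last `k`, and `j + k - (d + 1)` numbers them from `0`.
  -- Index `0` is not among them because `k ≤ d`.
  let v : Fin (d + 1) → Amb d := fun j =>
    if h : d < (j : ℕ) + k then (b ⟨(j : ℕ) + k - (d + 1), by omega⟩ : Amb d) else c.nrm m
  have hv0 : v 0 = c.nrm m := dif_neg (by simp; omega)
  have hvt : ∀ j : Fin (d + 1), ∀ h : d < (j : ℕ) + k,
      v j = (b ⟨(j : ℕ) + k - (d + 1), by omega⟩ : Amb d) := fun j h => dif_pos h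
  have hon : Orthonormal ℝ (({j | j = 0 ∨ d < (j : ℕ) + k} : Set (Fin (d + 1))).domRestrict v) := by
    constructor
    · rintro ⟨j, rfl | hj⟩
      · simp only [Set.domRestrict_apply, hv0, c.norm_nrm hm]
      · rw [Set.domRestrict_apply, hvt j hj]
        exact b.orthonormal.1 _
    · rintro ⟨i, hi⟩ ⟨j, hj⟩ hij
      have hij' : i ≠ j := fun h => hij (Subtype.ext h)
      simp only [Set.domRestrict_apply]
      rcases hi with rfl | hi <;> rcases hj with rfl | hj
      · exact absurd rfl hij'
      · rw [hv0, hvt j hj]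
        exact c.inner_nrm_eq_zero (SetLike.coe_mem _)
      · rw [hv0, hvt i hi, real_inner_comm]
        exact c.inner_nrm_eq_zero (SetLike.coe_mem _)
      · rw [hvt i hi, hvt j hj]
        refine b.orthonormal.2 fun h => hij' (Fin.ext ?_)
        have := congrArg Fin.val h
        simp only at this
        omega
  obtain ⟨e, he⟩ := hon.exists_orthonormalBasis_extension_of_card_eq (by simp)
  refine ⟨e, ?_, fun j hj => ?_⟩
  · rw [he 0 (Or.inl rfl), hv0]
  · rw [he j (Or.inr hj), hvt j hj]
    exact SetLike.coe_mem _

namespace IsFrameAt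

variable {c} {m : Q.L₀} {e : OrthonormalBasis (Fin (d + 1)) ℝ (Amb d)}

/-- By dimension, the last `k` axes span the whole direction of the `k`-plane. -/
theorem inner_eq_zero (hkd : k ≤ d) (he : c.IsFrameAt m e) {j : Fin (d + 1)} (hj : (j : ℕ) + k ≤ d)
    {w : Amb d} (hw : w ∈ vectorSpan ℝ (Set.range (c.X m))) : inner ℝ (e j) w = 0 := by
  let τ : Fin k → Fin (d + 1) := fun i => ⟨d + 1 - k + i, by omega⟩
  have hτ : Function.Injective τ := fun i i' h => Fin.ext (by
    have := congrArg Fin.val h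
    simp only [τ] at this
    omega)
  have hli : LinearIndependent ℝ (e ∘ τ) := (e.orthonormal.comp τ hτ).linearIndependent
  have hle : Submodule.span ℝ (Set.range (e ∘ τ)) ≤ vectorSpan ℝ (Set.range (c.X m)) := by
    rw [Submodule.span_le]
    rintro _ ⟨i, rfl⟩
    exact he.2 _ (by simp only [τ]; omega)
  have heq : Submodule.span ℝ (Set.range (e ∘ τ)) = vectorSpan ℝ (Set.range (c.X m)) :=
    Submodule.eq_of_le_of_finrank_eq hle
      (by rw [finrank_span_eq_card hli, Fintype.card_fin, c.finrank_vectorSpan])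
  have hker : Submodule.span ℝ (Set.range (e ∘ τ)) ≤ LinearMap.ker (innerSL ℝ (e j)).toLinearMap := by
    rw [Submodule.span_le]
    rintro _ ⟨i, rfl⟩
    refine e.orthonormal.2 fun h => ?_
    have := congrArg Fin.val h
    simp only [τ] at this
    omega
  rw [← heq] at hw
  exact hker hw

/-- `z - R m z` is parallel to the `k`-plane, so the transversal axes see only `R m z`. -/
theorem abs_inner_le (hkd : k ≤ d) (he : c.IsFrameAt m e) {j : Fin (d + 1)}
    (hj : (j : ℕ) + k ≤ d) (z : Amb d) : |inner ℝ (e j) z| ≤ ‖c.R m z‖ := by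
  have h1 : inner ℝ (e j) z = inner ℝ (e j) (c.R m z : Amb d) := by
    rw [← sub_eq_zero, ← inner_sub_right]
    refine he.inner_eq_zero hkd hj (c.mem_vectorSpan_iff.2 ?_)
    rw [map_sub, R_coe, sub_self]
  rw [h1]
  refine (abs_real_inner_le_norm _ _).trans ?_
  rw [e.orthonormal.1 j, one_mul]
  rfl

theorem norm_R_le (he : c.IsFrameAt m e) (hm : ‖m‖ = 1) {z : Amb d} {s : ℝ}
    (hs : ∀ j : Fin (d + 1), (j : ℕ) + k ≤ d → |inner ℝ (e j) z| ≤ s) (hs0 : 0 ≤ s) :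
    ‖c.R m z‖ ≤ c.D * s := by
  have hB := c.B_pos
  rw [← e.sum_repr' z, map_sum]
  calc ‖∑ j, c.R m (inner ℝ (e j) z • e j)‖ ≤ ∑ _j : Fin (d + 1), s * (c.B + c.B ^ 3) := by
        refine (norm_sum_le _ _).trans (Finset.sum_le_sum fun j _ => ?_)
        rw [map_smul, norm_smul, Real.norm_eq_abs]
        by_cases hj : (j : ℕ) + k ≤ d
        · have h1 := c.norm_R_le' hm (e j)
          rw [e.orthonormal.1 j, mul_one] at h1
          exact mul_le_mul (hs j hj) h1 (norm_nonneg _) hs0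
        · rw [c.mem_vectorSpan_iff.1 (he.2 j (by omega)), norm_zero, mul_zero]
          positivity
    _ = (d + 1) * (c.B + c.B ^ 3) * s := by simp; ring
    _ ≤ c.D * s := by
        rw [D]
        gcongr
        have : 0 < c.B ^ 3 := by positivity
        linarith

theorem norm_le (c : Q.Chart) (e : OrthonormalBasis (Fin (d + 1)) ℝ (Amb d)) {z : Amb d} {s : ℝ}
    (hs : ∀ j : Fin (d + 1), |inner ℝ (e j) z| ≤ s) : ‖z‖ ≤ c.D * s := by
  have hB := c.B_pos
  have hs0 : 0 ≤ s := (abs_nonneg _).trans (hs 0)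
  rw [← e.sum_repr' z]
  calc ‖∑ j, inner ℝ (e j) z • e j‖ ≤ ∑ _j : Fin (d + 1), s := by
        refine (norm_sum_le _ _).trans (Finset.sum_le_sum fun j _ => ?_)
        rw [norm_smul, Real.norm_eq_abs, e.orthonormal.1 j, mul_one]
        exact hs j
    _ = (d + 1) * 1 * s := by simp
    _ ≤ c.D * s := by
        rw [D]
        gcongr
        have : 0 < c.B ^ 3 := by positivity
        linarith [c.one_le_B]

end IsFrameAt

/-! ### Boxes -/

section Box

variable {c} {m : Q.L₀} {e : OrthonormalBasis (Fin (d + 1)) ℝ (Amb d)} {t : Fin (k + 1) → ℝ}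
  {C₁ C₂ C₃ δ : ℝ} {x : Amb d}

/-- This and `of_mem_rectBox` replace boxes, up to constants, by conditions on `err` and on the
distance to the centre. The choice of axes no longer matters. -/
theorem mem_rectBox (hkd : k ≤ d) (he : c.IsFrameAt m e) (hm : ‖m‖ = 1) (ht : ∑ i, t i = 1)
    (h1 : |inner ℝ (c.err m x) m| ≤ C₁ * δ / 2) (h2 : ‖c.err m x‖ ≤ C₂ * √δ / 2)
    (h3 : ‖x - c.pt m t‖ ≤ C₃ / 2) :
    x ∈ rectBox e (c.pt m t) (sectorSides d k C₁ C₂ C₃ δ) := by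
  rw [c.err_eq_R m ht] at h1 h2
  intro j
  rw [sectorSides]
  split_ifs with hj0 hj
  · have : j = 0 := Fin.ext hj0
    rw [this, he.1]
    refine (c.abs_inner_nrm_le hm _).trans ?_
    rwa [real_inner_comm]
  · exact (he.abs_inner_le hkd hj _).trans h2
  · refine (abs_real_inner_le_norm _ _).trans ?_
    rwa [e.orthonormal.1 j, one_mul]

theorem of_mem_rectBox (he : c.IsFrameAt m e) (hm : ‖m‖ = 1) (ht : ∑ i, t i = 1)
    {s : ℝ} (hs : 0 ≤ s) (hC₁ : 0 ≤ C₁) (hC₂ : 0 ≤ C₂) (hC₃ : 0 ≤ C₃) (hδ : 0 < δ) (hδ1 : δ ≤ 1)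
    (hx : x ∈ rectBox e (c.pt m t) (fun j => s * sectorSides d k C₁ C₂ C₃ δ j)) :
    |inner ℝ (c.err m x) m| ≤ c.D * (s * C₁) * δ ∧ ‖c.err m x‖ ≤ c.D * (s * (C₁ + C₂)) * √δ ∧
      ‖x - c.pt m t‖ ≤ c.D * (s * (C₁ * δ + C₂ * √δ + C₃)) := by
  have hD := c.D_pos
  have hδs : δ ≤ √δ := by
    rw [Real.le_sqrt hδ.le hδ.le]
    nlinarith
  have hsq : 0 ≤ √δ := Real.sqrt_nonneg δ
  have hx0 := hx 0
  simp only [sectorSides, Fin.val_zero, if_true] at hx0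
  rw [c.err_eq_R m ht]
  refine ⟨?_, ?_, ?_⟩
  · rw [real_inner_comm]
    refine (c.abs_inner_R_le hm _).trans ?_
    rw [mul_assoc]
    gcongr
    rw [he.1] at hx0
    have : 0 ≤ s * C₁ * δ := by positivity
    linarith
  · rw [mul_assoc]
    refine he.norm_R_le hm (fun j hj => ?_) (by positivity)
    have hxj := hx j
    simp only [sectorSides, hj, if_true] at hxj
    -- The transversal axes include the normal one, whose side `C₁ * δ` is at most `C₁ * √δ` because
    -- `δ ≤ 1`.
    have g1 : s * (C₁ * δ) ≤ s * (C₁ * √δ) := by gcongr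
    have g2 : 0 ≤ s * (C₂ * √δ) := by positivity
    have g3 : 0 ≤ s * (C₁ * √δ) := by positivity
    split_ifs at hxj <;> linarith
  · refine IsFrameAt.norm_le c e fun j => ?_
    have hxj := hx j
    simp only [sectorSides] at hxj
    have g1 : 0 ≤ s * (C₁ * δ) := by positivity
    have g2 : 0 ≤ s * (C₂ * √δ) := by positivity
    have g3 : 0 ≤ s * C₃ := by positivity
    split_ifs at hxj <;> linarith

end Box

end Chart

end KCone

/-- The number of `s`-separated points in a ball of radius `A * s` is bounded. -/
theorem exists_packing_bound (V : Type*) [NormedAddCommGroup V] [NormedSpace ℝ V]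
    [FiniteDimensional ℝ V] (A : ℝ) :
    ∃ N : ℕ, ∀ s : ℝ, 0 < s → ∀ P : Set V, (∀ p ∈ P, ∀ q ∈ P, p ≠ q → s ≤ dist p q) →
      ∀ x : V, {p ∈ P | ‖x - p‖ ≤ A * s}.encard ≤ N := by
  have : ProperSpace V := FiniteDimensional.proper ℝ V
  obtain ⟨F, -, hF, hcov⟩ := (isCompact_closedBall (0 : V) A).finite_cover_balls
    (e := 1 / 2) (by norm_num)
  refine ⟨F.ncard, fun s hs P hP x => ?_⟩
  rw [hF.cast_ncard_eq]
  -- After rescaling by `s⁻¹` the points are `1`-separated in a ball of radius `A`, so each of the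
  -- finitely many balls of radius `1 / 2` contains at most one.
  have hex : ∀ p ∈ {p ∈ P | ‖x - p‖ ≤ A * s}, ∃ f ∈ F, dist (s⁻¹ • (x - p)) f < 1 / 2 := by
    rintro p ⟨-, hp⟩
    have : s⁻¹ • (x - p) ∈ Metric.closedBall (0 : V) A := by
      rw [mem_closedBall_zero_iff, norm_smul, norm_inv, Real.norm_of_nonneg hs.le,
        inv_mul_le_iff₀ hs]
      linarith
    simpa using hcov this
  choose! f hfF hf using hex
  refine Set.encard_le_encard_of_injOn (f := f) hfF ?_
  intro p hp q hq hpq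
  by_contra hne
  have h1 := hP p hp.1 q hq.1 hne
  have h2 : dist (s⁻¹ • (x - p)) (s⁻¹ • (x - q)) < 1 := by
    have h3 := hf p hp
    have h4 := hf q hq
    rw [← hpq, dist_comm] at h4
    calc dist (s⁻¹ • (x - p)) (s⁻¹ • (x - q)) ≤ _ := dist_triangle _ (f p) _
      _ < 1 / 2 + 1 / 2 := add_lt_add h3 h4
      _ = 1 := by norm_num
  rw [dist_eq_norm, ← smul_sub, norm_smul, norm_inv, Real.norm_of_nonneg hs.le,
    inv_mul_lt_iff₀ hs, sub_sub_sub_cancel_left, mul_one, ← dist_eq_norm, dist_comm] at h2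
  linarith

theorem sectorSides_mul (d k : ℕ) (s C₁ C₂ C₃ δ : ℝ) :
    (fun j => s * sectorSides d k C₁ C₂ C₃ δ j) =
      sectorSides d k (s * C₁) (s * C₂) (s * C₃) δ := by
  ext j
  simp only [sectorSides]
  split_ifs <;> ring

/-! ### Nets of normals and weights -/

namespace KCone

variable {d k : ℕ} {Q : KCone d k}

theorem exists_isMaximalSeparated (Q : KCone d k) {s : ℝ} (hs : 0 < s) :
    ∃ P, Q.IsMaximalSeparated s P := by
  obtain ⟨P, hP⟩ := zorn_subset
    {P : Set Q.L₀ | P ⊆ Metric.sphere 0 1 ∧ ∀ m ∈ P, ∀ m' ∈ P, m ≠ m' → s ≤ dist m m'} (by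
      intro c hc hchain
      refine ⟨⋃₀ c, ⟨Set.sUnion_subset fun P hP => (hc hP).1, ?_⟩, fun P hP =>
        Set.subset_sUnion_of_mem hP⟩
      rintro m ⟨P, hP, hm⟩ m' ⟨P', hP', hm'⟩ hne
      rcases hchain.total hP hP' with h | h
      · exact (hc hP').2 m (h hm) m' hm' hne
      · exact (hc hP).2 m hm m' (h hm') hne)
  refine ⟨P, hP.prop.1, hP.prop.2, fun m hm => ?_⟩
  by_contra! hcon
  have hins : insert m P ∈ {P : Set Q.L₀ | P ⊆ Metric.sphere 0 1 ∧
      ∀ m ∈ P, ∀ m' ∈ P, m ≠ m' → s ≤ dist m m'} := by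
    refine ⟨Set.insert_subset hm hP.prop.1, ?_⟩
    rintro p (rfl | hp) q (rfl | hq) hne
    · exact absurd rfl hne
    · exact hcon q hq
    · rw [dist_comm]
      exact hcon p hp
    · exact hP.prop.2 p hp q hq hne
  have hmP : m ∈ P := hP.le_of_ge hins (Set.subset_insert m P) (Set.mem_insert m P)
  have := hcon m hmP
  rw [dist_self] at this
  linarith

namespace Chart

variable (c : Q.Chart)

/-- The points with normal in `P` and barycentric coordinates in `T`. -/
def centers (P : Set Q.L₀) (T : Finset (Fin (k + 1) → ℝ)) : Set (Amb d) :=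
  {a | ∃ m ∈ P, ∃ t ∈ T, a = c.pt m t}

/-- The inverse Gauss map with weights `t` is uniformly injective. -/
def Nondeg (t : Fin (k + 1) → ℝ) : Prop :=
  ∀ m m', ‖m‖ = 1 → ‖m'‖ = 1 → c.r / 2 * ‖m - m'‖ ≤ ‖c.sectionG t m - c.sectionG t m'‖

theorem nondeg_of_mem_stdSimplex {t : Fin (k + 1) → ℝ} (ht : t ∈ stdSimplex ℝ (Fin (k + 1))) :
    c.Nondeg t := by
  intro m m' hm hm'
  refine le_trans ?_ (IsGaussParam.norm_sub_ge (c.sectionG_isGaussParam ht).convex hm hm')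
  gcongr
  linarith [c.r_pos]

/-- Write `t i = (t i + ε) - ε`. The nonnegative weights have sum at least `1` and keep the constant
`r / 2`, while the correction costs at most `ε * B ^ 2 ≤ r / 4`. -/
theorem nondeg_of_neg_le {t : Fin (k + 1) → ℝ} (ht : ∑ i, t i = 1) {ε : ℝ} (hε : 0 ≤ ε)
    (hεr : ε * c.B ^ 2 ≤ c.r / 4) (hneg : ∀ i, -ε ≤ t i) : c.Nondeg t := by
  intro m m' hm hm'
  refine IsGaussParam.norm_sub_ge (r := c.r / 2) (G := c.sectionG t) (fun m m' hm hm' => ?_) hm hm'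
  have hr := c.r_pos
  have hB := c.B_pos
  have hq : 0 ≤ ‖m - m'‖ ^ 2 := sq_nonneg _
  have h1 : inner ℝ (c.sectionG t m - c.sectionG t m') m =
      ∑ i, (t i + ε) * inner ℝ (c.G i m - c.G i m') m -
        ε * ∑ i, inner ℝ (c.G i m - c.G i m') m := by
    rw [sectionG, sectionG, ← Finset.sum_sub_distrib, sum_inner, Finset.mul_sum,
      ← Finset.sum_sub_distrib]
    refine Finset.sum_congr rfl fun i _ => ?_
    rw [← smul_sub, real_inner_smul_left]
    ring
  have h2 : c.r / 2 * ‖m - m'‖ ^ 2 ≤ ∑ i, (t i + ε) * inner ℝ (c.G i m - c.G i m') m := by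
    calc c.r / 2 * ‖m - m'‖ ^ 2 ≤ ∑ i, (t i + ε) * (c.r / 2 * ‖m - m'‖ ^ 2) := by
          rw [← Finset.sum_mul, Finset.sum_add_distrib, ht]
          refine le_mul_of_one_le_left (by positivity) ?_
          simp
          positivity
      _ ≤ _ := Finset.sum_le_sum fun i _ =>
          mul_le_mul_of_nonneg_left (c.inner_G_sub_mem hm hm' i).1 (by linarith [hneg i])
  have h3 : ∑ i, inner ℝ (c.G i m - c.G i m') m ≤ c.B * (c.B * ‖m - m'‖ ^ 2) :=
    c.sum_le_B_mul (by positivity) fun i => (c.inner_G_sub_mem hm hm' i).2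
  rw [h1]
  nlinarith [mul_le_mul_of_nonneg_left h3 hε, mul_le_mul_of_nonneg_right hεr hq]

theorem norm_pt_sub_pt_le {m m' : Q.L₀} (hm : ‖m‖ = 1) (hm' : ‖m'‖ = 1) {t : Fin (k + 1) → ℝ}
    (ht : t ∈ stdSimplex ℝ (Fin (k + 1))) : ‖c.pt m t - c.pt m' t‖ ≤ c.B * ‖m - m'‖ := by
  rw [c.pt_eq, c.pt_eq, add_sub_add_right_eq_sub, ← Submodule.coe_sub]
  exact c.norm_sectionG_sub_le ht hm hm'

theorem norm_pt_sub_pt_le' {m : Q.L₀} (hm : ‖m‖ = 1) (t t' : Fin (k + 1) → ℝ) :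
    ‖c.pt m t - c.pt m t'‖ ≤ 2 * c.B ^ 2 * ‖t - t'‖ := by
  have hB := c.B_pos
  rw [pt, pt, ← Finset.sum_sub_distrib]
  calc ‖∑ i, (t i • c.X m i - t' i • c.X m i)‖ ≤ ∑ i, ‖t i • c.X m i - t' i • c.X m i‖ :=
        norm_sum_le _ _
    _ ≤ c.B * (‖t - t'‖ * (2 * c.B)) := by
        refine c.sum_le_B_mul (by positivity) fun i => ?_
        rw [← sub_smul, norm_smul]
        refine mul_le_mul (norm_le_pi_norm (t - t') i) ?_ (norm_nonneg _) (norm_nonneg _)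
        refine (norm_add_le _ _).trans ?_
        have h1 := c.norm_base_le i
        have h2 : ‖(c.G i m : Amb d)‖ ≤ c.B := c.bound i m hm
        linarith
    _ = 2 * c.B ^ 2 * ‖t - t'‖ := by ring

theorem abs_bary_sub_le (x a : Amb d) (i : Fin (k + 1)) :
    |c.bary x i - c.bary a i| ≤ c.B * ‖x - a‖ := by
  have : c.bary x i - c.bary a i = c.σ i (x - a) := by simp [bary]
  rw [this]
  exact c.abs_σ_le i _

theorem err_sub_err' (m m' : Q.L₀) (z : Amb d) :
    c.err m z - c.err m' z = c.sectionG (c.bary z) m' - c.sectionG (c.bary z) m := by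
  rw [err, err]
  abel

/-! ### Covering -/

theorem exists_mem_rectBox (hkd : k ≤ d) {δ : ℝ} (hδ : 0 < δ) (hδ1 : δ ≤ 1) {P : Set Q.L₀}
    (hP : Q.IsMaximalSeparated √δ P) {T : Finset (Fin (k + 1) → ℝ)}
    (hT : ∀ t ∈ T, t ∈ stdSimplex ℝ (Fin (k + 1)))
    {e : Amb d → OrthonormalBasis (Fin (d + 1)) ℝ (Amb d)}
    (he : ∀ a ∈ c.centers P T, Q.IsSectorFrame c.normal a (e a))
    {C₁ C₂ C₃ η : ℝ} (hC₁ : 4 * c.D ≤ C₁) (hC₂ : 4 * c.D ≤ C₂) (hC₃ : 4 * c.D * √δ + 2 * η ≤ C₃)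
    (hη : ∀ t' ∈ stdSimplex ℝ (Fin (k + 1)), ∃ t ∈ T, ∀ m, ‖m‖ = 1 →
      ‖c.pt m t' - c.pt m t‖ ≤ η)
    {x : Amb d} (hx : x ∈ Metric.thickening δ Q.surface) :
    ∃ a ∈ c.centers P T, x ∈ rectBox (e a) a (sectorSides d k C₁ C₂ C₃ δ) := by
  have hD := c.D_pos
  have hB := c.B_pos
  have hBD : c.B ≤ c.D := by
    have := c.B_le_D
    have : 0 < c.B ^ 3 := by positivity
    linarith
  have hD1 := c.one_le_D
  have hsq : 0 ≤ √δ := Real.sqrt_nonneg δ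
  have hss : √δ ^ 2 = δ := Real.sq_sqrt hδ.le
  have hδs : δ ≤ √δ := by
    rw [Real.le_sqrt hδ.le hδ.le]
    nlinarith
  obtain ⟨s, hs, hxs⟩ := Metric.mem_thickening_iff.1 hx
  obtain ⟨m', hm', t', ht', rfl⟩ := c.mem_surface_iff.1 hs
  obtain ⟨m, hmP, hmm⟩ := hP.2.2 m' (mem_sphere_zero_iff_norm.2 hm')
  have hm : ‖m‖ = 1 := mem_sphere_zero_iff_norm.1 (hP.1 hmP)
  obtain ⟨t, htT, htη⟩ := hη t' ht'
  have hmem : c.pt m t ∈ c.centers P T := ⟨m, hmP, t, htT, rfl⟩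
  refine ⟨_, hmem, ?_⟩
  rw [dist_eq_norm] at hxs hmm
  -- With `m` within `√δ` of `m'`, the first term has size `O(√δ)` and component `O(δ)` along `m`;
  -- the second is `O(δ)`. The change of weights from `t'` to `t` affects only the distance to the
  -- centre.
  have herr : c.err m x = (c.sectionG t' m' - c.sectionG t' m) + c.R m (x - c.pt m' t') := by
    rw [← c.err_sub_err, c.err_pt m' m ht'.2]
    abel
  have hR : ‖c.R m (x - c.pt m' t')‖ ≤ c.D * δ :=
    (c.norm_R_le hm _).trans (by gcongr)
  refine mem_rectBox hkd ((c.isSectorFrame_iff hm (hT t htT)).1 (he _ hmem)) hm (hT t htT).2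
    ?_ ?_ ?_
  · rw [herr, inner_add_left]
    have h1 := c.inner_sectionG_sub_mem ht' hm hm'
    have h2 : |inner ℝ (c.sectionG t' m' - c.sectionG t' m) m| ≤ c.B * δ := by
      rw [← neg_sub, inner_neg_left, abs_neg, abs_of_nonneg]
      · refine h1.2.trans ?_
        rw [norm_sub_rev, ← hss]
        gcongr
      · have := c.r_pos
        exact le_trans (by positivity) h1.1
    have h3 : |inner ℝ (c.R m (x - c.pt m' t')) m| ≤ c.D * δ := by
      refine (abs_real_inner_le_norm _ _).trans ?_
      rwa [hm, mul_one]
    have h4 : c.B * δ ≤ c.D * δ := by gcongr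
    have h5 : 4 * c.D * δ ≤ C₁ * δ := by gcongr
    linarith [abs_add_le (inner ℝ (c.sectionG t' m' - c.sectionG t' m) m)
      (inner ℝ (c.R m (x - c.pt m' t')) m)]
  · rw [herr]
    have h1 := c.norm_sectionG_sub_le ht' hm' hm
    have h2 : c.B * ‖m' - m‖ ≤ c.D * √δ := by gcongr
    have h3 : c.D * δ ≤ c.D * √δ := by gcongr
    have h4 : 4 * c.D * √δ ≤ C₂ * √δ := by gcongr
    linarith [norm_add_le (c.sectionG t' m' - c.sectionG t' m) (c.R m (x - c.pt m' t'))]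
  · have h1 := c.norm_pt_sub_pt_le hm' hm ht'
    have h2 : c.B * ‖m' - m‖ ≤ c.D * √δ := by gcongr
    have h3 := htη m hm
    have h4 : √δ ≤ c.D * √δ := le_mul_of_one_le_left hsq hD1
    have h5 := norm_sub_le_norm_sub_add_norm_sub x (c.pt m' t') (c.pt m t)
    have h6 := norm_sub_le_norm_sub_add_norm_sub (c.pt m' t') (c.pt m t') (c.pt m t)
    linarith

/-! ### Counting -/

theorem exists_encard_le (T : Finset (Fin (k + 1) → ℝ)) (A : ℝ) :
    ∃ N : ℕ, ∀ δ : ℝ, 0 < δ → ∀ P, Q.IsMaximalSeparated √δ P → ∀ m₀ : Q.L₀, ∀ M : Set (Amb d),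
      (∀ a ∈ M, ∃ m ∈ P, ∃ t ∈ T, a = c.pt m t ∧ ‖m₀ - m‖ ≤ A * √δ) → M.encard ≤ N := by
  obtain ⟨N, hN⟩ := exists_packing_bound Q.L₀ A
  refine ⟨N * T.card, fun δ hδ P hP m₀ M hM => ?_⟩
  have h1 := hN √δ (Real.sqrt_pos.2 hδ) P hP.2.1 m₀
  have h2 : M ⊆ (fun q : Q.L₀ × (Fin (k + 1) → ℝ) => c.pt q.1 q.2) ''
      ({p ∈ P | ‖m₀ - p‖ ≤ A * √δ} ×ˢ (T : Set (Fin (k + 1) → ℝ))) := by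
    intro a ha
    obtain ⟨m, hm, t, ht, rfl, hmm⟩ := hM a ha
    exact ⟨(m, t), ⟨⟨hm, hmm⟩, ht⟩, rfl⟩
  calc M.encard ≤ _ := Set.encard_le_encard h2
    _ ≤ _ := Set.encard_image_le _ _
    _ = {p ∈ P | ‖m₀ - p‖ ≤ A * √δ}.encard * (T : Set (Fin (k + 1) → ℝ)).encard :=
        Set.encard_prod
    _ ≤ (N : ℕ∞) * (T.card : ℕ∞) := by
        rw [Set.encard_coe_eq_coe_finsetCard]
        gcongr
    _ = ((N * T.card : ℕ) : ℕ∞) := by push_cast; rfl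

/-! ### Inner boxes -/

/-- Split `err` into `b • m` and a tangential `w`. By `exists_norm_sub_le`, moving tangentially by
`w` leaves the slice of `S` by at most `‖w‖² / (2 * r)`, so both parts are `O(δ)`. The simplex
condition ensures that this slice belongs to `S`. -/
theorem mem_thickening_of_err {m : Q.L₀} (hm : ‖m‖ = 1) {x : Amb d} {δ E : ℝ} (hδ : 0 < δ)
    (hE : 0 ≤ E) (hE1 : E ≤ 1 / 4) (hEr : E ≤ c.r / 8)
    (hx : c.bary x ∈ stdSimplex ℝ (Fin (k + 1)))
    (h1 : |inner ℝ (c.err m x) m| ≤ E * δ) (h2 : ‖c.err m x‖ ≤ E * √δ) :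
    x ∈ Metric.thickening δ Q.surface := by
  have hr := c.r_pos
  have hss : √δ ^ 2 = δ := Real.sq_sqrt hδ.le
  set b := inner ℝ (c.err m x) m with hb
  set w := c.err m x - b • m with hw
  have hwm : inner ℝ w m = 0 := by
    have e1 : inner ℝ (b • m) m = b * inner ℝ m m := real_inner_smul_left m m b
    rw [hw, inner_sub_left, e1, real_inner_self_eq_norm_sq, hm, ← hb]
    ring
  have hwn : ‖w‖ ^ 2 ≤ ‖c.err m x‖ ^ 2 := by
    have : c.err m x = w + b • m := by rw [hw]; abel
    have e1 : inner ℝ w (b • m) = b * inner ℝ w m := real_inner_smul_right w m b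
    rw [this, norm_add_sq_real, e1, hwm]
    have := sq_nonneg ‖b • m‖
    linarith
  have hwE : ‖w‖ ^ 2 ≤ E ^ 2 * δ := by
    refine hwn.trans ?_
    rw [← hss, ← mul_pow]
    gcongr
  obtain ⟨m', hm', hle⟩ := (c.sectionG_isGaussParam hx).exists_norm_sub_le hr hm hwm
  refine Metric.mem_thickening_iff.2 ⟨_, c.pt_mem_surface hm' hx, ?_⟩
  have hxeq : x - c.pt m' (c.bary x) =
      (((c.sectionG (c.bary x) m + w - c.sectionG (c.bary x) m') + b • m : Q.L₀) : Amb d) := by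
    have h3 : (c.sectionG (c.bary x) m + w - c.sectionG (c.bary x) m') + b • m =
        c.Y x - c.sectionG (c.bary x) m' := by
      rw [hw, err]
      abel
    rw [h3, c.pt_eq, Submodule.coe_sub]
    rw [sub_eq_of_eq_add]
    rw [← add_assoc, sub_add_cancel]
    exact (c.Y_add_sum_bary x).symm
  rw [dist_eq_norm, hxeq]
  have hbm : ‖b • m‖ = |b| := by rw [norm_smul, hm, mul_one, Real.norm_eq_abs]
  calc ‖(((c.sectionG (c.bary x) m + w - c.sectionG (c.bary x) m') + b • m : Q.L₀) : Amb d)‖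
      = ‖(c.sectionG (c.bary x) m + w - c.sectionG (c.bary x) m') + b • m‖ := rfl
    _ ≤ ‖c.sectionG (c.bary x) m + w - c.sectionG (c.bary x) m'‖ + ‖b • m‖ := norm_add_le _ _
    _ ≤ E ^ 2 * δ / (2 * c.r) + E * δ := by
        rw [hbm]
        refine add_le_add (hle.trans ?_) h1
        gcongr
    _ ≤ 1 / 4 * δ + 1 / 4 * δ := by
        refine add_le_add ?_ (by gcongr)
        rw [div_le_iff₀ (by positivity)]
        have : E ^ 2 ≤ 1 / 4 * (c.r / 8) := by
          rw [sq]
          exact mul_le_mul hE1 hEr hE (by norm_num)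
        nlinarith [mul_pos hr hδ]
    _ < δ := by linarith

/-! ### Consistency -/

/-- Passing from `m'` to `m` adds `∑ bary x i • (G i m' - G i m)`. The weights may be negative but
are bounded, as `x` is near `S`, so each term is estimated separately: linearly in norm,
quadratically along `m`. Tilting the normal adds `E * √δ * H * √σ ≤ E * H * σ`. -/
theorem err_bounds_of_near {m m' : Q.L₀} (hm : ‖m‖ = 1) (hm' : ‖m'‖ = 1)
    {t' : Fin (k + 1) → ℝ} (ht' : t' ∈ stdSimplex ℝ (Fin (k + 1))) {x : Amb d} {δ σ E H : ℝ}
    (hδ : 0 < δ) (hδσ : δ ≤ σ) (hE : 0 ≤ E) (hH : 0 ≤ H) (hmm : ‖m - m'‖ ≤ H * √σ)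
    (h1 : |inner ℝ (c.err m' x) m'| ≤ E * δ) (h2 : ‖c.err m' x‖ ≤ E * √δ)
    (h3 : ‖x - c.pt m' t'‖ ≤ E) :
    |inner ℝ (c.err m x) m| ≤ (E + E * H + c.B ^ 2 * (1 + c.B * E) * H ^ 2) * σ ∧
      ‖c.err m x‖ ≤ (E + c.B ^ 2 * (1 + c.B * E) * H) * √σ := by
  have hB := c.B_pos
  have hr := c.r_pos
  have hσ : 0 < σ := hδ.trans_le hδσ
  have hss : √σ ^ 2 = σ := Real.sq_sqrt hσ.le
  have hsδ : √δ ≤ √σ := Real.sqrt_le_sqrt hδσ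
  have hs0 : 0 ≤ √σ := Real.sqrt_nonneg σ
  have hF : ∀ i, |c.bary x i| ≤ 1 + c.B * E := by
    intro i
    have g1 := c.abs_bary_sub_le x (c.pt m' t') i
    rw [c.bary_pt m' ht'.2] at g1
    have g2 : |t' i| ≤ 1 := by
      rw [abs_of_nonneg (ht'.1 i)]
      exact (mem_Icc_of_mem_stdSimplex ht' i).2
    have g3 : c.B * ‖x - c.pt m' t'‖ ≤ c.B * E := by gcongr
    have g4 : |c.bary x i| ≤ |c.bary x i - t' i| + |t' i| := by
      have := abs_add_le (c.bary x i - t' i) (t' i)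
      rwa [sub_add_cancel] at this
    linarith
  have herr : c.err m x = c.err m' x + ∑ i, c.bary x i • (c.G i m' - c.G i m) := by
    have := c.err_sub_err' m m' x
    rw [sub_eq_iff_eq_add'] at this
    rw [this, sectionG, sectionG, ← Finset.sum_sub_distrib]
    exact congrArg _ (Finset.sum_congr rfl fun i _ => (smul_sub _ _ _).symm)
  constructor
  · have e1 : inner ℝ (c.err m x) m = inner ℝ (c.err m' x) m' + inner ℝ (c.err m' x) (m - m') +
        ∑ i, c.bary x i * inner ℝ (c.G i m' - c.G i m) m := by
      have e0 : ∀ i, inner ℝ (c.bary x i • (c.G i m' - c.G i m)) m =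
          c.bary x i * inner ℝ (c.G i m' - c.G i m) m := fun i =>
        real_inner_smul_left (c.G i m' - c.G i m) m (c.bary x i)
      rw [herr, inner_add_left, sum_inner, inner_sub_right, Finset.sum_congr rfl fun i _ => e0 i]
      ring
    have e2 : |inner ℝ (c.err m' x) (m - m')| ≤ E * H * σ := by
      calc |inner ℝ (c.err m' x) (m - m')| ≤ ‖c.err m' x‖ * ‖m - m'‖ := abs_real_inner_le_norm _ _
        _ ≤ (E * √σ) * (H * √σ) := by
            gcongr
            exact h2.trans (by gcongr)
        _ = E * H * √σ ^ 2 := by ring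
        _ = E * H * σ := by rw [hss]
    have e3 : |∑ i, c.bary x i * inner ℝ (c.G i m' - c.G i m) m| ≤
        c.B * ((1 + c.B * E) * (c.B * (H ^ 2 * σ))) := by
      refine (Finset.abs_sum_le_sum_abs _ _).trans (c.sum_le_B_mul (by positivity) fun i => ?_)
      rw [abs_mul]
      refine mul_le_mul (hF i) ?_ (abs_nonneg _) (by positivity)
      have g1 := c.inner_G_sub_mem hm hm' i
      rw [← neg_sub, inner_neg_left, abs_neg, abs_of_nonneg (le_trans (by positivity) g1.1)]
      refine g1.2.trans ?_
      have : H ^ 2 * σ = (H * √σ) ^ 2 := by rw [mul_pow, hss]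
      rw [this]
      gcongr
    have e4 : E * δ ≤ E * σ := by gcongr
    rw [e1]
    have e5 := abs_add_le (inner ℝ (c.err m' x) m' + inner ℝ (c.err m' x) (m - m'))
      (∑ i, c.bary x i * inner ℝ (c.G i m' - c.G i m) m)
    have e6 := abs_add_le (inner ℝ (c.err m' x) m') (inner ℝ (c.err m' x) (m - m'))
    nlinarith
  · have e3 : ‖∑ i, c.bary x i • (c.G i m' - c.G i m)‖ ≤
        c.B * ((1 + c.B * E) * (c.B * (H * √σ))) := by
      refine (norm_sum_le _ _).trans (c.sum_le_B_mul (by positivity) fun i => ?_)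
      rw [norm_smul, Real.norm_eq_abs]
      refine mul_le_mul (hF i) ?_ (norm_nonneg _) (by positivity)
      refine (c.lip i m' m hm' hm).trans ?_
      rw [norm_sub_rev]
      gcongr
    have e4 : E * √δ ≤ E * √σ := by gcongr
    rw [herr]
    have e5 := norm_add_le (c.err m' x) (∑ i, c.bary x i • (c.G i m' - c.G i m))
    nlinarith

/-! ### Assembly of the coverings -/

set_option maxHeartbeats 1000000 in
/-- Sectors centered at the points with given barycentric coordinates on the `k`-planes with
normals in a maximal separated set form a sector covering. -/
theorem exists_isSectorCovering (hkd : k ≤ d) (T : Finset (Fin (k + 1) → ℝ)) {τ : ℝ} (hτ : 0 < τ)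
    (hT : ∀ t ∈ T, t ∈ stdSimplex ℝ (Fin (k + 1)) ∧ ∀ i, τ ≤ t i) {C₁ C₂ C₃ : ℝ}
    (hC₁ : 4 * c.D ≤ C₁) (hC₂ : 4 * c.D ≤ C₂) (hC₃ : 0 < C₃) :
    ∃ (s C' : ℝ) (K : ℕ) (N : ℝ → ℕ), 0 < s ∧ 0 < C' ∧
      ∀ (δ₀ : ℝ) (P : ℝ → Set Q.L₀) (e : ℝ → Amb d → OrthonormalBasis (Fin (d + 1)) ℝ (Amb d))
        (Ω : ℝ → Set (Amb d)) (η : ℝ), δ₀ ≤ 1 →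
        (∀ δ, 0 < δ → δ ≤ δ₀ → Q.IsMaximalSeparated √δ (P δ)) →
        (∀ δ, 0 < δ → δ ≤ δ₀ → ∀ a ∈ c.centers (P δ) T, Q.IsSectorFrame c.normal a (e δ a)) →
        4 * c.D * √δ₀ + 2 * η ≤ C₃ →
        (∀ t' ∈ stdSimplex ℝ (Fin (k + 1)), ∃ t ∈ T, ∀ m, ‖m‖ = 1 →
          ‖c.pt m t' - c.pt m t‖ ≤ η) →
        -- Finite overlap at `x` needs injectivity of the section map only at some `z` within `δ`,
        -- and only if `x` lies near a centre. Both coverings meet this condition, for different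
        -- reasons.
        (∀ δ, 0 < δ → δ ≤ δ₀ → ∀ x ∈ Ω δ, ∀ m, ‖m‖ = 1 → ∀ t ∈ T,
          ‖x - c.pt m t‖ ≤ c.D * (C₁ * δ + C₂ * √δ + C₃) →
          ∃ z, ‖x - z‖ ≤ δ ∧ c.Nondeg (c.bary z)) →
        Q.IsSectorCovering c.normal δ₀ (fun δ => c.centers (P δ) T) e C₁ C₂ C₃ s C' K N Ω := by
  have hD := c.D_pos
  have hD1 := c.one_le_D
  have hB := c.B_pos
  have hr := c.r_pos
  have hC₁0 : 0 < C₁ := by linarith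
  have hC₂0 : 0 < C₂ := by linarith
  set E := c.D * (C₁ + C₂ + C₃) with hE
  have hE0 : 0 < E := by positivity
  -- bounds on a box
  have hbox : ∀ s : ℝ, 0 ≤ s → ∀ δ : ℝ, 0 < δ → δ ≤ 1 → ∀ m, ‖m‖ = 1 → ∀ t, ∑ i, t i = 1 →
      ∀ e, c.IsFrameAt m e → ∀ x,
      x ∈ rectBox e (c.pt m t) (fun j => s * sectorSides d k C₁ C₂ C₃ δ j) →
      |inner ℝ (c.err m x) m| ≤ s * E * δ ∧ ‖c.err m x‖ ≤ s * E * √δ ∧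
        ‖x - c.pt m t‖ ≤ c.D * (s * (C₁ * δ + C₂ * √δ + C₃)) ∧ ‖x - c.pt m t‖ ≤ s * E := by
    intro s hs δ hδ hδ1 m hm t ht e he x hx
    obtain ⟨h1, h2, h3⟩ := of_mem_rectBox he hm ht hs hC₁0.le hC₂0.le hC₃.le hδ hδ1 hx
    have hsq1 : √δ ≤ 1 := Real.sqrt_le_one.2 hδ1
    have hsq0 : 0 ≤ √δ := Real.sqrt_nonneg δ
    refine ⟨h1.trans ?_, h2.trans ?_, h3, h3.trans ?_⟩
    · have : c.D * (s * C₁) ≤ s * E := by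
        rw [hE]
        have : 0 ≤ s * c.D * (C₂ + C₃) := by positivity
        nlinarith
      gcongr
    · have : c.D * (s * (C₁ + C₂)) ≤ s * E := by
        rw [hE]
        have : 0 ≤ s * c.D * C₃ := by positivity
        nlinarith
      gcongr
    · have g1 : C₁ * δ ≤ C₁ := mul_le_of_le_one_right hC₁0.le hδ1
      have g2 : C₂ * √δ ≤ C₂ := mul_le_of_le_one_right hC₂0.le hsq1
      have : c.D * (s * (C₁ * δ + C₂ * √δ + C₃)) ≤ c.D * (s * (C₁ + C₂ + C₃)) := by gcongr
      rw [hE]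
      linarith
  have hbox1 : ∀ δ : ℝ, 0 < δ → δ ≤ 1 → ∀ m, ‖m‖ = 1 → ∀ t, ∑ i, t i = 1 →
      ∀ e, c.IsFrameAt m e → ∀ x,
      x ∈ rectBox e (c.pt m t) (sectorSides d k C₁ C₂ C₃ δ) →
      |inner ℝ (c.err m x) m| ≤ E * δ ∧ ‖c.err m x‖ ≤ E * √δ ∧
        ‖x - c.pt m t‖ ≤ c.D * (C₁ * δ + C₂ * √δ + C₃) ∧ ‖x - c.pt m t‖ ≤ E := by
    intro δ hδ hδ1 m hm t ht e he x hx
    have := hbox 1 zero_le_one δ hδ hδ1 m hm t ht e he x (by simpa only [one_mul] using hx)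
    simpa only [one_mul] using this
  -- constants
  set s := min (1 / 4) (min (c.r / 8) (τ / c.B)) / E with hs
  have hs0 : 0 < s := by positivity
  have hsE : s * E = min (1 / 4) (min (c.r / 8) (τ / c.B)) := div_mul_cancel₀ _ hE0.ne'
  have hsE1 : s * E ≤ 1 / 4 := hsE.trans_le (min_le_left _ _)
  have hsE2 : s * E ≤ c.r / 8 := hsE.trans_le ((min_le_right _ _).trans (min_le_left _ _))
  have hsE3 : s * E ≤ τ / c.B := hsE.trans_le ((min_le_right _ _).trans (min_le_right _ _))
  set H := 2 * E / c.r + 1 with hH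
  have hH0 : 0 < H := by positivity
  set G₁ := E + E * H + c.B ^ 2 * (1 + c.B * E) * H ^ 2 with hG₁
  set G₂ := E + c.B ^ 2 * (1 + c.B * E) * H with hG₂
  have hG₁0 : 0 < G₁ := by positivity
  have hG₂0 : 0 < G₂ := by positivity
  -- Boxes use half the side lengths, which doubles `G₁` and `G₂`. The distance between centres and
  -- that from `x` to its own centre add up to `2 * E`.
  set C' := 2 * G₁ / C₁ + 2 * G₂ / C₂ + 4 * E / C₃ with hC'
  have hC'0 : 0 < C' := by positivity
  have hC'1 : 2 * G₁ ≤ C' * C₁ := by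
    rw [← div_le_iff₀ hC₁0, hC']
    have : 0 < 2 * G₂ / C₂ + 4 * E / C₃ := by positivity
    linarith
  have hC'2 : 2 * G₂ ≤ C' * C₂ := by
    rw [← div_le_iff₀ hC₂0, hC']
    have : 0 < 2 * G₁ / C₁ + 4 * E / C₃ := by positivity
    linarith
  have hC'3 : 4 * E ≤ C' * C₃ := by
    rw [← div_le_iff₀ hC₃, hC']
    have : 0 < 2 * G₁ / C₁ + 2 * G₂ / C₂ := by positivity
    linarith
  clear_value C' G₁ G₂ s
  -- For two sectors containing `x` the deviations at `z` are at most `(E + D) * √δ` each. Dividing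
  -- their sum by the constant `r / 2` of `Nondeg` bounds the distance between the normals.
  obtain ⟨K, hK⟩ := c.exists_encard_le T (4 * (E + c.D) / c.r)
  choose N hN using fun A : ℝ => c.exists_encard_le T (c.D * A)
  refine ⟨s, C', K, N, hs0, hC'0, ?_⟩
  intro δ₀ P e Ω η hδ₀ hP he hη1 hη2 hΩ
  have hPn : ∀ δ, 0 < δ → δ ≤ δ₀ → ∀ m ∈ P δ, ‖m‖ = 1 := fun δ hδ hδ' m hm =>
    mem_sphere_zero_iff_norm.1 ((hP δ hδ hδ').1 hm)
  have hfr : ∀ δ, 0 < δ → δ ≤ δ₀ → ∀ m ∈ P δ, ∀ t ∈ T, c.IsFrameAt m (e δ (c.pt m t)) :=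
    fun δ hδ hδ' m hm t ht => (c.isSectorFrame_iff (hPn δ hδ hδ' m hm) (hT t ht).1).1
      (he δ hδ hδ' _ ⟨m, hm, t, ht, rfl⟩)
  refine ⟨?_, he, ?_, ?_, ?_, ?_, ?_⟩
  · rintro δ hδ hδ' _ ⟨m, hm, t, ht, rfl⟩
    exact c.pt_mem_surface (hPn δ hδ hδ' m hm) (hT t ht).1
  · intro δ hδ hδ' x hx
    refine c.exists_mem_rectBox hkd hδ (hδ'.trans hδ₀) (hP δ hδ hδ') (fun t ht => (hT t ht).1)
      (he δ hδ hδ') hC₁ hC₂ (le_trans ?_ hη1) hη2 hx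
    gcongr
  · intro δ hδ hδ' x hx
    rcases Set.eq_empty_or_nonempty {a ∈ c.centers (P δ) T |
      x ∈ rectBox (e δ a) a (sectorSides d k C₁ C₂ C₃ δ)} with h0 | ⟨a₀, ⟨m₀, hm₀, t₀, ht₀, rfl⟩, hx₀⟩
    · rw [h0, Set.encard_empty]
      exact zero_le
    have hδ1 := hδ'.trans hδ₀
    have hδs : δ ≤ √δ := by
      rw [Real.le_sqrt hδ.le hδ.le]
      nlinarith
    have hm₀1 := hPn δ hδ hδ' m₀ hm₀
    have hb₀ := hbox1 δ hδ hδ1 m₀ hm₀1 t₀ (hT t₀ ht₀).1.2 _ (hfr δ hδ hδ' m₀ hm₀ t₀ ht₀) x hx₀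
    obtain ⟨z, hz, hnd⟩ := hΩ δ hδ hδ' x hx m₀ hm₀1 t₀ ht₀ hb₀.2.2.1
    have herr : ∀ m, ‖m‖ = 1 → ‖c.err m x‖ ≤ E * √δ → ‖c.err m z‖ ≤ (E + c.D) * √δ := by
      intro m hm h
      have h1 : c.err m z = c.err m x - c.R m (x - z) := by rw [← c.err_sub_err]; abel
      rw [h1]
      refine (norm_sub_le _ _).trans ?_
      have h2 := c.norm_R_le hm (x - z)
      have h3 : c.D * ‖x - z‖ ≤ c.D * √δ := by
        gcongr
        exact hz.trans hδs
      linarith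
    refine hK δ hδ (P δ) (hP δ hδ hδ') m₀ _ ?_
    rintro _ ⟨⟨m, hm, t, ht, rfl⟩, hxa⟩
    refine ⟨m, hm, t, ht, rfl, ?_⟩
    have hm1 := hPn δ hδ hδ' m hm
    have hb := hbox1 δ hδ hδ1 m hm1 t (hT t ht).1.2 _ (hfr δ hδ hδ' m hm t ht) x hxa
    have h1 := herr m hm1 hb.2.1
    have h2 := herr m₀ hm₀1 hb₀.2.1
    have h3 := hnd m₀ m hm₀1 hm1
    rw [← c.err_sub_err' m m₀ z] at h3
    have h4 := norm_sub_le (c.err m z) (c.err m₀ z)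
    rw [div_mul_eq_mul_div, le_div_iff₀ hr]
    linarith
  · rintro δ hδ hδ' _ ⟨m, hm, t, ht, rfl⟩ x hx
    have hm1 := hPn δ hδ hδ' m hm
    obtain ⟨h1, h2, -, h3⟩ := hbox s hs0.le δ hδ (hδ'.trans hδ₀) m hm1 t (hT t ht).1.2 _
      (hfr δ hδ hδ' m hm t ht) x hx
    constructor
    · refine c.mem_thickening_of_err hm1 hδ (by positivity) hsE1 hsE2 ⟨fun i => ?_, c.sum_bary x⟩
        h1 h2
      have g1 := c.abs_bary_sub_le x (c.pt m t) i
      rw [c.bary_pt m (hT t ht).1.2] at g1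
      have g2 : c.B * ‖x - c.pt m t‖ ≤ τ := by
        have := h3.trans hsE3
        rw [le_div_iff₀ hB] at this
        linarith
      have g3 := (abs_le.1 (g1.trans g2)).1
      linarith [(hT t ht).2 i]
    · rw [Set.mem_ofPred_eq, c.normal_pt hm1 (hT t ht).1, real_inner_comm]
      refine (c.abs_inner_nrm_le hm1 _).trans ?_
      rw [← c.err_eq_R m (hT t ht).1.2, real_inner_comm]
      refine h1.trans ?_
      nlinarith
  · rintro A δ hδ hδ' _ ⟨m, hm, t, ht, rfl⟩
    refine hN A δ hδ (P δ) (hP δ hδ hδ') m _ ?_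
    rintro _ ⟨⟨m', hm', t', ht', rfl⟩, hn⟩
    refine ⟨m', hm', t', ht', rfl, ?_⟩
    have hm1 := hPn δ hδ hδ' m hm
    have hm1' := hPn δ hδ hδ' m' hm'
    rw [c.normal_pt hm1 (hT t ht).1, c.normal_pt hm1' (hT t' ht').1] at hn
    refine (c.norm_sub_le_nrm hm1 hm1').trans ?_
    rw [mul_assoc]
    gcongr
  · rintro δ σ hδ hδσ hσ' _ ⟨m, hm, t, ht, rfl⟩ _ ⟨m', hm', t', ht', rfl⟩ hb x hx
    have hσ : 0 < σ := hδ.trans_le hδσ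
    have hδ' := hδσ.trans hσ'
    have hm1 := hPn σ hσ hσ' m hm
    have hm1' := hPn δ hδ hδ' m' hm'
    obtain ⟨h1, -, -, h2⟩ := hbox1 σ hσ (hσ'.trans hδ₀) m hm1 t (hT t ht).1.2 _
      (hfr σ hσ hσ' m hm t ht) _ hb
    obtain ⟨h3, h4, -, h5⟩ := hbox1 δ hδ (hδ'.trans hδ₀) m' hm1' t' (hT t' ht').1.2 _
      (hfr δ hδ hδ' m' hm' t' ht') _ hx
    -- The component along `m` of the deviation of the second centre is at least `r / 2 * ‖m - m'‖²`
    -- in absolute value and at most `E * σ`. Adding `1` in `H` avoids a square root.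
    have hmm : ‖m - m'‖ ≤ H * √σ := by
      rw [c.err_pt m' m (hT t' ht').1.2, ← neg_sub, inner_neg_left, abs_neg] at h1
      have g1 := (c.inner_sectionG_sub_mem (hT t' ht').1 hm1 hm1').1
      have g2 := g1.trans ((le_abs_self _).trans h1)
      refine le_of_sq_le_sq ?_ (by positivity)
      rw [mul_pow, Real.sq_sqrt hσ.le]
      have g3 : ‖m - m'‖ ^ 2 ≤ 2 * E / c.r * σ := by
        rw [div_mul_eq_mul_div, le_div_iff₀ hr]
        linarith
      refine g3.trans ?_
      have g4 : 0 < 2 * E / c.r := by positivity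
      gcongr
      rw [hH]
      nlinarith
    obtain ⟨g1, g2⟩ := c.err_bounds_of_near hm1 hm1' (hT t' ht').1 hδ hδσ hE0.le hH0.le hmm h3 h4 h5
    rw [← hG₁] at g1
    rw [← hG₂] at g2
    rw [sectorSides_mul]
    refine mem_rectBox hkd (hfr σ hσ hσ' m hm t ht) hm1 (hT t ht).1.2 ?_ ?_ ?_
    · refine g1.trans ?_
      have : 2 * G₁ * σ ≤ C' * C₁ * σ := by gcongr
      linarith
    · refine g2.trans ?_
      have : 2 * G₂ * √σ ≤ C' * C₂ * √σ := by gcongr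
      linarith
    · have := norm_sub_le_norm_sub_add_norm_sub x (c.pt m' t') (c.pt m t)
      linarith

/-- A finite net in the interior of the simplex. -/
theorem exists_interior_net {η : ℝ} (hη : 0 < η) :
    ∃ (T : Finset (Fin (k + 1) → ℝ)) (τ : ℝ), 0 < τ ∧
      (∀ t ∈ T, t ∈ stdSimplex ℝ (Fin (k + 1)) ∧ ∀ i, τ ≤ t i) ∧
      ∀ t' ∈ stdSimplex ℝ (Fin (k + 1)), ∃ t ∈ T, ‖t' - t‖ ≤ η := by
  classical
  obtain ⟨F, hFs, hF, hcov⟩ := (isCompact_stdSimplex ℝ (Fin (k + 1))).finite_cover_balls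
    (e := η / 2) (by positivity)
  set θ := min 1 (η / 2) with hθ
  have hθ0 : 0 < θ := by positivity
  have hθ1 : θ ≤ 1 := min_le_left _ _
  have hk0 : (0 : ℝ) < (k : ℝ) + 1 := by positivity
  -- A finite net of the closed simplex is contracted towards the barycentre, which makes every
  -- weight at least `θ / (k + 1)`.
  let f : (Fin (k + 1) → ℝ) → Fin (k + 1) → ℝ := fun t i => (1 - θ) * t i + θ * ((k : ℝ) + 1)⁻¹
  refine ⟨hF.toFinset.image f, θ * ((k : ℝ) + 1)⁻¹, by positivity, ?_, ?_⟩
  · intro t ht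
    obtain ⟨u, hu, rfl⟩ := Finset.mem_image.1 ht
    have hu' := hFs (hF.mem_toFinset.1 hu)
    have hge : ∀ i, θ * ((k : ℝ) + 1)⁻¹ ≤ f u i := fun i => by
      have := mul_nonneg (sub_nonneg.2 hθ1) (hu'.1 i)
      simp only [f]
      linarith
    refine ⟨⟨fun i => le_trans (by positivity) (hge i), ?_⟩, hge⟩
    simp only [f, Finset.sum_add_distrib, ← Finset.mul_sum, hu'.2]
    simp
    field_simp
    ring
  · intro t' ht'
    obtain ⟨u, hu, hd⟩ : ∃ u ∈ F, dist t' u < η / 2 := by simpa using hcov ht'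
    have hu' := hFs hu
    refine ⟨f u, Finset.mem_image.2 ⟨u, hF.mem_toFinset.2 hu, rfl⟩, ?_⟩
    have h1 : ‖u - f u‖ ≤ η / 2 := by
      rw [pi_norm_le_iff_of_nonneg (by positivity)]
      intro i
      have h2 : (u - f u) i = θ * (u i - ((k : ℝ) + 1)⁻¹) := by
        simp only [f, Pi.sub_apply]
        ring
      have h3 := mem_Icc_of_mem_stdSimplex hu' i
      have h4 : ((k : ℝ) + 1)⁻¹ ≤ 1 := inv_le_one_of_one_le₀ (by linarith [(Nat.cast_nonneg k : (0 : ℝ) ≤ k)])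
      have h5 : 0 < ((k : ℝ) + 1)⁻¹ := by positivity
      rw [h2, norm_mul, Real.norm_of_nonneg hθ0.le]
      have h6 : ‖u i - ((k : ℝ) + 1)⁻¹‖ ≤ 1 := by
        rw [Real.norm_eq_abs, abs_le]
        exact ⟨by linarith [h3.1], by linarith [h3.2]⟩
      calc θ * ‖u i - ((k : ℝ) + 1)⁻¹‖ ≤ η / 2 * 1 := by
            gcongr
            exact min_le_right _ _
        _ = η / 2 := mul_one _
    rw [dist_eq_norm] at hd
    have := norm_sub_le_norm_sub_add_norm_sub t' u (f u)
    linarith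

/-- Sectors short along the `k`-planes have barycentric coordinates at least `-ε` throughout, so
`nondeg_of_neg_le` applies at each of their points. A finite net of centres on each plane makes up
for the short length. -/
theorem satisfiesAssumptionA (c : Q.Chart) (hkd : k ≤ d) : Q.SatisfiesAssumptionA c.normal := by
  classical
  have hD := c.D_pos
  have hD1 := c.one_le_D
  have hB := c.B_pos
  have hr := c.r_pos
  -- Here `ε * B ^ 2 = r / 4`. The choice of `C₃` spends half of `ε`, and smallness of `q = √δ₀`
  -- leaves at most the other half to the remaining sides of the box.
  set ε := c.r / (4 * c.B ^ 2) with hε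
  have hε0 : 0 < ε := by positivity
  set C₃ := ε / (2 * c.D * c.B) with hC₃
  have hC₃0 : 0 < C₃ := by positivity
  have hC₃ε : c.B * (c.D * C₃) = ε / 2 := by
    rw [hC₃]
    field_simp
  obtain ⟨T, τ, hτ, hT, hnet⟩ := exists_interior_net (k := k)
    -- A net of this mesh moves points by at most `C₃ / 4`. This uses half of `C₃` in the covering
    -- condition and leaves the other half for `4 * D * √δ₀`.
    (η := C₃ / (8 * c.B ^ 2)) (by positivity)
  set q := min 1 (min (C₃ / (8 * c.D)) (ε / (16 * c.D ^ 2 * c.B))) with hq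
  have hq0 : 0 < q := by positivity
  have hq1 : q ≤ 1 := min_le_left _ _
  have hq2 : 4 * c.D * q ≤ C₃ / 2 := by
    have : q ≤ C₃ / (8 * c.D) := (min_le_right _ _).trans (min_le_left _ _)
    rw [le_div_iff₀ (by positivity)] at this
    linarith
  have hq3 : c.B * (c.D * (4 * c.D * q + 4 * c.D * q)) ≤ ε / 2 := by
    have : q ≤ ε / (16 * c.D ^ 2 * c.B) := (min_le_right _ _).trans (min_le_right _ _)
    rw [le_div_iff₀ (by positivity)] at this
    linarith
  have hsq : √(q ^ 2) = q := Real.sqrt_sq hq0.le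
  have hqq : q ^ 2 ≤ 1 := pow_le_one₀ hq0.le hq1
  obtain ⟨s, C', K, N, hs, hC', hcov⟩ := c.exists_isSectorCovering hkd T hτ hT le_rfl le_rfl hC₃0
  have hPex : ∀ δ : ℝ, ∃ P, 0 < δ → Q.IsMaximalSeparated √δ P := fun δ => by
    by_cases hδ : 0 < δ
    · obtain ⟨P, hP⟩ := Q.exists_isMaximalSeparated (Real.sqrt_pos.2 hδ)
      exact ⟨P, fun _ => hP⟩
    · exact ⟨∅, fun h => absurd h hδ⟩
  choose P hP using hPex
  have heex : ∀ a : Amb d, ∃ e, a ∈ Q.surface → Q.IsSectorFrame c.normal a e := fun a => by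
    by_cases ha : a ∈ Q.surface
    · obtain ⟨m, hm, t, ht, rfl⟩ := c.mem_surface_iff.1 ha
      obtain ⟨e, he⟩ := c.exists_isFrameAt hkd hm
      exact ⟨e, fun _ => (c.isSectorFrame_iff hm ht).2 he⟩
    · exact ⟨EuclideanSpace.basisFun _ ℝ, fun h => absurd h ha⟩
  choose e he using heex
  refine ⟨q ^ 2, 4 * c.D, 4 * c.D, C₃, s, C', K, N, by positivity, by positivity, by positivity,
    hC₃0, hs, hC', fun δ => c.centers (P δ) T, fun _ => e,
    hcov (q ^ 2) P (fun _ => e) _ (C₃ / 4) hqq (fun δ hδ _ => hP δ hδ) ?_ ?_ ?_ ?_⟩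
  · rintro δ hδ - _ ⟨m, hm, t, ht, rfl⟩
    exact he _ (c.pt_mem_surface (mem_sphere_zero_iff_norm.1 ((hP δ hδ).1 hm)) (hT t ht).1)
  · rw [hsq]
    linarith
  · intro t' ht'
    obtain ⟨t, ht, htt⟩ := hnet t' ht'
    refine ⟨t, ht, fun m hm => (c.norm_pt_sub_pt_le' hm t' t).trans ?_⟩
    rw [le_div_iff₀ (by positivity)] at htt
    linarith
  · intro δ hδ hδq x _ m hm t ht hx
    refine ⟨x, by simpa using hδ.le, c.nondeg_of_neg_le (c.sum_bary x) hε0.le ?_ fun i => ?_⟩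
    · rw [hε]
      field_simp
      exact le_rfl
    · have h1 := c.abs_bary_sub_le x (c.pt m t) i
      rw [c.bary_pt m (hT t ht).1.2] at h1
      have h2 : √δ ≤ q := by
        rw [← hsq]
        exact Real.sqrt_le_sqrt hδq
      have h3 : δ ≤ q := hδq.trans (by nlinarith)
      have h4 : c.D * (4 * c.D * δ + 4 * c.D * √δ + C₃) ≤
          c.D * (4 * c.D * q + 4 * c.D * q + C₃) := by gcongr
      have h5 : c.B * ‖x - c.pt m t‖ ≤ c.B * (c.D * (4 * c.D * q + 4 * c.D * q + C₃)) :=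
        mul_le_mul_of_nonneg_left (hx.trans h4) hB.le
      have h6 := (abs_le.1 h1).1
      have h7 := (hT t ht).1.1 i
      linarith

theorem centersOfMass_eq (c : Q.Chart) (P : Set Q.L₀) (hP : ∀ m ∈ P, ‖m‖ = 1) :
    Q.centersOfMass P = c.centers P {fun _ => ((k : ℝ) + 1)⁻¹} := by
  have hcm : ∀ m, centerOfMass (c.X m) = c.pt m fun _ => ((k : ℝ) + 1)⁻¹ := fun m => by
    rw [centerOfMass, pt, Finset.smul_sum]
  ext a
  constructor
  · rintro ⟨x, m, hm, hx, rfl⟩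
    obtain ⟨-, rfl⟩ := c.isGoodWith_iff.1 hx
    exact ⟨m, hm, _, Finset.mem_singleton_self _, hcm m⟩
  · rintro ⟨m, hm, t, ht, rfl⟩
    rw [Finset.mem_singleton] at ht
    subst ht
    exact ⟨c.X m, m, hm, c.isGoodWith_iff.2 ⟨hP m hm, rfl⟩, (hcm m).symm⟩

theorem exists_centerOfMass_covering (c : Q.Chart) (hkd : k ≤ d) :
    ∃ C₀ : ℝ, 0 < C₀ ∧ ∀ C : ℝ, C₀ ≤ C →
      ∃ (s C' c' : ℝ) (K : ℕ) (N : ℝ → ℕ), 0 < s ∧ 0 < C' ∧ 0 < c' ∧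
        ∀ P : ℝ → Set Q.L₀,
          (∀ δ, 0 < δ → δ ≤ 1 → Q.IsMaximalSeparated (Real.sqrt δ) (P δ)) →
          (∀ δ, 0 < δ → δ ≤ 1 → ∀ a ∈ Q.centersOfMass (P δ), ∀ b ∈ Q.centersOfMass (P δ),
            a ≠ b → c' * Real.sqrt δ ≤ ‖c.normal a - c.normal b‖) ∧
          ∀ e : ℝ → Amb d → OrthonormalBasis (Fin (d + 1)) ℝ (Amb d),
            (∀ δ, 0 < δ → δ ≤ 1 → ∀ a ∈ Q.centersOfMass (P δ),
              Q.IsSectorFrame c.normal a (e δ a)) →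
            Q.IsSectorCovering c.normal 1 (fun δ => Q.centersOfMass (P δ)) e C C C s C' K N
              (fun δ => Q.slab ∪ Metric.thickening δ Q.surface) := by
  have hD := c.D_pos
  have hB := c.B_pos
  have hk0 : (0 : ℝ) < (k : ℝ) + 1 := by positivity
  set t₀ : Fin (k + 1) → ℝ := fun _ => ((k : ℝ) + 1)⁻¹ with ht₀
  have ht₀s : t₀ ∈ stdSimplex ℝ (Fin (k + 1)) := by
    refine ⟨fun i => by positivity, ?_⟩
    simp [ht₀]
    field_simp
  -- Any two weights in the simplex differ by at most `1` in each coordinate, so the barycentre is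
  -- within `2 * B ^ 2` of every point of its `k`-plane. The constant is the covering condition with
  -- `δ₀ = 1`.
  refine ⟨4 * c.D + 4 * c.B ^ 2, by positivity, fun C hC => ?_⟩
  have hB2 : 0 < 4 * c.B ^ 2 := by positivity
  obtain ⟨s, C', K, N, hs, hC', hcov⟩ := c.exists_isSectorCovering hkd {t₀} (inv_pos.2 hk0)
    (by
      intro t ht
      rw [Finset.mem_singleton] at ht
      subst ht
      exact ⟨ht₀s, fun i => le_rfl⟩)
    (C₁ := C) (C₂ := C) (C₃ := C) (by linarith) (by linarith) (by linarith)
  refine ⟨s, C', c.D⁻¹, K, N, hs, hC', by positivity, fun P hP => ⟨?_, fun e he => ?_⟩⟩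
  · intro δ hδ hδ1 a ha b hb hab
    have hP1 : ∀ m ∈ P δ, ‖m‖ = 1 := fun m hm =>
      mem_sphere_zero_iff_norm.1 ((hP δ hδ hδ1).1 hm)
    rw [c.centersOfMass_eq _ hP1] at ha hb
    obtain ⟨m, hm, t, ht, rfl⟩ := ha
    obtain ⟨m', hm', t', ht', rfl⟩ := hb
    rw [Finset.mem_singleton] at ht ht'
    subst ht
    subst ht'
    have hne : m ≠ m' := fun h => hab (by rw [h])
    have h1 := (hP δ hδ hδ1).2.1 m hm m' hm' hne
    rw [c.normal_pt (hP1 m hm) ht₀s, c.normal_pt (hP1 m' hm') ht₀s, inv_mul_le_iff₀ hD]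
    rw [dist_eq_norm] at h1
    exact h1.trans (c.norm_sub_le_nrm (hP1 m hm) (hP1 m' hm'))
  · have heq : ∀ δ, 0 < δ → δ ≤ 1 → Q.centersOfMass (P δ) = c.centers (P δ) {t₀} :=
      fun δ hδ hδ1 => c.centersOfMass_eq _ fun m hm =>
        mem_sphere_zero_iff_norm.1 ((hP δ hδ hδ1).1 hm)
    have key := hcov 1 P e (fun δ => Q.slab ∪ Metric.thickening δ Q.surface) (2 * c.B ^ 2) le_rfl hP
      (fun δ hδ hδ1 a ha => he δ hδ hδ1 a (by rwa [heq δ hδ hδ1]))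
      (by rw [Real.sqrt_one]; linarith)
      (by
        intro t' ht'
        refine ⟨t₀, Finset.mem_singleton_self _, fun m hm =>
          (c.norm_pt_sub_pt_le' hm t' t₀).trans ?_⟩
        refine mul_le_of_le_one_right (by positivity) ?_
        rw [pi_norm_le_iff_of_nonneg zero_le_one]
        intro i
        have h1 := mem_Icc_of_mem_stdSimplex ht' i
        have h2 := mem_Icc_of_mem_stdSimplex ht₀s i
        rw [Pi.sub_apply, Real.norm_eq_abs, abs_le]
        exact ⟨by linarith [h1.1, h2.2], by linarith [h1.2, h2.1]⟩)
      (by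
        -- In the slab the weights of `x` itself lie in the simplex. In the `δ`-neighbourhood a
        -- nearby point of `S` is used instead.
        rintro δ hδ - x (hx | hx) m - t - -
        · exact ⟨x, by simpa using hδ.le, c.nondeg_of_mem_stdSimplex (c.mem_slab_iff.1 hx)⟩
        · obtain ⟨z, hz, hxz⟩ := Metric.mem_thickening_iff.1 hx
          rw [dist_eq_norm] at hxz
          exact ⟨z, hxz.le, c.nondeg_of_mem_stdSimplex (c.bary_mem_of_mem_surface hz)⟩)
    refine ⟨?_, he, ?_, ?_, ?_, ?_, ?_⟩
    · intro δ hδ hδ1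
      rw [heq δ hδ hδ1]
      exact key.centers δ hδ hδ1
    · intro δ hδ hδ1
      rw [heq δ hδ hδ1]
      exact key.cover δ hδ hδ1
    · intro δ hδ hδ1
      rw [heq δ hδ hδ1]
      exact key.overlap δ hδ hδ1
    · intro δ hδ hδ1
      rw [heq δ hδ hδ1]
      exact key.inner_box δ hδ hδ1
    · intro A δ hδ hδ1
      rw [heq δ hδ hδ1]
      exact key.angular A δ hδ hδ1
    · intro δ σ hδ hδσ hσ1
      rw [heq δ hδ (hδσ.trans hσ1), heq σ (hδ.trans_le hδσ) hσ1]
      exact key.consistency δ σ hδ hδσ hσ1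

end Chart

end KCone

end

/-! ### The theorem -/

theorem mainTheorem3 (d k : ℕ) (hk : 1 ≤ k) (hkd : k + 1 ≤ d) (Q : KCone d k) :
    -- cross-sections parallel to `L₀`
    (∀ p : Amb d, (Q.surface ∩ Q.parallel p).Nonempty →
      ∃ K : Set Q.L₀, IsSmoothStrictlyConvexBody K ∧
        Q.section_ p Q.surface = frontier K ∧
        (∀ x, Q.IsGood x → ∃! z, z ∈ kPlane x ∧ z ∈ Q.parallel p) ∧
        ∃ φ : Amb d → Amb d, SmoothOnSubset φ (Q.E 0) ∧
          ∀ x m, Q.IsGoodWith x m →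
            φ (x 0) ∈ kPlane x ∧
            ∃ y ∈ frontier K, φ (x 0) = p + (y : Amb d) ∧ IsOutwardUnitNormal K y m) ∧
    -- each `η(x₀, …, x_k)` is a `k`-dimensional simplex, and different ones do not intersect
    (∀ x, Q.IsGood x → AffineIndependent ℝ x) ∧
    (∀ x y, Q.IsGood x → Q.IsGood y → x ≠ y → Disjoint (kPlane x) (kPlane y)) ∧
    (∀ a ∈ Q.surface, ∃! x, Q.IsGood x ∧ a ∈ kPlane x) ∧
    -- `S` is a smooth hypersurface, up to its boundary
    (∀ a ∈ Q.surface, ∃ (U : Set (Amb d)) (ρ : Amb d → ℝ), IsOpen U ∧ a ∈ U ∧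
      ContDiffOn ℝ ∞ ρ U ∧ (∃ w ∈ Q.L₀, fderiv ℝ ρ a w ≠ 0) ∧
      Q.surface ∩ U = {z ∈ U | z ∈ Q.slab ∧ ρ z = 0}) ∧
    ∃ n : Amb d → Amb d, IsUnitNormalField Q.surface n ∧
      (∀ a ∈ Q.surface, ∃ e, Q.IsSectorFrame n a e) ∧
      -- Assumption (A)
      Q.SatisfiesAssumptionA n ∧
      -- the covering by sectors centered at the centers of mass
      ∃ C₀ : ℝ, 0 < C₀ ∧ ∀ C : ℝ, C₀ ≤ C →
        ∃ (c C' c' : ℝ) (K : ℕ) (N : ℝ → ℕ), 0 < c ∧ 0 < C' ∧ 0 < c' ∧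
          ∀ P : ℝ → Set Q.L₀,
            (∀ δ, 0 < δ → δ ≤ 1 → Q.IsMaximalSeparated (Real.sqrt δ) (P δ)) →
            (∀ δ, 0 < δ → δ ≤ 1 → ∀ a ∈ Q.centersOfMass (P δ), ∀ b ∈ Q.centersOfMass (P δ),
              a ≠ b → c' * Real.sqrt δ ≤ ‖n a - n b‖) ∧
            ∀ e : ℝ → Amb d → OrthonormalBasis (Fin (d + 1)) ℝ (Amb d),
              (∀ δ, 0 < δ → δ ≤ 1 → ∀ a ∈ Q.centersOfMass (P δ),
                Q.IsSectorFrame n a (e δ a)) →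
              Q.IsSectorCovering n 1 (fun δ => Q.centersOfMass (P δ)) e C C C c C' K N
                (fun δ => Q.slab ∪ Metric.thickening δ Q.surface) := by
  obtain ⟨c⟩ := Q.exists_chart
  have hkd' : k ≤ d := by omega
  -- The dimension of `L₀` is `d + 1 - k`, which is positive, so the unit sphere is nonempty and the
  -- sections have interior points.
  have : Nontrivial Q.L₀ := by
    apply Module.nontrivial_of_finrank_pos (R := ℝ)
    have := Q.finrank_L₀
    omega
  refine ⟨fun p hp => c.exists_section p hp, ?_, ?_, ?_, fun a ha => c.exists_defining_function ha,
    c.normal, c.isUnitNormalField, ?_, c.satisfiesAssumptionA hkd',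
    c.exists_centerOfMass_covering hkd'⟩
  · intro x hx
    obtain ⟨m, -, rfl⟩ := c.isGood_iff.1 hx
    exact c.affineIndependent_X m
  · intro x y hx hy hxy
    obtain ⟨m, hm, rfl⟩ := c.isGood_iff.1 hx
    obtain ⟨m', hm', rfl⟩ := c.isGood_iff.1 hy
    exact c.disjoint_kPlane hm hm' fun h => hxy (by rw [h])
  · rintro a ⟨x, hx, hax⟩
    refine ⟨x, ⟨hx, hax⟩, ?_⟩
    rintro y ⟨hy, hay⟩
    obtain ⟨m, hm, rfl⟩ := c.isGood_iff.1 hx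
    obtain ⟨m', hm', rfl⟩ := c.isGood_iff.1 hy
    by_contra hne
    exact Set.disjoint_left.1 (c.disjoint_kPlane hm' hm fun h => hne (by rw [h])) hay hax
  · intro a ha
    obtain ⟨m, hm, t, ht, rfl⟩ := c.mem_surface_iff.1 ha
    obtain ⟨e, he⟩ := c.exists_isFrameAt hkd' hm
    exact ⟨e, (c.isSectorFrame_iff hm ht).2 he⟩
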